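/- Let $V:\mathbb R^4\to\mathbb R$ be a real potential which is not almost everywhere zero, and let $H=\Delta^2+V$ on $L^2=L^2(\mathbb R^4;\mathbb C)$, the operator of the quadratic form $\int(|\Delta u|^2+V|u|^2)\,dx$ with domain $H^2(\mathbb R^4)$. Write $\langle t\rangle=(1+|t|^2)^{1/2}$, $(f,g)=\int f\bar g\,dx$, and let $M_f$ be multiplication by $f$. Put $v=|V|^{1/2}$, $U(x)=1$ if $V(x)\ge 0$ and $U(x)=-1$ if $V(x)<0$, and $w=Uv$. Let $N_0,G_2,G_4$ be the convolutions with $$N_0(x)=-\frac{\log|x|}{8\pi^2},\qquad G_2(x)=-\frac{i|x|^2}{4^4\pi},\qquad G_4(x)=\frac{|x|^4}{3\cdot 4^3}.$$ Let $T_0=M_U+M_vN_0M_v$, let $P$ be the orthogonal projection of $L^2$ onto $\mathbb C v$ and $Q=1-P$. The operator $H$ is *singular at zero* if $QT_0Q$ is not invertible in $QL^2$. Let $S_1,S_2,S_3,S_4$ be the orthogonal projections onto the successive kernels $$S_1L^2=\operatorname{Ker}_{QL^2}QT_0Q,\quad S_2L^2=\operatorname{Ker}_{S_1L^2}T_1,\quad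 S_3L^2=\operatorname{Ker}_{S_2L^2}T_2,\quad S_4L^2=\operatorname{Ker}_{S_3L^2}T_3,$$ where $T_1=S_1T_0PT_0S_1$, $T_2=S_2M_vG_2M_vS_2$, $T_3=S_3M_vG_4M_vS_3$; here $T_2$ and $T_3$ are understood through their absolutely convergent sesquilinear forms $\iint G(x-y)(v\zeta)(y)\overline{(v\eta)(x)}\,dx\,dy$ on $S_2L^2$ and $S_3L^2$. $H$ has a *singularity of the first kind* at zero if it is singular at zero and $T_1$ is invertible in $S_1L^2$. Let $$\mathcal N_\infty(H)=\{u\in L^\infty(\mathbb R^4):\ \Delta^2u+Vu=0\ \text{in the sense of distributions}\},$$ and for functions in it consider the expansion $$\varphi(x)=-c_0+\frac{\mathbf a\cdot x}{|x|^2}+\frac{Ax\cdot x}{|x|^4}+O(|x|^{-3})\qquad(|x|\to\infty),\qquad(*)$$ with $c_0\in\mathbb C$, $\mathbf a\in\mathbb C^4$ and $A$ a complex symmetric $4\times4$ matrix. A nonzero $\varphi\in\mathcal N_\infty(H)$ is an *$s$-wave resonance* if $c_0\ne0$, a *$p$-wave resonance* if $c_0=0$ and $\mathbf a\neq0$, a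 *$d$-wave resonance* if $c_0=0$, $\mathbf a=0$ and $A\ne0$. The condition $c_0\neq 0$ refers only to the leading behaviour $\varphi(x)=-c_0+o(1)$. Finally put $$\Phi(\zeta)=N_0M_v\zeta-\|v\|^{-2}(PT_0\zeta,v).$$ Assume $\langle\log|x|\rangle^2V\in L^1\cap L^q$ for some $q>1$. Then $T_0$ is a bounded operator on $L^2$, and the following hold. (1) $H$ is singular at zero if and only if $\mathcal N_\infty(H)\ne\{0\}$. In this case $\Phi$ is an isomorphism from $S_1L^2$ onto $\mathcal N_\infty(H)$, with inverse $\varphi\mapsto-w\varphi$. (2) If $H$ has a singularity of the first kind at zero, then $\operatorname{rank}S_1=1$ and every nonzero $\varphi\in\mathcal N_\infty(H)$ is an $s$-wave resonance. (3) If moreover $\langle\log|x|\rangle^2\langle x\rangle^3V\in L^1\cap L^q$ for some $q>1$, then $\Phi(\zeta)$ has an expansion $(*)$ for every $\zeta\in S_1L^2$, and $\Phi$ maps every nonzero $\zeta$ in $S_1L^2\ominus S_2L^2$, $S_2L^2\ominus S_3L^2$, $S_3L^2\ominus S_4L^2$ and $S_4L^2$ to an $s$-wave resonance, a $p$-wave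 resonance, a $d$-wave resonance and a zero-energy eigenfunction of $H$, respectively. In the last case $\Phi(\zeta)\in\mathcal N_\infty(H)$, the expansion $(*)$ holds with $c_0=0$, $\mathbf a=0$, $A=0$, and $0\neq\Phi(\zeta)\in D(H)$ with $H\Phi(\zeta)=0$. -/

import Mathlib

open MeasureTheory Filter Topology Asymptotics InnerProductSpace Laplacian
open scoped ENNReal ContDiff ComplexConjugate

noncomputable section

namespace Bilaplace

/-- The Euclidean space of dimension four. -/
abbrev E := EuclideanSpace ℝ (Fin 4)

/-- The complex Hilbert space `L²(ℝ⁴)`.  The pairing `(f, g) = ∫ f \bar g` is `inner ℂ g f`. -/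
abbrev L2 := Lp ℂ 2 (volume : Measure E)

/-- The complex Banach space `L^∞(ℝ⁴)`. -/
abbrev LInf := Lp ℂ ∞ (volume : Measure E)

/-! ### The potential and the functions `v`, `U`, `w` -/

/-- `⟨log|x|⟩² ⟨x⟩ᵏ V ∈ L¹ ∩ L^q` for some `q > 1`, where `⟨t⟩ = (1 + |t|²)^{1/2}`. -/
def LogDecay (k : ℝ) (V : E → ℝ) : Prop :=
  ∃ q : ℝ≥0∞, 1 < q ∧
    MemLp (fun x : E => (1 + Real.log ‖x‖ ^ 2) * (1 + ‖x‖ ^ 2) ^ (k / 2) * V x) 1 volume ∧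
    MemLp (fun x : E => (1 + Real.log ‖x‖ ^ 2) * (1 + ‖x‖ ^ 2) ^ (k / 2) * V x) q volume

/-- `v = |V|^{1/2}`. -/
def vFun (V : E → ℝ) (x : E) : ℝ := Real.sqrt |V x|

/-- The sign `U` of `V`, with the value `1` on `{V = 0}`, so that `U² = 1`. -/
def uFun (V : E → ℝ) (x : E) : ℝ := if 0 ≤ V x then 1 else -1

/-- `w = U v`, so that `V = v w`. -/
def wFun (V : E → ℝ) (x : E) : ℝ := uFun V x * vFun V x

open Classical in
/-- `v` as a vector of `L²` (it is one as soon as `V ∈ L¹`). -/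
def vVec (V : E → ℝ) : L2 :=
  if h : MemLp (fun x => (vFun V x : ℂ)) 2 volume then h.toLp _ else 0

/-! ### The kernels -/

/-- `N₀(x) = -log|x| / (8π²)`. -/
def N0 (x : E) : ℂ := ((-(Real.log ‖x‖) / (8 * Real.pi ^ 2) : ℝ) : ℂ)

/-- `G₂(x) = -i|x|² / (4⁴π)`. -/
def G2 (x : E) : ℂ := -Complex.I * ((‖x‖ ^ 2 / (4 ^ 4 * Real.pi) : ℝ) : ℂ)

/-- `G₄(x) = |x|⁴ / (3·4³)`. -/
def G4 (x : E) : ℂ := ((‖x‖ ^ 4 / (3 * 4 ^ 3) : ℝ) : ℂ)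

/-- `(N₀ M_v ζ)(x) = ∫ N₀(x - y) v(y) ζ(y) dy`. -/
def N0v (V : E → ℝ) (ζ : E → ℂ) (x : E) : ℂ := ∫ y, N0 (x - y) * ((vFun V y : ℂ) * ζ y)

/-! ### The operators `T₀`, `P`, `Q` -/

/-- `T` is the bounded operator `M_U + M_v N₀ M_v` on `L²`. -/
def IsT0 (V : E → ℝ) (T : L2 →L[ℂ] L2) : Prop :=
  ∀ ζ : L2, T ζ =ᵐ[volume] fun x => (uFun V x : ℂ) * ζ x + (vFun V x : ℂ) * N0v V ζ x

open Classical in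
/-- `T₀ = M_U + M_v N₀ M_v`.  The kernel of `M_v N₀ M_v` is square integrable for the potentials
considered here, so that the bounded operator exists; it is then unique. -/
def T0 (V : E → ℝ) : L2 →L[ℂ] L2 := if h : ∃ T, IsT0 V T then h.choose else 0

/-- `P`, the orthogonal projection of `L²` onto the span of `v`. -/
def P (V : E → ℝ) : L2 →L[ℂ] L2 := (ℂ ∙ vVec V).starProjection

/-- The range `Q L²` of `Q = 1 - P`. -/
def QL2 (V : E → ℝ) : Submodule ℂ L2 := (ℂ ∙ vVec V)ᗮ

instance (V : E → ℝ) : CompleteSpace (QL2 V) := by unfold QL2; infer_instance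

/-- For the orthogonal projection `S` onto the closed subspace `K`: the part of `S A S` in `K`. -/
def part (K : Submodule ℂ L2) [CompleteSpace K] (A : L2 →L[ℂ] L2) : K →L[ℂ] K :=
  K.orthogonalProjectionOnto ∘L A ∘L K.subtypeL

/-- The kernel in `K` of the part of `S A S` in `K`, as a subspace of `L²`. -/
def kerPart (K : Submodule ℂ L2) [CompleteSpace K] (A : L2 →L[ℂ] L2) : Submodule ℂ L2 :=
  (LinearMap.ker (part K A).toLinearMap).map K.subtype

instance (K : Submodule ℂ L2) [CompleteSpace K] (A : L2 →L[ℂ] L2) :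
    CompleteSpace (kerPart K A) := by
  have h1 : IsComplete ((LinearMap.ker (part K A).toLinearMap : Submodule ℂ K) : Set K) :=
    (ContinuousLinearMap.isClosed_ker (part K A)).isComplete
  have h2 : IsComplete (K.subtypeₗᵢ '' (LinearMap.ker (part K A).toLinearMap : Set K)) :=
    (LinearIsometry.isComplete_image_iff K.subtypeₗᵢ).2 h1
  exact completeSpace_coe_iff_isComplete.2 h2

/-- The kernel in `K` of `S M_v G M_v S`, where `S` is the orthogonal projection onto `K` and `G` is
the convolution with `G(x)`.  The operator is read through its sesquilinear form
`∬ G(x - y) (vζ)(y) \bar{(vη)(x)} dx dy` on `K`, which has to converge absolutely: under the decay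
assumed below this holds on the subspaces concerned, although `M_v G M_v` need not be bounded on the
whole of `L²`. -/
def kerForm (V : E → ℝ) (G : E → ℂ) (K : Submodule ℂ L2) : Submodule ℂ L2 where
  carrier := {ζ | ζ ∈ K ∧ ∀ η ∈ K,
    Integrable (fun p : E × E =>
      G (p.1 - p.2) * ((vFun V p.2 : ℂ) * ζ p.2) * conj ((vFun V p.1 : ℂ) * η p.1)) ∧
    ∫ p : E × E,
      G (p.1 - p.2) * ((vFun V p.2 : ℂ) * ζ p.2) * conj ((vFun V p.1 : ℂ) * η p.1) = 0}
  zero_mem' := by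
    refine ⟨K.zero_mem, fun η _ => ?_⟩
    have h : (fun p : E × E => G (p.1 - p.2) * ((vFun V p.2 : ℂ) * (0 : L2) p.2) *
        conj ((vFun V p.1 : ℂ) * η p.1)) =ᵐ[volume] fun _ => 0 := by
      have := (Measure.quasiMeasurePreserving_snd (μ := (volume : Measure E))
        (ν := (volume : Measure E))).ae (Lp.coeFn_zero ℂ 2 (volume : Measure E))
      filter_upwards [this] with p hp
      rw [hp]; simp
    exact ⟨(integrable_congr h).2 (integrable_zero _ _ _), by rw [integral_congr_ae h]; simp⟩
  add_mem' := by
    rintro a b ⟨ha, ha'⟩ ⟨hb, hb'⟩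
    refine ⟨K.add_mem ha hb, fun η hη => ?_⟩
    have h : (fun p : E × E => G (p.1 - p.2) * ((vFun V p.2 : ℂ) * (a + b : L2) p.2) *
        conj ((vFun V p.1 : ℂ) * η p.1)) =ᵐ[volume] fun p =>
        G (p.1 - p.2) * ((vFun V p.2 : ℂ) * a p.2) * conj ((vFun V p.1 : ℂ) * η p.1) +
        G (p.1 - p.2) * ((vFun V p.2 : ℂ) * b p.2) * conj ((vFun V p.1 : ℂ) * η p.1) := by
      have := (Measure.quasiMeasurePreserving_snd (μ := (volume : Measure E))
        (ν := (volume : Measure E))).ae (Lp.coeFn_add a b)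
      filter_upwards [this] with p hp
      rw [hp, Pi.add_apply]; ring
    obtain ⟨i1, e1⟩ := ha' η hη
    obtain ⟨i2, e2⟩ := hb' η hη
    exact ⟨(integrable_congr h).2 (i1.add i2), by
      rw [integral_congr_ae h, integral_add i1 i2, e1, e2, add_zero]⟩
  smul_mem' := by
    rintro c a ⟨ha, ha'⟩
    refine ⟨K.smul_mem c ha, fun η hη => ?_⟩
    have h : (fun p : E × E => G (p.1 - p.2) * ((vFun V p.2 : ℂ) * (c • a : L2) p.2) *
        conj ((vFun V p.1 : ℂ) * η p.1)) =ᵐ[volume] fun p =>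
        c * (G (p.1 - p.2) * ((vFun V p.2 : ℂ) * a p.2) * conj ((vFun V p.1 : ℂ) * η p.1)) := by
      have := (Measure.quasiMeasurePreserving_snd (μ := (volume : Measure E))
        (ν := (volume : Measure E))).ae (Lp.coeFn_smul c a)
      filter_upwards [this] with p hp
      rw [hp, Pi.smul_apply, smul_eq_mul]; ring
    obtain ⟨i1, e1⟩ := ha' η hη
    exact ⟨(integrable_congr h).2 (i1.const_mul c), by
      rw [integral_congr_ae h, integral_const_mul, e1, mul_zero]⟩

/-! ### Singularities of `H = Δ² + V` at zero -/

/-- `H` is singular at zero: `Q T₀ Q` is not invertible in `Q L²`. -/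
def IsSingularAtZero (V : E → ℝ) : Prop := ¬ IsUnit (part (QL2 V) (T0 V))

/-- `S₁ L²`, the kernel of `Q T₀ Q` in `Q L²`. -/
def S1 (V : E → ℝ) : Submodule ℂ L2 := kerPart (QL2 V) (T0 V)

instance (V : E → ℝ) : CompleteSpace (S1 V) := by unfold S1; infer_instance

/-- `H` has a singularity of the first kind at zero: it is singular at zero and
`T₁ = S₁ T₀ P T₀ S₁` is invertible in `S₁ L²`. -/
def IsFirstKind (V : E → ℝ) : Prop :=
  IsSingularAtZero V ∧ IsUnit (part (S1 V) (T0 V ∘L P V ∘L T0 V))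

/-- `S₂ L²`, the kernel of `T₁ = S₁ T₀ P T₀ S₁` in `S₁ L²`. -/
def S2 (V : E → ℝ) : Submodule ℂ L2 := kerPart (S1 V) (T0 V ∘L P V ∘L T0 V)

/-- `S₃ L²`, the kernel of `T₂ = S₂ M_v G₂ M_v S₂` in `S₂ L²`. -/
def S3 (V : E → ℝ) : Submodule ℂ L2 := kerForm V G2 (S2 V)

/-- `S₄ L²`, the kernel of `T₃ = S₃ M_v G₄ M_v S₃` in `S₃ L²`. -/
def S4 (V : E → ℝ) : Submodule ℂ L2 := kerForm V G4 (S3 V)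

/-- `Φ(ζ) = N₀ M_v ζ - ‖v‖⁻² (P T₀ ζ, v)`. -/
def Phi (V : E → ℝ) (ζ : L2) (x : E) : ℂ :=
  N0v V ζ x - ((‖vVec V‖ ^ 2)⁻¹ : ℝ) * inner ℂ (vVec V) (P V (T0 V ζ))

/-! ### Bounded solutions of `(Δ² + V) u = 0` -/

/-- Complex test functions on `ℝ⁴`. -/
def IsTest (ψ : E → ℂ) : Prop := ContDiff ℝ ∞ ψ ∧ HasCompactSupport ψ

/-- `N_∞(H)`: the functions `u ∈ L^∞(ℝ⁴)` with `Δ²u + Vu = 0` in the sense of distributions. -/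
def NInf (V : E → ℝ) : Submodule ℂ LInf where
  carrier := {u | ∀ ψ : E → ℂ, IsTest ψ →
    Integrable (fun x => u x * Δ (Δ ψ) x + (V x : ℂ) * u x * ψ x) ∧
    ∫ x, (u x * Δ (Δ ψ) x + (V x : ℂ) * u x * ψ x) = 0}
  zero_mem' := by
    intro ψ _
    have h : (fun x => (0 : LInf) x * Δ (Δ ψ) x + (V x : ℂ) * (0 : LInf) x * ψ x)
        =ᵐ[volume] fun _ => 0 := by
      filter_upwards [Lp.coeFn_zero ℂ ∞ (volume : Measure E)] with x hx
      rw [hx]; simp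
    exact ⟨(integrable_congr h).2 (integrable_zero _ _ _), by rw [integral_congr_ae h]; simp⟩
  add_mem' := by
    intro a b ha hb ψ hψ
    have h : (fun x => (a + b : LInf) x * Δ (Δ ψ) x + (V x : ℂ) * (a + b : LInf) x * ψ x)
        =ᵐ[volume] fun x => (a x * Δ (Δ ψ) x + (V x : ℂ) * a x * ψ x) +
          (b x * Δ (Δ ψ) x + (V x : ℂ) * b x * ψ x) := by
      filter_upwards [Lp.coeFn_add a b] with x hx
      rw [hx, Pi.add_apply]; ring
    obtain ⟨i1, e1⟩ := ha ψ hψ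
    obtain ⟨i2, e2⟩ := hb ψ hψ
    exact ⟨(integrable_congr h).2 (i1.add i2), by
      rw [integral_congr_ae h, integral_add i1 i2, e1, e2, add_zero]⟩
  smul_mem' := by
    intro c a ha ψ hψ
    have h : (fun x => (c • a : LInf) x * Δ (Δ ψ) x + (V x : ℂ) * (c • a : LInf) x * ψ x)
        =ᵐ[volume] fun x => c * (a x * Δ (Δ ψ) x + (V x : ℂ) * a x * ψ x) := by
      filter_upwards [Lp.coeFn_smul c a] with x hx
      rw [hx, Pi.smul_apply, smul_eq_mul]; ring
    obtain ⟨i1, e1⟩ := ha ψ hψ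
    exact ⟨(integrable_congr h).2 (i1.const_mul c), by
      rw [integral_congr_ae h, integral_const_mul, e1, mul_zero]⟩

/-- `u` represents a nonzero element of `N_∞(H)`. -/
def InNInf (V : E → ℝ) (u : E → ℂ) : Prop := ∃ f ∈ NInf V, f ≠ 0 ∧ u =ᵐ[volume] f

/-- The filter of neighbourhoods of infinity in `ℝ⁴`, up to null sets. -/
def nearInfinity : Filter E := cocompact E ⊓ ae volume

/-- `u(x) = -c₀ + a·x/|x|² + (Ax·x)/|x|⁴ + O(|x|⁻³)` as `|x| → ∞`, with `A` symmetric. -/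
def HasExpansion (u : E → ℂ) (c₀ : ℂ) (a : Fin 4 → ℂ) (A : Matrix (Fin 4) (Fin 4) ℂ) : Prop :=
  A.IsSymm ∧
  (fun x : E => u x - (-c₀ + (∑ i, a i * (x i : ℂ)) / (‖x‖ : ℂ) ^ 2 +
      (∑ i, ∑ j, A i j * (x j : ℂ) * (x i : ℂ)) / (‖x‖ : ℂ) ^ 4))
    =O[nearInfinity] fun x : E => (‖x‖ ^ 3)⁻¹

/-- `s`-wave resonance: a nonzero `u ∈ N_∞(H)` whose leading coefficient `c₀`, determined by
`u = -c₀ + o(1)` at infinity, does not vanish.  The leading coefficient makes sense also where the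
decay of `V` is too weak for the full expansion; where `HasExpansion` holds it is the same number. -/
def IsSWave (V : E → ℝ) (u : E → ℂ) : Prop :=
  InNInf V u ∧ ∃ c₀ : ℂ, c₀ ≠ 0 ∧ Tendsto u nearInfinity (𝓝 (-c₀))

/-- `p`-wave resonance: `c₀ = 0` and `a ≠ 0`. -/
def IsPWave (V : E → ℝ) (u : E → ℂ) : Prop :=
  InNInf V u ∧ ∃ a A, a ≠ 0 ∧ HasExpansion u 0 a A

/-- `d`-wave resonance: `c₀ = 0`, `a = 0` and `A ≠ 0`. -/
def IsDWave (V : E → ℝ) (u : E → ℂ) : Prop :=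
  InNInf V u ∧ ∃ A, A ≠ 0 ∧ HasExpansion u 0 0 A

/-- `g = Δu` in the sense of distributions. -/
def HasWeakLaplacian (u g : E → ℂ) : Prop :=
  ∀ ψ : E → ℂ, IsTest ψ → ∫ x, u x * Δ ψ x = ∫ x, g x * ψ x

/-- `u ≠ 0` lies in the domain of `H` and `Hu = 0`, where `H` is the operator of the quadratic form
`∫ (|Δu|² + V|u|²)` with domain `H²(ℝ⁴) = {u ∈ L² : Δu ∈ L²}`. -/
def IsZeroEigenfunction (V : E → ℝ) (u : E → ℂ) : Prop :=
  ¬ u =ᵐ[volume] 0 ∧ MemLp u 2 volume ∧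
  ∃ g : E → ℂ, MemLp g 2 volume ∧ HasWeakLaplacian u g ∧
    ∀ ψ h : E → ℂ, MemLp ψ 2 volume → MemLp h 2 volume → HasWeakLaplacian ψ h →
      Integrable (fun x => (V x : ℂ) * u x * conj (ψ x)) ∧
      (∫ x, g x * conj (h x)) + ∫ x, (V x : ℂ) * u x * conj (ψ x) = 0

end Bilaplace

end

/-! Everything is read off the density f = vζ. A vector ζ lies in S₁L² exactly when ∫ f = 0 and T₀ζ
= c v for some number c. Since U² = 1, the second condition says ζ = -wΦ with Φ = N₀f - c, so f =
-VΦ. As N₀ is a fundamental solution of Δ² on ℝ⁴, Δ²Φ = f = -VΦ.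

Boundedness of Φ rests on log|x - y| = log(1 + |x|) + `logKer x y`: the first term only sees ∫ f =
0, and ∫ `logKer x y`² |V(y)| dy is bounded uniformly in x (`LogDecay.exists_logKer_bound`). This
uses both the squared logarithmic weight and q > 1. Conversely, for a bounded solution φ and ζ =
-wφ, the difference φ - N₀(vζ) is biharmonic of logarithmic growth, hence constant
(`ae_eq_const_of_bilap_eq_zero`). Boundedness of φ then forces ∫ vζ = 0, so ζ lies in S₁L² and Φ(ζ)
= φ. Finally T₀ is the involution U plus a Hilbert-Schmidt operator, so the Fredholm alternative
turns non-invertibility of QT₀Q into S₁L² ≠ 0. This is (1).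

The number c is minus the limit of Φ at infinity (`LogDecay.tendsto_Phi`), and (T₁ζ, ζ) = ‖T₀ζ‖² =
|c|²‖v‖² on S₁L². Hence S₂L² is the subspace c = 0. If T₁ is invertible, c is an injective
functional on S₁L², which gives (2).

For (3), expanding log|x - y| to second order in y shows that the coefficients of 1/|x|² and 1/|x|⁴
in Φ are the first moments of f and a trace-corrected matrix of its second moments. For densities of
mean zero the form of |x - y|² is -2 times the pairing of first moments. If the first moments vanish
as well, the form of |x - y|⁴ is 2|tr M|² + 4∑|Mᵢⱼ|² on the diagonal, where M is the matrix of
second moments. So S₃L² and S₄L² are cut out by the vanishing of the first and of the second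
moments, which is the classification into waves. The |x - y|⁴ form needs more moments than V
provides; they come from f = -VΦ and the decay Φ = O(|x|⁻²) on S₃L².

On S₄L² one has Φ = O(|x|⁻³), so Φ is square integrable. Its Laplacian is minus the Newtonian
potential of f, again square integrable because f has mean zero and the singularity |x - y|⁻² can be
shared by Cauchy-Schwarz. The form equation for H is Green's formula, proved for weak Laplacians
with a compactly supported parametrix (`IsDensity.green`). -/

noncomputable section

namespace Bilaplace

/-! ### Calculus of the Laplacian on test functions -/

/-- The `i`-th partial derivative. -/
def pd (i : Fin 4) (f : E → ℂ) (x : E) : ℂ := fderiv ℝ f x (EuclideanSpace.basisFun (Fin 4) ℝ i)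

lemma contDiff_pd {f : E → ℂ} (hf : ContDiff ℝ ∞ f) (i : Fin 4) : ContDiff ℝ ∞ (pd i f) :=
  (hf.fderiv_right (m := ∞) (by simp)).clm_apply contDiff_const

lemma hasCompactSupport_pd {f : E → ℂ} (hf : HasCompactSupport f) (i : Fin 4) :
    HasCompactSupport (pd i f) :=
  hf.fderiv_apply (𝕜 := ℝ) _

lemma lap_eq_sum {f : E → ℂ} (hf : ContDiff ℝ ∞ f) : Δ f = fun x => ∑ i, pd i (pd i f) x := by
  rw [laplacian_eq_iteratedFDeriv_orthonormalBasis f (EuclideanSpace.basisFun (Fin 4) ℝ)]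
  ext x
  refine Finset.sum_congr rfl fun i _ => ?_
  rw [iteratedFDeriv_two_apply]
  have h : DifferentiableAt ℝ (fderiv ℝ f) x :=
    ((hf.fderiv_right (m := ∞) (by simp)).differentiable (by simp)) x
  unfold pd
  rw [fderiv_clm_apply h (differentiableAt_const _)]
  simp

lemma contDiff_lap {f : E → ℂ} (hf : ContDiff ℝ ∞ f) : ContDiff ℝ ∞ (Δ f) := by
  rw [lap_eq_sum hf]
  exact ContDiff.sum fun i _ => contDiff_pd (contDiff_pd hf i) i

lemma tsupport_lap_subset (f : E → ℂ) : tsupport (Δ f) ⊆ tsupport f := by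
  refine closure_minimal (fun x hx => ?_) (isClosed_tsupport f)
  by_contra h
  apply hx
  have h0 : f =ᶠ[𝓝 x] fun _ => 0 := notMem_tsupport_iff_eventuallyEq.1 h
  rw [(laplacian_congr_nhds h0).eq_of_nhds]
  simp

lemma hasCompactSupport_lap {f : E → ℂ} (hf : HasCompactSupport f) : HasCompactSupport (Δ f) :=
  hf.of_isClosed_subset (isClosed_tsupport _) (tsupport_lap_subset f)

lemma IsTest.lap {φ : E → ℂ} (h : IsTest φ) : IsTest (Δ φ) :=
  ⟨contDiff_lap h.1, hasCompactSupport_lap h.2⟩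

lemma IsTest.continuous {φ : E → ℂ} (h : IsTest φ) : Continuous φ := h.1.continuous

lemma IsTest.integrable {φ : E → ℂ} (h : IsTest φ) : Integrable φ :=
  h.continuous.integrable_of_hasCompactSupport h.2

lemma integrable_mul_test {M φ : E → ℂ} (hM : LocallyIntegrable M) (h : IsTest φ) :
    Integrable fun x => M x * φ x := by
  simpa [smul_eq_mul, mul_comm] using
    hM.integrable_smul_left_of_hasCompactSupport h.continuous h.2

lemma integral_mul_pd {M φ : E → ℂ} (hM : ContDiff ℝ ∞ M) (h : IsTest φ) (i : Fin 4) :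
    ∫ x, M x * pd i φ x = -∫ x, pd i M x * φ x := by
  have hpd : IsTest (pd i φ) := ⟨contDiff_pd h.1 i, hasCompactSupport_pd h.2 i⟩
  refine integral_mul_fderiv_eq_neg_fderiv_mul_of_integrable
    (integrable_mul_test (contDiff_pd hM i).continuous.locallyIntegrable h)
    (integrable_mul_test hM.continuous.locallyIntegrable hpd)
    (integrable_mul_test hM.continuous.locallyIntegrable h)
    (fun x _ => hM.differentiable (by simp) x) (fun x _ => h.1.differentiable (by simp) x)

lemma integral_mul_lap {M φ : E → ℂ} (hM : ContDiff ℝ ∞ M) (h : IsTest φ) :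
    ∫ x, M x * Δ φ x = ∫ x, Δ M x * φ x := by
  have hpd : ∀ i, IsTest (pd i φ) := fun i => ⟨contDiff_pd h.1 i, hasCompactSupport_pd h.2 i⟩
  have hpd2 : ∀ i, IsTest (pd i (pd i φ)) :=
    fun i => ⟨contDiff_pd (hpd i).1 i, hasCompactSupport_pd (hpd i).2 i⟩
  simp only [lap_eq_sum h.1, lap_eq_sum hM, Finset.mul_sum, Finset.sum_mul]
  rw [integral_finsetSum _ fun i _ =>
      integrable_mul_test hM.continuous.locallyIntegrable (hpd2 i),
    integral_finsetSum _ fun i _ => integrable_mul_test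
      (contDiff_pd (contDiff_pd hM i) i).continuous.locallyIntegrable h]
  refine Finset.sum_congr rfl fun i _ => ?_
  rw [integral_mul_pd hM (hpd i), integral_mul_pd (contDiff_pd hM i) h, neg_neg]

lemma pd_comp_affine {f : E → ℂ} (hf : ContDiff ℝ ∞ f) (c : ℝ) (a : E) (i : Fin 4) :
    pd i (fun x => f (c • x + a)) = fun x => c * pd i f (c • x + a) := by
  ext x
  have h1 : HasFDerivAt (fun x : E => c • x + a) (c • ContinuousLinearMap.id ℝ E) x :=
    ((hasFDerivAt_id x).const_smul c).add_const a
  have h2 := ((hf.differentiable (by simp)) (c • x + a)).hasFDerivAt.comp x h1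
  unfold pd
  have h3 : fderiv ℝ (fun x => f (c • x + a)) x = _ := h2.fderiv
  rw [h3]
  simp

lemma contDiff_comp_affine {f : E → ℂ} (hf : ContDiff ℝ ∞ f) (c : ℝ) (a : E) :
    ContDiff ℝ ∞ fun x => f (c • x + a) :=
  hf.comp ((contDiff_id.const_smul c).add contDiff_const)

lemma pd_const_mul {f : E → ℂ} (hf : ContDiff ℝ ∞ f) (c : ℂ) (i : Fin 4) :
    pd i (fun x => c * f x) = fun x => c * pd i f x := by
  ext x
  unfold pd
  rw [fderiv_const_mul (hf.differentiable (by simp) x)]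
  simp

lemma lap_comp_affine {f : E → ℂ} (hf : ContDiff ℝ ∞ f) (c : ℝ) (a : E) :
    Δ (fun x => f (c • x + a)) = fun x => (c : ℂ) ^ 2 * Δ f (c • x + a) := by
  rw [lap_eq_sum (contDiff_comp_affine hf c a), lap_eq_sum hf]
  ext x
  rw [Finset.mul_sum]
  refine Finset.sum_congr rfl fun i _ => ?_
  rw [pd_comp_affine hf, pd_const_mul (contDiff_comp_affine (contDiff_pd hf i) c a),
    pd_comp_affine (contDiff_pd hf i)]
  ring

lemma IsTest.comp_affine {φ : E → ℂ} (h : IsTest φ) {c : ℝ} (hc : c ≠ 0) (a : E) :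
    IsTest fun x => φ (c • x + a) :=
  ⟨contDiff_comp_affine h.1 c a, h.2.comp_homeomorph
    ((Homeomorph.smulOfNeZero c hc).trans (Homeomorph.addRight a))⟩

lemma lap_conj {f : E → ℂ} (hf : ContDiff ℝ ∞ f) :
    Δ (fun x => conj (f x)) = fun x => conj (Δ f x) := by
  ext x
  exact (hf.contDiffAt.of_le (by norm_cast) : ContDiffAt ℝ 2 f x).laplacian_CLM_comp_left
    (l := (Complex.conjCLE : ℂ →L[ℝ] ℂ))

lemma IsTest.conj {φ : E → ℂ} (h : IsTest φ) : IsTest fun x => conj (φ x) :=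
  ⟨Complex.conjCLE.contDiff.comp h.1, h.2.comp_left (g := fun z : ℂ => conj z) (by simp)⟩

/-- Convolution with a test function. -/
def cnv (f φ : E → ℂ) (x : E) : ℂ := ∫ y, f y * φ (x - y)

lemma cnv_eq_convolution (f φ : E → ℂ) :
    cnv f φ = convolution f φ (ContinuousLinearMap.mul ℝ ℂ) volume := rfl

lemma contDiff_cnv {f φ : E → ℂ} (hf : LocallyIntegrable f) (h : IsTest φ) :
    ContDiff ℝ ∞ (cnv f φ) := by
  rw [cnv_eq_convolution]
  exact h.2.contDiff_convolution_right _ hf h.1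

lemma pd_cnv {f φ : E → ℂ} (hf : LocallyIntegrable f) (h : IsTest φ) (i : Fin 4) :
    pd i (cnv f φ) = cnv f (pd i φ) := by
  ext x
  have h1 := (h.2.hasFDerivAt_convolution_right (ContinuousLinearMap.mul ℝ ℂ) hf
    (h.1.of_le (by norm_cast)) x).fderiv
  unfold pd
  rw [cnv_eq_convolution, h1, convolution_precompR_apply _ hf (h.2.fderiv ℝ)
    (h.1.continuous_fderiv (by simp))]
  rfl

lemma lap_cnv {f φ : E → ℂ} (hf : LocallyIntegrable f) (h : IsTest φ) :
    Δ (cnv f φ) = cnv f (Δ φ) := by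
  have hpd : ∀ i, IsTest (pd i φ) := fun i => ⟨contDiff_pd h.1 i, hasCompactSupport_pd h.2 i⟩
  have hpd2 : ∀ i, IsTest (pd i (pd i φ)) :=
    fun i => ⟨contDiff_pd (hpd i).1 i, hasCompactSupport_pd (hpd i).2 i⟩
  rw [lap_eq_sum (contDiff_cnv hf h), lap_eq_sum h.1]
  ext x
  simp only [cnv, Finset.mul_sum]
  rw [integral_finsetSum]
  · refine Finset.sum_congr rfl fun i _ => ?_
    rw [pd_cnv hf h, pd_cnv hf (hpd i)]; rfl
  · intro i _
    have := (hpd2 i).comp_affine (c := -1) (by norm_num) x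
    have h2 := integrable_mul_test hf this
    simpa [sub_eq_neg_add] using h2

lemma IsTest.cnv {f φ : E → ℂ} (hf : LocallyIntegrable f) (hc : HasCompactSupport f)
    (h : IsTest φ) : IsTest (cnv f φ) :=
  ⟨contDiff_cnv hf h, by
    rw [cnv_eq_convolution]; exact HasCompactSupport.convolution _ hc h.2⟩

/-! ### Fundamental solutions of the Laplacian and the bilaplacian -/

lemma hasFDerivAt_comp_normSq {F : ℝ → ℂ} {F' : ℂ} {x : E} (h : HasDerivAt F F' (‖x‖ ^ 2)) :
    HasFDerivAt (fun y : E => F (‖y‖ ^ 2))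
      ((ContinuousLinearMap.toSpanSingleton ℝ F') ∘L (2 • innerSL ℝ x)) x :=
  h.hasFDerivAt.comp x (hasStrictFDerivAt_norm_sq x).hasFDerivAt

lemma pd_radial {F : ℝ → ℂ} {F' : ℂ} {x : E} (h : HasDerivAt F F' (‖x‖ ^ 2)) (i : Fin 4) :
    pd i (fun y => F (‖y‖ ^ 2)) x = 2 * x i * F' := by
  unfold pd
  rw [(hasFDerivAt_comp_normSq h).fderiv]
  simp [EuclideanSpace.inner_single_right]
  ring

/-- Radial functions are written in the variable s = |x|², which is smooth at the origin; in
dimension four the Laplacian becomes 4sF'' + 8F'. -/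
lemma lap_radial {F F₁ F₂ : ℝ → ℂ} (h₁ : ∀ s, 0 ≤ s → HasDerivAt F (F₁ s) s)
    (h₂ : ∀ s, 0 ≤ s → HasDerivAt F₁ (F₂ s) s) (hF : ContDiff ℝ ∞ fun x : E => F (‖x‖ ^ 2)) (x : E) :
    Δ (fun x : E => F (‖x‖ ^ 2)) x = 4 * ((‖x‖ ^ 2 : ℝ) : ℂ) * F₂ (‖x‖ ^ 2) + 8 * F₁ (‖x‖ ^ 2) := by
  have e1 : ∀ i, pd i (fun y : E => F (‖y‖ ^ 2)) = fun y => 2 * (y i : ℂ) * F₁ (‖y‖ ^ 2) :=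
    fun i => funext fun y => pd_radial (h₁ _ (by positivity)) i
  have e2 : ∀ i, pd i (fun y : E => 2 * (y i : ℂ) * F₁ (‖y‖ ^ 2)) x =
      4 * ((x i ^ 2 : ℝ) : ℂ) * F₂ (‖x‖ ^ 2) + 2 * F₁ (‖x‖ ^ 2) := by
    intro i
    have a1 : HasFDerivAt (fun y : E => 2 * (y i : ℂ))
        ((2 : ℂ) • (Complex.ofRealCLM ∘L (EuclideanSpace.proj i : E →L[ℝ] ℝ))) x :=
      ((Complex.ofRealCLM ∘L (EuclideanSpace.proj i : E →L[ℝ] ℝ)).hasFDerivAt).const_mul 2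
    have a2 := a1.mul (hasFDerivAt_comp_normSq (h₂ (‖x‖ ^ 2) (by positivity)))
    unfold pd
    erw [a2.fderiv]
    simp [EuclideanSpace.inner_single_right]
    ring
  rw [lap_eq_sum hF]
  simp only [e1, e2]
  rw [Finset.sum_add_distrib, ← Finset.sum_mul, ← Finset.mul_sum, EuclideanSpace.norm_sq_eq]
  simp
  ring

/-! ### Local integrability of the singular kernels -/

lemma finrank_E : Module.finrank ℝ E = 4 := by simp

lemma integrableOn_ball_rpow {s : ℝ} (hs : s < 4) (r : ℝ) :
    IntegrableOn (fun x : E => ‖x‖ ^ (-s)) (Metric.ball 0 r) := by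
  rw [integrableOn_fun_norm_addHaar volume (f := fun t => t ^ (-s)), finrank_E]
  rcases le_or_gt r 0 with hr | hr
  · simp [Set.Ioo_eq_empty_of_le hr]
  · refine ((intervalIntegral.integrableOn_Ioo_rpow_iff (s := 3 - s) hr).2 (by linarith)).congr_fun
      (fun y hy => ?_) measurableSet_Ioo
    have : (3 : ℝ) - s = (3 : ℕ) + (-s) := by norm_num; ring
    simp only [this]
    rw [Real.rpow_add hy.1, Real.rpow_natCast]
    simp

lemma locallyIntegrable_of_ball {F : Type*} [NormedAddCommGroup F] {f : E → F}
    (h : ∀ r, IntegrableOn f (Metric.ball 0 r)) :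
    LocallyIntegrable f := by
  rw [locallyIntegrable_iff]
  intro K hK
  obtain ⟨r, hr⟩ := hK.isBounded.subset_ball 0
  exact (h r).mono_set hr

lemma locallyIntegrable_rpow {s : ℝ} (hs : s < 4) : LocallyIntegrable fun x : E => ‖x‖ ^ (-s) :=
  locallyIntegrable_of_ball (integrableOn_ball_rpow hs)

lemma locallyIntegrable_ofReal {f : E → ℝ} (h : LocallyIntegrable f) :
    LocallyIntegrable fun x => (f x : ℂ) := by
  rw [locallyIntegrable_iff] at h ⊢
  exact fun K hK => (h K hK).ofReal

lemma abs_log_le {t : ℝ} (ht : 0 ≤ t) : |Real.log t| ≤ t + t⁻¹ := by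
  rcases ht.eq_or_lt with rfl | ht
  · simp
  have h1 := Real.log_le_sub_one_of_pos ht
  have h2 := Real.log_le_sub_one_of_pos (inv_pos.2 ht)
  rw [Real.log_inv] at h2
  have : 0 < t⁻¹ := inv_pos.2 ht
  exact abs_le.2 ⟨by linarith, by linarith⟩

/-- The Newtonian kernel `1 / (4π²|x|²)`. -/
def gam (x : E) : ℂ := ((1 / (4 * Real.pi ^ 2) * (‖x‖ ^ 2)⁻¹ : ℝ) : ℂ)

lemma locallyIntegrable_inv_sq : LocallyIntegrable fun x : E => (‖x‖ ^ 2)⁻¹ := by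
  have := locallyIntegrable_rpow (s := (2 : ℕ)) (by norm_num)
  simp only [Real.rpow_neg (norm_nonneg _), Real.rpow_natCast] at this
  exact this

lemma locallyIntegrable_gam : LocallyIntegrable gam :=
  locallyIntegrable_ofReal (locallyIntegrable_inv_sq.smul (1 / (4 * Real.pi ^ 2)))

lemma measurable_log_norm : Measurable fun x : E => Real.log ‖x‖ :=
  Real.measurable_log.comp measurable_norm

lemma locallyIntegrable_log : LocallyIntegrable fun x : E => Real.log ‖x‖ := by
  have h1 := locallyIntegrable_rpow (s := 1) (by norm_num)
  have h2 : LocallyIntegrable fun x : E => ‖x‖ := continuous_norm.locallyIntegrable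
  refine (h2.add h1).mono measurable_log_norm.aestronglyMeasurable (.of_forall fun x => ?_)
  have : ‖x‖ ^ (-1 : ℝ) = ‖x‖⁻¹ := Real.rpow_neg_one _
  simp only [Pi.add_apply, this, Real.norm_eq_abs]
  exact (abs_log_le (norm_nonneg x)).trans (le_abs_self _)

lemma locallyIntegrable_N0 : LocallyIntegrable N0 := by
  convert locallyIntegrable_ofReal (locallyIntegrable_log.smul (-1 / (8 * Real.pi ^ 2))) using 1
  ext x
  simp only [N0, Pi.smul_apply, smul_eq_mul]
  congr 1
  ring

/-! ### Regularized kernels and their limits -/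

lemma contDiff_log_reg {e : ℝ} (he : 0 < e) :
    ContDiff ℝ ∞ fun x : E => ((Real.log (‖x‖ ^ 2 + e) / 2 : ℝ) : ℂ) := by
  refine Complex.ofRealCLM.contDiff.comp ?_
  refine ContDiff.div_const ?_ 2
  exact ((contDiff_norm_sq ℝ).add contDiff_const).log fun x => by positivity

lemma lap_log_reg {e : ℝ} (he : 0 < e) (x : E) :
    Δ (fun x : E => ((Real.log (‖x‖ ^ 2 + e) / 2 : ℝ) : ℂ)) x =
      ((2 * (‖x‖ ^ 2 + e)⁻¹ + 2 * e * ((‖x‖ ^ 2 + e) ^ 2)⁻¹ : ℝ) : ℂ) := by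
  have hd : ∀ s : ℝ, 0 ≤ s → s + e ≠ 0 := fun s hs => by positivity
  rw [lap_radial (F := fun s => ((Real.log (s + e) / 2 : ℝ) : ℂ))
    (F₁ := fun s => (((s + e)⁻¹ / 2 : ℝ) : ℂ)) (F₂ := fun s => ((-((s + e) ^ 2)⁻¹ / 2 : ℝ) : ℂ))
    ?_ ?_ (contDiff_log_reg he)]
  · have h0 : ((‖x‖ ^ 2 + e : ℝ) : ℂ) ≠ 0 := Complex.ofReal_ne_zero.2 (hd (‖x‖ ^ 2) (by positivity))
    push_cast at h0 ⊢
    field_simp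
    ring
  · intro s hs
    have h0 : HasDerivAt (fun s => Real.log (s + e) / 2) ((s + e)⁻¹ / 2) s :=
      ((((hasDerivAt_id s).add_const e).log (hd s hs)).div_const 2).congr_deriv (by simp)
    exact h0.ofReal_comp
  · intro s hs
    refine HasDerivAt.ofReal_comp ?_
    refine (((hasDerivAt_id s).add_const e).inv (hd s hs)).div_const 2
      |>.congr_deriv (by simp [div_eq_mul_inv])

lemma contDiff_inv_reg {e : ℝ} (he : 0 < e) :
    ContDiff ℝ ∞ fun x : E => (((‖x‖ ^ 2 + e)⁻¹ : ℝ) : ℂ) := by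
  refine Complex.ofRealCLM.contDiff.comp ?_
  exact ((contDiff_norm_sq ℝ).add contDiff_const).inv fun x => by positivity

lemma lap_inv_reg {e : ℝ} (he : 0 < e) (x : E) :
    Δ (fun x : E => (((‖x‖ ^ 2 + e)⁻¹ : ℝ) : ℂ)) x =
      ((-8 * e * ((‖x‖ ^ 2 + e) ^ 3)⁻¹ : ℝ) : ℂ) := by
  have hd : ∀ s : ℝ, 0 ≤ s → s + e ≠ 0 := fun s hs => by positivity
  rw [lap_radial (F := fun s => (((s + e)⁻¹ : ℝ) : ℂ))
    (F₁ := fun s => ((-((s + e) ^ 2)⁻¹ : ℝ) : ℂ)) (F₂ := fun s => ((2 * ((s + e) ^ 3)⁻¹ : ℝ) : ℂ))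
    ?_ ?_ (contDiff_inv_reg he)]
  · have h0 : ((‖x‖ ^ 2 + e : ℝ) : ℂ) ≠ 0 := Complex.ofReal_ne_zero.2 (hd (‖x‖ ^ 2) (by positivity))
    push_cast at h0 ⊢
    field_simp
    ring
  · intro s hs
    refine HasDerivAt.ofReal_comp ?_
    refine (((hasDerivAt_id s).add_const e).inv (hd s hs))
      |>.congr_deriv (by simp [div_eq_mul_inv])
  · intro s hs
    refine HasDerivAt.ofReal_comp ?_
    refine (((((hasDerivAt_id s).add_const e).pow 2).inv (pow_ne_zero 2 (hd s hs))).neg)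
      |>.congr_deriv ?_
    have := hd s hs
    simp
    field_simp

lemma integrable_inv_cube : Integrable fun x : E => ((‖x‖ ^ 2 + 1) ^ 3)⁻¹ := by
  have := integrable_rpow_neg_one_add_norm_sq (E := E) (μ := volume) (r := 6)
    (by rw [finrank_E]; norm_num)
  refine this.congr (.of_forall fun x => ?_)
  have h : (-6 / 2 : ℝ) = -((3 : ℕ) : ℝ) := by norm_num
  simp only [h]
  rw [Real.rpow_neg (by positivity), Real.rpow_natCast, add_comm]

lemma volume_unitBall : (volume : Measure E).real (Metric.ball 0 1) = Real.pi ^ 2 / 2 := by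
  rw [Measure.real, InnerProductSpace.volume_ball_of_dim_even (k := 2) (by simp)]
  rw [ENNReal.ofReal_one, one_pow, one_mul, ENNReal.toReal_ofReal (by positivity)]
  simp [Nat.factorial]

lemma integral_inv_cube : ∫ x : E, ((‖x‖ ^ 2 + 1) ^ 3)⁻¹ = Real.pi ^ 2 / 2 := by
  have hi := integrable_inv_cube
  rw [integrable_fun_norm_addHaar volume (f := fun t => ((t ^ 2 + 1) ^ 3)⁻¹), finrank_E] at hi
  rw [integral_fun_norm_addHaar volume (fun t => ((t ^ 2 + 1) ^ 3)⁻¹), finrank_E, volume_unitBall]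
  -- In polar coordinates the integrand is y³/(y² + 1)³, with primitive (1 - 1/(y² + 1))²/4, rising
  -- from 0 to 1/4.
  have key : ∫ y in Set.Ioi (0 : ℝ), y ^ (4 - 1) • ((y ^ 2 + 1) ^ 3)⁻¹ = 1 / 4 - 0 := by
    have := integral_Ioi_of_hasDerivAt_of_tendsto (a := 0)
      (f := fun y : ℝ => (1 - (y ^ 2 + 1)⁻¹) ^ 2 / 4) (m := 1 / 4)
      (f' := fun y : ℝ => y ^ (4 - 1) • ((y ^ 2 + 1) ^ 3)⁻¹) ?_ ?_ hi ?_
    · rw [this]; norm_num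
    · have : ∀ y : ℝ, y ^ 2 + 1 ≠ 0 := fun y => by positivity
      have : Continuous fun y : ℝ => (1 - (y ^ 2 + 1)⁻¹) ^ 2 / 4 := by fun_prop (disch := assumption)
      exact this.continuousWithinAt
    · intro y _
      have h0 : y ^ 2 + 1 ≠ 0 := by positivity
      refine (((((((hasDerivAt_id y).pow 2).add_const 1).inv h0).const_sub 1).pow 2).div_const 4)
        |>.congr_deriv ?_
      simp
      field_simp
      ring
    · have h1 : Tendsto (fun y : ℝ => y ^ 2 + 1) atTop atTop :=
        tendsto_atTop_add_const_right _ _ (tendsto_pow_atTop two_ne_zero)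
      have h2 := (((tendsto_inv_atTop_zero.comp h1).const_sub 1).pow 2).div_const 4
      simpa using h2
  rw [key]
  simp
  ring

lemma tendsto_normSq_add (x : E) : Tendsto (fun ε : ℝ => ‖x‖ ^ 2 + ε ^ 2) (𝓝[>] 0) (𝓝 (‖x‖ ^ 2)) := by
  have : Tendsto (fun ε : ℝ => ‖x‖ ^ 2 + ε ^ 2) (𝓝 0) (𝓝 (‖x‖ ^ 2 + 0 ^ 2)) :=
    (Continuous.tendsto (by fun_prop) 0)
  simpa using this.mono_left nhdsWithin_le_nhds

lemma ae_ne_zero : ∀ᵐ x : E, x ≠ 0 := by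
  simp [ae_iff, measure_singleton]

lemma inv_add_le {a e : ℝ} (ha : 0 < a) (he : 0 ≤ e) : (a + e)⁻¹ ≤ a⁻¹ := by
  gcongr; linarith

lemma tendsto_inv_reg {ψ : E → ℂ} (h : IsTest ψ) :
    Tendsto (fun ε : ℝ => ∫ x : E, (((‖x‖ ^ 2 + ε ^ 2)⁻¹ : ℝ) : ℂ) * ψ x) (𝓝[>] 0)
      (𝓝 (∫ x : E, (((‖x‖ ^ 2)⁻¹ : ℝ) : ℂ) * ψ x)) := by
  have hi : LocallyIntegrable fun x : E => (((‖x‖ ^ 2)⁻¹ : ℝ) : ℂ) :=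
    locallyIntegrable_ofReal locallyIntegrable_inv_sq
  refine tendsto_integral_filter_of_dominated_convergence
    (fun x => ‖(((‖x‖ ^ 2)⁻¹ : ℝ) : ℂ) * ψ x‖) (.of_forall fun ε => ?_) (.of_forall fun ε => ?_)
    (integrable_mul_test hi h).norm ?_
  · exact (Measurable.aestronglyMeasurable (by fun_prop)).mul h.continuous.aestronglyMeasurable
  · filter_upwards [ae_ne_zero] with x hx
    have : 0 < ‖x‖ ^ 2 := by positivity
    rw [norm_mul, norm_mul, Complex.norm_real, Complex.norm_real, Real.norm_of_nonneg (by positivity),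
      Real.norm_of_nonneg (by positivity)]
    exact mul_le_mul_of_nonneg_right (inv_add_le this (by positivity)) (norm_nonneg _)
  · filter_upwards [ae_ne_zero] with x hx
    have : ‖x‖ ^ 2 ≠ 0 := by positivity
    exact (((Complex.continuous_ofReal.tendsto _).comp
      ((tendsto_normSq_add x).inv₀ this))).mul_const _

/-- The Laplacian of 1/(|x|² + ε²) is -8ε²/(|x|² + ε²)³, the dilate of a fixed integrable profile of
mass -8 · π²/2. After the substitution x = εy only φ(εy) depends on ε, and it tends to φ(0). -/
lemma integral_inv_sq_lap {φ : E → ℂ} (h : IsTest φ) :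
    ∫ x : E, (((‖x‖ ^ 2)⁻¹ : ℝ) : ℂ) * Δ φ x = -(4 * Real.pi ^ 2 : ℝ) * φ 0 := by
  refine tendsto_nhds_unique (tendsto_inv_reg h.lap) ?_
  have e1 : ∀ ε : ℝ, 0 < ε → ∫ x : E, (((‖x‖ ^ 2 + ε ^ 2)⁻¹ : ℝ) : ℂ) * Δ φ x =
      ∫ y : E, -8 * ((((‖y‖ ^ 2 + 1) ^ 3)⁻¹ : ℝ) : ℂ) * φ (ε • y) := by
    intro ε hε
    rw [integral_mul_lap (contDiff_inv_reg (by positivity)) h]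
    have := Measure.integral_comp_smul (volume : Measure E)
      (fun x => Δ (fun x : E => (((‖x‖ ^ 2 + ε ^ 2)⁻¹ : ℝ) : ℂ)) x * φ x) ε
    rw [finrank_E, abs_of_pos (by positivity)] at this
    have h4 : ∫ x, Δ (fun x : E => (((‖x‖ ^ 2 + ε ^ 2)⁻¹ : ℝ) : ℂ)) x * φ x =
        (ε ^ 4 : ℝ) • ∫ (x : E), Δ (fun x : E => (((‖x‖ ^ 2 + ε ^ 2)⁻¹ : ℝ) : ℂ)) (ε • x) * φ (ε • x) := by
      rw [this, smul_smul, mul_inv_cancel₀ (by positivity), one_smul]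
    rw [h4, ← integral_smul]
    refine integral_congr_ae (.of_forall fun y => ?_)
    simp only [lap_inv_reg (show 0 < ε ^ 2 by positivity), Complex.real_smul]
    rw [← mul_assoc]
    congr 1
    norm_cast
    rw [norm_smul, Real.norm_of_nonneg hε.le]
    have : ‖y‖ ^ 2 + 1 ≠ 0 := by positivity
    have : (ε * ‖y‖) ^ 2 + ε ^ 2 ≠ 0 := by positivity
    field_simp
  refine Tendsto.congr' (f₁ := fun ε : ℝ => ∫ y : E, -8 * ((((‖y‖ ^ 2 + 1) ^ 3)⁻¹ : ℝ) : ℂ) * φ (ε • y))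
    (by filter_upwards [self_mem_nhdsWithin] with ε hε using (e1 ε hε).symm) ?_
  obtain ⟨C, hC⟩ := h.2.exists_bound_of_continuous h.continuous
  have lim : Tendsto (fun ε : ℝ => ∫ y : E, -8 * ((((‖y‖ ^ 2 + 1) ^ 3)⁻¹ : ℝ) : ℂ) * φ (ε • y)) (𝓝[>] 0)
      (𝓝 (∫ y : E, -8 * ((((‖y‖ ^ 2 + 1) ^ 3)⁻¹ : ℝ) : ℂ) * φ 0)) := by
    refine tendsto_integral_filter_of_dominated_convergence
      (fun y => 8 * ((‖y‖ ^ 2 + 1) ^ 3)⁻¹ * C) (.of_forall fun ε => ?_) (.of_forall fun ε => ?_)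
      ((integrable_inv_cube.const_mul 8).mul_const C) (.of_forall fun y => ?_)
    · refine Measurable.aestronglyMeasurable ?_
      have := h.continuous.measurable
      fun_prop
    · refine .of_forall fun y => ?_
      rw [norm_mul, norm_mul, Complex.norm_real, Real.norm_of_nonneg (by positivity)]
      have : ‖(-8 : ℂ)‖ = 8 := by simp
      rw [this]
      gcongr
      exact hC _
    · refine Tendsto.const_mul _ ?_
      have : Tendsto (fun ε : ℝ => φ (ε • y)) (𝓝 0) (𝓝 (φ ((0 : ℝ) • y))) :=
        (h.continuous.comp (by fun_prop : Continuous fun ε : ℝ => ε • y)).tendsto 0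
      rw [zero_smul] at this
      exact this.mono_left nhdsWithin_le_nhds
  convert lim using 2
  rw [integral_mul_const, integral_const_mul, integral_complex_ofReal, integral_inv_cube]
  push_cast
  ring

theorem integral_gam_lap {φ : E → ℂ} (h : IsTest φ) : ∫ x, gam x * Δ φ x = -φ 0 := by
  have : ∀ x, gam x * Δ φ x = ((1 / (4 * Real.pi ^ 2) : ℝ) : ℂ) *
      ((((‖x‖ ^ 2)⁻¹ : ℝ) : ℂ) * Δ φ x) := fun x => by simp only [gam]; push_cast; ring
  simp only [this]
  rw [integral_const_mul, integral_inv_sq_lap h]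
  have : (Real.pi : ℂ) ≠ 0 := by exact_mod_cast Real.pi_ne_zero
  push_cast
  field_simp

/-- The regularization log(|x|² + ε²)/2 has Laplacian 2/(|x|² + ε²) + 2ε²/(|x|² + ε²)². The second
term tends to 0 under the locally integrable bound 2/|x|², so no point mass survives in dimension
four. -/
lemma integral_log_lap {φ : E → ℂ} (h : IsTest φ) :
    ∫ x : E, ((Real.log ‖x‖ : ℝ) : ℂ) * Δ φ x = 2 * ∫ x : E, (((‖x‖ ^ 2)⁻¹ : ℝ) : ℂ) * φ x := by
  have hlog : LocallyIntegrable fun x : E => ((Real.log ‖x‖ : ℝ) : ℂ) :=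
    locallyIntegrable_ofReal locallyIntegrable_log
  have hi : LocallyIntegrable fun x : E => (((‖x‖ ^ 2)⁻¹ : ℝ) : ℂ) :=
    locallyIntegrable_ofReal locallyIntegrable_inv_sq
  have hreg : LocallyIntegrable fun x : E => ((Real.log (‖x‖ ^ 2 + 1) / 2 : ℝ) : ℂ) :=
    (contDiff_log_reg one_pos).continuous.locallyIntegrable
  have l1 : Tendsto (fun ε : ℝ => ∫ x : E, ((Real.log (‖x‖ ^ 2 + ε ^ 2) / 2 : ℝ) : ℂ) * Δ φ x)
      (𝓝[>] 0) (𝓝 (∫ x : E, ((Real.log ‖x‖ : ℝ) : ℂ) * Δ φ x)) := by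
    refine tendsto_integral_filter_of_dominated_convergence
      (fun x => ‖((Real.log ‖x‖ : ℝ) : ℂ) * Δ φ x‖ +
        ‖((Real.log (‖x‖ ^ 2 + 1) / 2 : ℝ) : ℂ) * Δ φ x‖) (.of_forall fun ε => ?_) ?_
      ((integrable_mul_test hlog h.lap).norm.add (integrable_mul_test hreg h.lap).norm) ?_
    · exact (Measurable.aestronglyMeasurable (by fun_prop)).mul h.lap.continuous.aestronglyMeasurable
    · have : ∀ᶠ ε : ℝ in 𝓝[>] 0, ε < 1 := nhdsWithin_le_nhds (Iio_mem_nhds one_pos)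
      filter_upwards [self_mem_nhdsWithin, this] with ε hε hε1
      filter_upwards [ae_ne_zero] with x hx
      rw [norm_mul, norm_mul, norm_mul, ← add_mul]
      refine mul_le_mul_of_nonneg_right ?_ (norm_nonneg _)
      rw [Complex.norm_real, Complex.norm_real, Complex.norm_real]
      have hx0 : 0 < ‖x‖ := norm_pos_iff.2 hx
      have hε0 : (0 : ℝ) < ε := hε
      -- For 0 < ε < 1 the regularized logarithm lies between its values at ε = 0 and ε = 1, which
      -- gives the dominating function.
      have b1 : Real.log (‖x‖ ^ 2) ≤ Real.log (‖x‖ ^ 2 + ε ^ 2) :=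
        Real.log_le_log (by positivity) (by nlinarith)
      have b2 : Real.log (‖x‖ ^ 2 + ε ^ 2) ≤ Real.log (‖x‖ ^ 2 + 1) :=
        Real.log_le_log (by positivity) (by nlinarith)
      rw [Real.log_pow] at b1
      push_cast at b1
      simp only [Real.norm_eq_abs]
      refine abs_le.2 ⟨?_, ?_⟩
      · have := neg_abs_le (Real.log ‖x‖)
        have := abs_nonneg (Real.log (‖x‖ ^ 2 + 1) / 2)
        linarith
      · have := le_abs_self (Real.log (‖x‖ ^ 2 + 1) / 2)
        have := abs_nonneg (Real.log ‖x‖)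
        linarith
    · filter_upwards [ae_ne_zero] with x hx
      have hx0 : ‖x‖ ^ 2 ≠ 0 := by positivity
      have := (((tendsto_normSq_add x).log hx0).div_const 2)
      rw [Real.log_pow] at this
      have h2 := ((Complex.continuous_ofReal.tendsto _).comp this).mul_const (Δ φ x)
      rw [show ((2 : ℕ) : ℝ) * Real.log ‖x‖ / 2 = Real.log ‖x‖ by push_cast; ring] at h2
      exact h2
  have l2 : Tendsto (fun ε : ℝ => ∫ x : E,
      ((2 * (‖x‖ ^ 2 + ε ^ 2)⁻¹ + 2 * ε ^ 2 * ((‖x‖ ^ 2 + ε ^ 2) ^ 2)⁻¹ : ℝ) : ℂ) * φ x)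
      (𝓝[>] 0) (𝓝 (∫ x : E, ((2 * (‖x‖ ^ 2)⁻¹ : ℝ) : ℂ) * φ x)) := by
    refine tendsto_integral_filter_of_dominated_convergence
      (fun x => 4 * ‖(((‖x‖ ^ 2)⁻¹ : ℝ) : ℂ) * φ x‖) (.of_forall fun ε => ?_)
      (.of_forall fun ε => ?_) ((integrable_mul_test hi h).norm.const_mul 4) ?_
    · exact (Measurable.aestronglyMeasurable (by fun_prop)).mul h.continuous.aestronglyMeasurable
    · filter_upwards [ae_ne_zero] with x hx
      have hx0 : 0 < ‖x‖ ^ 2 := by positivity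
      rw [norm_mul, norm_mul, ← mul_assoc]
      refine mul_le_mul_of_nonneg_right ?_ (norm_nonneg _)
      rw [Complex.norm_real, Complex.norm_real, Real.norm_of_nonneg (by positivity),
        Real.norm_of_nonneg (by positivity)]
      have b1 := inv_add_le hx0 (sq_nonneg ε)
      have b2 : ε ^ 2 * ((‖x‖ ^ 2 + ε ^ 2) ^ 2)⁻¹ ≤ (‖x‖ ^ 2 + ε ^ 2)⁻¹ := by
        have : 0 < ‖x‖ ^ 2 + ε ^ 2 := by positivity
        rw [← div_eq_mul_inv, inv_eq_one_div, div_le_div_iff₀ (by positivity) this]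
        nlinarith
      linarith
    · filter_upwards [ae_ne_zero] with x hx
      have hx0 : ‖x‖ ^ 2 ≠ 0 := by positivity
      have t1 := tendsto_normSq_add x
      have t2 : Tendsto (fun ε : ℝ => ε ^ 2) (𝓝[>] 0) (𝓝 0) := by
        have : Tendsto (fun ε : ℝ => ε ^ 2) (𝓝 0) (𝓝 (0 ^ 2)) := (continuous_pow 2).tendsto 0
        rw [zero_pow two_ne_zero] at this
        exact this.mono_left nhdsWithin_le_nhds
      have t3 := ((t1.inv₀ hx0).const_mul 2).add
        ((t2.const_mul 2).mul ((t1.pow 2).inv₀ (pow_ne_zero 2 hx0)))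
      simp only [mul_zero, zero_mul, add_zero] at t3
      exact ((Complex.continuous_ofReal.tendsto _).comp t3).mul_const _
  refine (tendsto_nhds_unique l1 (l2.congr' ?_)).trans ?_
  · filter_upwards [self_mem_nhdsWithin] with ε hε
    have hε0 : (0 : ℝ) < ε := hε
    rw [integral_mul_lap (contDiff_log_reg (by positivity)) h]
    simp only [lap_log_reg (show 0 < ε ^ 2 by positivity)]
  · rw [← integral_const_mul]
    refine integral_congr_ae (.of_forall fun x => ?_)
    push_cast
    ring

theorem integral_N0_lap {φ : E → ℂ} (h : IsTest φ) :
    ∫ x, N0 x * Δ φ x = -∫ x, gam x * φ x := by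
  have e1 : ∀ x, N0 x * Δ φ x = ((-1 / (8 * Real.pi ^ 2) : ℝ) : ℂ) *
      (((Real.log ‖x‖ : ℝ) : ℂ) * Δ φ x) := fun x => by simp only [N0]; push_cast; ring
  have e2 : ∀ x, gam x * φ x = ((1 / (4 * Real.pi ^ 2) : ℝ) : ℂ) *
      ((((‖x‖ ^ 2)⁻¹ : ℝ) : ℂ) * φ x) := fun x => by simp only [gam]; push_cast; ring
  simp only [e1, e2]
  rw [integral_const_mul, integral_const_mul, integral_log_lap h]
  push_cast
  ring

theorem integral_N0_bilap {φ : E → ℂ} (h : IsTest φ) : ∫ x, N0 x * Δ (Δ φ) x = φ 0 := by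
  rw [integral_N0_lap h.lap, integral_gam_lap h, neg_neg]

/-! ### Parametrices and Liouville's theorem -/

/-- The `k`-th power of the Laplacian. -/
def lapIter (k : ℕ) (f : E → ℂ) : E → ℂ := (fun f : E → ℂ => Δ f)^[k] f

lemma lapIter_succ (k : ℕ) (f : E → ℂ) : lapIter (k + 1) f = Δ (lapIter k f) :=
  Function.iterate_succ_apply' _ _ _

lemma contDiff_lapIter {f : E → ℂ} (hf : ContDiff ℝ ∞ f) (k : ℕ) : ContDiff ℝ ∞ (lapIter k f) := by
  induction k with
  | zero => exact hf
  | succ k ih => rw [lapIter_succ]; exact contDiff_lap ih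

lemma IsTest.lapIter {φ : E → ℂ} (h : IsTest φ) (k : ℕ) : IsTest (lapIter k φ) := by
  induction k with
  | zero => exact h
  | succ k ih => rw [lapIter_succ]; exact ih.lap

lemma tsupport_lapIter_subset (f : E → ℂ) (k : ℕ) : tsupport (lapIter k f) ⊆ tsupport f := by
  induction k with
  | zero => exact subset_rfl
  | succ k ih => rw [lapIter_succ]; exact (tsupport_lap_subset _).trans ih

lemma integral_mul_lapIter {M : E → ℂ} (hM : ContDiff ℝ ∞ M) (k : ℕ) :
    ∀ {φ : E → ℂ}, IsTest φ → ∫ x, M x * lapIter k φ x = ∫ x, lapIter k M x * φ x := by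
  induction k with
  | zero => intro φ _; rfl
  | succ k ih =>
    intro φ h
    rw [lapIter_succ k M, ← integral_mul_lap (contDiff_lapIter hM k) h, ← ih h.lap]
    rfl

lemma lapIter_const_mul {f : E → ℂ} (hf : ContDiff ℝ ∞ f) (c : ℂ) (k : ℕ) :
    lapIter k (fun x => c * f x) = fun x => c * lapIter k f x := by
  induction k with
  | zero => rfl
  | succ k ih =>
    rw [lapIter_succ, ih, lapIter_succ]
    ext x
    exact laplacian_smul c ((contDiff_lapIter hf k).contDiffAt.of_le (by norm_cast))

lemma lapIter_comp_affine {f : E → ℂ} (hf : ContDiff ℝ ∞ f) (c : ℝ) (a : E) (k : ℕ) :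
    lapIter k (fun x => f (c • x + a)) = fun x => (c : ℂ) ^ (2 * k) * lapIter k f (c • x + a) := by
  induction k with
  | zero => simp [lapIter]
  | succ k ih =>
    rw [lapIter_succ, ih]
    have h1 := lapIter_const_mul (contDiff_comp_affine (contDiff_lapIter hf k) c a)
      ((c : ℂ) ^ (2 * k)) 1
    have h2 := lap_comp_affine (contDiff_lapIter hf k) c a
    simp only [lapIter, Function.iterate_one] at h1
    simp only [lapIter] at h2 ⊢
    rw [h1, h2]
    ext x
    rw [Function.iterate_succ_apply']
    ring

lemma lapIter_cnv {f φ : E → ℂ} (hf : LocallyIntegrable f) (h : IsTest φ) (k : ℕ) :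
    lapIter k (cnv f φ) = cnv f (lapIter k φ) := by
  induction k with
  | zero => rfl
  | succ k ih => rw [lapIter_succ, ih, lap_cnv hf (h.lapIter k), lapIter_succ]

lemma isTest_ofReal {φ : E → ℝ} (h : ContDiff ℝ ∞ φ) (hc : HasCompactSupport φ) :
    IsTest fun x => (φ x : ℂ) :=
  ⟨Complex.ofRealCLM.contDiff.comp h, hc.comp_left (g := fun t : ℝ => (t : ℂ)) (by simp)⟩

lemma ae_eq_of_test {f g : E → ℂ} (hf : LocallyIntegrable f) (hg : LocallyIntegrable g)
    (h : ∀ φ, IsTest φ → ∫ x, f x * φ x = ∫ x, g x * φ x) : f =ᵐ[volume] g := by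
  refine ae_eq_of_integral_contDiff_smul_eq hf hg fun φ h1 h2 => ?_
  have := h _ (isTest_ofReal h1 h2)
  simpa [mul_comm] using this

/-- A smooth cutoff function, equal to one near the origin. -/
def cutoff : ContDiffBump (0 : E) := ⟨1, 2, one_pos, one_lt_two⟩

/-- Split N = χN + (1 - χ)N with χ a cutoff at the origin. The second part M is smooth, so Δᵏ(χN) =
δ - ΔᵏM. Away from the support of χ the function ΔᵏM vanishes, because there M = N and ΔᵏN = 0. Take
θ = χN and κ = -ΔᵏM. The bound by |N| keeps track of the singularity of θ. -/
theorem exists_parametrix {N : E → ℂ} (hN : LocallyIntegrable N) (hs : ContDiffOn ℝ ∞ N {0}ᶜ) (k : ℕ)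
    (hfund : ∀ φ, IsTest φ → ∫ x, N x * lapIter k φ x = φ 0) :
    ∃ θ κ : E → ℂ, Integrable θ ∧ HasCompactSupport θ ∧ (∀ x, ‖θ x‖ ≤ ‖N x‖) ∧ IsTest κ ∧
      ∀ φ, IsTest φ → lapIter k (cnv θ φ) = fun y => φ y + cnv κ φ y := by
  set χ : E → ℂ := fun x => (cutoff x : ℂ) with hχ
  have hχt : IsTest χ := isTest_ofReal cutoff.contDiff cutoff.hasCompactSupport
  set M : E → ℂ := fun x => (1 - χ x) * N x with hMdef
  have hθint : Integrable fun x => χ x * N x := by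
    simpa only [mul_comm] using integrable_mul_test hN hχt
  have hM : ContDiff ℝ ∞ M := by
    rw [contDiff_iff_contDiffAt]
    intro x
    rcases eq_or_ne x 0 with rfl | hx
    · have : M =ᶠ[𝓝 0] fun _ => 0 := by
        filter_upwards [Metric.ball_mem_nhds (0 : E) one_pos] with y hy
        have : cutoff y = 1 := cutoff.one_of_mem_closedBall (Metric.ball_subset_closedBall hy)
        simp [M, χ, this]
      exact contDiffAt_const.congr_of_eventuallyEq this
    · exact (contDiff_const.sub hχt.1).contDiffAt.mul
        (hs.contDiffAt (isOpen_compl_singleton.mem_nhds hx))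
  have key : ∀ φ, IsTest φ → ∫ x, χ x * N x * lapIter k φ x =
      φ 0 - ∫ x, lapIter k M x * φ x := by
    intro φ h
    rw [← integral_mul_lapIter hM k h, ← hfund φ h, ← integral_sub
      (integrable_mul_test hN (h.lapIter k))
      (integrable_mul_test hM.continuous.locallyIntegrable (h.lapIter k))]
    refine integral_congr_ae (.of_forall fun x => ?_)
    simp only [M]
    ring
  -- Against a test function supported outside the closed ball of radius 2, both the term with χ and
  -- the value at 0 in `key` vanish. Hence ΔᵏM is zero almost everywhere there, and everywhere by
  -- continuity.
  have hcs : HasCompactSupport (lapIter k M) := by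
    refine HasCompactSupport.of_support_subset_isCompact (isCompact_closedBall (0 : E) 2) ?_
    have hU : IsOpen (Metric.closedBall (0 : E) 2)ᶜ := Metric.isClosed_closedBall.isOpen_compl
    have hcont : Continuous (lapIter k M) := (contDiff_lapIter hM k).continuous
    have hz := hU.ae_eq_zero_of_integral_contDiff_smul_eq_zero (μ := volume)
      (f := lapIter k M) (hcont.locallyIntegrable.locallyIntegrableOn _) ?_
    · intro x hx
      by_contra hxU
      apply hx
      have h0 : x ∈ {x | x ∈ (Metric.closedBall (0 : E) 2)ᶜ ∧ lapIter k M x ≠ 0} := ⟨hxU, hx⟩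
      have hopen : IsOpen {x | x ∈ (Metric.closedBall (0 : E) 2)ᶜ ∧ lapIter k M x ≠ 0} :=
        hU.inter (isOpen_ne_fun hcont continuous_const)
      have hpos := hopen.measure_pos volume ⟨x, h0⟩
      have hzero : volume {x | x ∈ (Metric.closedBall (0 : E) 2)ᶜ ∧ lapIter k M x ≠ 0} = 0 := by
        rw [ae_iff] at hz
        convert hz using 3
        simp
      exact absurd hzero hpos.ne'
    · intro φ h1 h2 h3
      have ht := isTest_ofReal h1 h2
      have hsub : tsupport (fun x => (φ x : ℂ)) ⊆ (Metric.closedBall (0 : E) 2)ᶜ := by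
        have : Function.support (fun x => (φ x : ℂ)) = Function.support φ := by ext; simp
        rw [tsupport, this]; exact h3
      have := key _ ht
      have hl : ∀ x, χ x * N x * lapIter k (fun x => (φ x : ℂ)) x = 0 := by
        intro x
        by_cases hx : x ∈ Metric.closedBall (0 : E) 2
        · have : x ∉ tsupport (lapIter k (fun x => (φ x : ℂ))) := fun h =>
            hsub (tsupport_lapIter_subset _ _ h) hx
          rw [image_eq_zero_of_notMem_tsupport this, mul_zero]
        · have : cutoff x = 0 := cutoff.zero_of_le_dist (by
            rw [Metric.mem_closedBall, not_le] at hx; exact hx.le)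
          simp [χ, this]
      have h00 : (φ 0 : ℂ) = 0 := by
        have : (0 : E) ∉ tsupport (fun x => (φ x : ℂ)) := fun h => hsub h (by simp)
        exact image_eq_zero_of_notMem_tsupport (f := fun x => (φ x : ℂ)) this
      simp only [hl, integral_zero, h00, zero_sub] at this
      simpa [mul_comm] using this.symm
  refine ⟨fun x => χ x * N x, fun x => -lapIter k M x, hθint, hχt.2.mul_right, fun x => ?_,
    ⟨(contDiff_lapIter hM k).neg, hcs.neg⟩, fun φ h => ?_⟩
  · rw [norm_mul, Complex.norm_real, Real.norm_of_nonneg cutoff.nonneg]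
    exact mul_le_of_le_one_left (norm_nonneg _) cutoff.le_one
  · rw [lapIter_cnv hθint.locallyIntegrable h]
    ext y
    have h1 := key _ (h.comp_affine (c := -1) (by norm_num) y)
    rw [lapIter_comp_affine h.1] at h1
    simp only [Complex.ofReal_neg, Complex.ofReal_one, even_two, Even.mul_right, Even.neg_pow,
      one_pow, one_mul, neg_smul, one_smul, neg_add_eq_sub, sub_zero] at h1
    simp only [cnv, neg_mul]
    rw [integral_neg, ← sub_eq_add_neg]
    exact h1

/-- The correlation of `g` with `a`. -/
def corr (g a : E → ℂ) (y : E) : ℂ := ∫ x, g x * a (x - y)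

/-- Only the values of g on the compact set supp a + supp φ enter. Truncated to it, g is integrable,
and the integrand is a bounded function times a convolution integrand. -/
lemma integrable_mul_mul_test {g a φ : E → ℂ} (hg : LocallyIntegrable g) (ha : Integrable a)
    (hc : HasCompactSupport a) (h : IsTest φ) :
    Integrable fun p : E × E => g p.1 * (a (p.1 - p.2) * φ p.2) := by
  set K : Set E := (fun p : E × E => p.1 + p.2) '' (tsupport a ×ˢ tsupport φ) with hK
  have hKc : IsCompact K := (hc.isCompact.prod h.2.isCompact).image continuous_add
  have h1 : Integrable (K.indicator g) :=
    (integrable_indicator_iff hKc.measurableSet).2 (hg.integrableOn_isCompact hKc)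
  have h2 : Integrable fun z => a (-z) := ha.comp_neg
  have h3 := (h1.convolution_integrand (ContinuousLinearMap.mul ℝ ℂ) h2).swap
  obtain ⟨C, hC⟩ := h.2.exists_bound_of_continuous h.continuous
  have h4 : Integrable fun p : E × E => φ p.2 * (K.indicator g p.1 * a (p.1 - p.2)) := by
    refine Integrable.bdd_mul (c := C) ?_ (h.continuous.comp continuous_snd).aestronglyMeasurable
      (.of_forall fun p => hC _)
    exact h3.congr (.of_forall fun p => by simp)
  refine h4.congr (.of_forall fun p => ?_)
  by_cases hp : p.1 ∈ K
  · simp [Set.indicator_of_mem hp]; ring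
  · have : a (p.1 - p.2) * φ p.2 = 0 := by
      by_contra hne
      exact hp ⟨(p.1 - p.2, p.2), ⟨subset_tsupport _ (left_ne_zero_of_mul hne),
        subset_tsupport _ (right_ne_zero_of_mul hne)⟩, by simp⟩
    simp [Set.indicator_of_notMem hp, this]

lemma cnv_eq_sub (a φ : E → ℂ) (x : E) : cnv a φ x = ∫ y, a (x - y) * φ y := by
  rw [cnv, ← integral_sub_left_eq_self _ volume x]
  simp

lemma integral_mul_cnv {g a φ : E → ℂ} (hg : LocallyIntegrable g) (ha : Integrable a)
    (hc : HasCompactSupport a) (h : IsTest φ) :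
    ∫ x, g x * cnv a φ x = ∫ y, corr g a y * φ y := by
  simp only [cnv_eq_sub, corr, ← integral_const_mul, ← integral_mul_const]
  rw [integral_integral_swap (integrable_mul_mul_test hg ha hc h)]
  simp only [mul_assoc]

lemma exists_test_eq_one (r : ℝ) : ∃ φ : E → ℂ, IsTest φ ∧ ∀ x ∈ Metric.ball (0 : E) r, φ x = 1 := by
  let b : ContDiffBump (0 : E) := ⟨|r| + 1, |r| + 2, by positivity, by linarith⟩
  refine ⟨fun x => (b x : ℂ), isTest_ofReal b.contDiff b.hasCompactSupport, fun x hx => ?_⟩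
  have : b x = 1 := b.one_of_mem_closedBall (by
    rw [Metric.mem_ball] at hx; rw [Metric.mem_closedBall]
    exact hx.le.trans ((le_abs_self r).trans (by simp [b])))
  simp [this]

lemma locallyIntegrable_of_mul_test {f : E → ℂ} (h : ∀ φ, IsTest φ → Integrable fun x => f x * φ x) :
    LocallyIntegrable f := by
  refine locallyIntegrable_of_ball fun r => ?_
  obtain ⟨φ, hφ, h1⟩ := exists_test_eq_one r
  refine (h φ hφ).integrableOn.congr_fun (fun x hx => ?_) measurableSet_ball
  simp [h1 x hx]

lemma locallyIntegrable_corr {g a : E → ℂ} (hg : LocallyIntegrable g) (ha : Integrable a)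
    (hc : HasCompactSupport a) : LocallyIntegrable (corr g a) := by
  refine locallyIntegrable_of_mul_test fun φ h => ?_
  refine (integrable_mul_mul_test hg ha hc h).integral_prod_right.congr (.of_forall fun y => ?_)
  simp only [corr, ← integral_mul_const, mul_assoc]

lemma corr_eq_cnv (g a : E → ℂ) : corr g a = cnv g fun z => a (-z) := by
  ext y; simp [corr, cnv]

lemma quasiMeasurePreserving_smul {R : ℝ} (hR : R ≠ 0) :
    Measure.QuasiMeasurePreserving (fun x : E => R • x) volume volume := by
  refine ⟨measurable_const_smul R, ?_⟩
  rw [Measure.map_addHaar_smul volume hR]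
  exact Measure.smul_absolutelyContinuous

lemma continuous_one_add_log : Continuous fun x : E => 1 + Real.log (1 + ‖x‖) :=
  continuous_const.add (Continuous.log (f := fun x : E => 1 + ‖x‖) (by fun_prop) fun x => by positivity)

/-- The parametrix gives g = -`corr g κ` almost everywhere, hence a smooth representative whose
Lipschitz constant on the unit ball is controlled by the size of g on a fixed ball. Every dilate
g(R·) is again biharmonic and has size O(1 + log R) there. Rescaling gives |g(x) - g(x')| = O((1 +
log R)/R) for the representative, which tends to 0. -/
theorem ae_eq_const_of_bilap_eq_zero {g : E → ℂ} (hm : AEStronglyMeasurable g volume) {C : ℝ}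
    (hb : ∀ᵐ x, ‖g x‖ ≤ C * (1 + Real.log (1 + ‖x‖)))
    (h0 : ∀ φ, IsTest φ → ∫ x, g x * lapIter 2 φ x = 0) : ∃ c : ℂ, g =ᵐ[volume] fun _ => c := by
  have hNs : ContDiffOn ℝ ∞ N0 {0}ᶜ := by
    refine Complex.ofRealCLM.contDiff.comp_contDiffOn ?_
    refine ContDiffOn.div_const (ContDiffOn.neg ?_) _
    exact ContDiffOn.log (contDiffOn_id.norm ℝ fun x hx => hx) fun x hx => norm_ne_zero_iff.2 hx
  obtain ⟨θ, κ, hθ, hθc, -, hκ, hpar⟩ := exists_parametrix locallyIntegrable_N0 hNs 2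
    fun φ h => integral_N0_bilap h
  have hloc : ∀ g : E → ℂ, AEStronglyMeasurable g volume → ∀ (C R : ℝ), 
      (∀ᵐ x, ‖g x‖ ≤ C * (1 + Real.log (1 + ‖R • x‖))) → LocallyIntegrable g := by
    intro g hm C R hb
    refine ((continuous_const (y := C)).mul (continuous_one_add_log.comp
      (continuous_const_smul R))).locallyIntegrable.mono hm ?_
    filter_upwards [hb] with x hx using hx.trans (le_abs_self _)
  set gR : ℝ → E → ℂ := fun R x => g (R • x) with hgR
  have hgm : ∀ R : ℝ, R ≠ 0 → AEStronglyMeasurable (gR R) volume := fun R hR =>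
    hm.comp_quasiMeasurePreserving (quasiMeasurePreserving_smul hR)
  have hgb : ∀ R : ℝ, R ≠ 0 → ∀ᵐ x, ‖gR R x‖ ≤ C * (1 + Real.log (1 + ‖R • x‖)) := fun R hR =>
    (quasiMeasurePreserving_smul hR).ae hb
  have hgl : ∀ R : ℝ, R ≠ 0 → LocallyIntegrable (gR R) := fun R hR =>
    hloc _ (hgm R hR) C R (hgb R hR)
  have hg0 : ∀ R : ℝ, R ≠ 0 → ∀ φ, IsTest φ → ∫ x, gR R x * lapIter 2 φ x = 0 := by
    intro R hR φ h
    have h1 := h0 _ (h.comp_affine (inv_ne_zero hR) 0)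
    rw [lapIter_comp_affine h.1] at h1
    have h2 := Measure.integral_comp_smul (volume : Measure E)
      (fun x => g x * (((R⁻¹ : ℝ) : ℂ) ^ (2 * 2) * lapIter 2 φ (R⁻¹ • x + 0))) R
    rw [h1, smul_zero] at h2
    simp only [add_zero, smul_smul, inv_mul_cancel₀ hR, one_smul] at h2
    have h3 : ∀ x, g (R • x) * (((R⁻¹ : ℝ) : ℂ) ^ (2 * 2) * lapIter 2 φ x) =
        ((R⁻¹ : ℝ) : ℂ) ^ (2 * 2) * (gR R x * lapIter 2 φ x) := fun x => by simp only [gR]; ring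
    simp only [h3] at h2
    rw [integral_const_mul] at h2
    exact (mul_eq_zero.1 h2).resolve_left (pow_ne_zero _ (by simpa using hR))
  set κ' : E → ℂ := fun z => κ (-z)
  have hκ' : IsTest κ' := by simpa using hκ.comp_affine (c := -1) (by norm_num) 0
  set G : ℝ → E → ℂ := fun R => corr (gR R) κ with hG
  have hGc : ∀ R : ℝ, R ≠ 0 → Continuous (G R) := fun R hR => by
    rw [hG]; simp only [corr_eq_cnv]; exact (contDiff_cnv (hgl R hR) hκ').continuous
  -- Testing biharmonicity against θ ∗ φ, whose bilaplacian is φ + κ ∗ φ.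
  have hrep : ∀ R : ℝ, R ≠ 0 → gR R =ᵐ[volume] fun y => -G R y := by
    intro R hR
    refine ae_eq_of_test (hgl R hR) (hGc R hR).neg.locallyIntegrable fun φ h => ?_
    have h1 := hg0 R hR _ (h.cnv hθ.locallyIntegrable hθc)
    rw [hpar φ h] at h1
    simp only [mul_add] at h1
    rw [integral_add (integrable_mul_test (hgl R hR) h) (integrable_mul_test (hgl R hR)
      (h.cnv hκ.integrable.locallyIntegrable hκ.2)),
      integral_mul_cnv (hgl R hR) hκ.integrable hκ.2 h] at h1
    rw [eq_neg_of_add_eq_zero_left h1]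
    simp only [neg_mul]
    rw [integral_neg]
  have hscale : ∀ R : ℝ, 0 < R → ∀ y, G 1 (R • y) = G R y := by
    intro R hR
    have h1 : (fun y => G 1 (R • y)) =ᵐ[volume] G R := by
      have e1 := (quasiMeasurePreserving_smul hR.ne').ae (hrep 1 one_ne_zero)
      filter_upwards [e1, hrep R hR.ne'] with y h1 h2
      simp only [gR, one_smul] at h1 h2
      exact neg_injective (h1.symm.trans h2)
    exact fun y => congr_fun (Continuous.ae_eq_iff_eq volume
      ((hGc 1 one_ne_zero).comp (continuous_const_smul R)) (hGc R hR.ne') |>.1 h1) y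
  obtain ⟨L, hL⟩ := (hκ.1.of_le (m := 1) (by norm_cast)).lipschitzWith_of_hasCompactSupport hκ.2
    one_ne_zero
  obtain ⟨r, hr0, hr⟩ : ∃ r : ℝ, 0 < r ∧ tsupport κ ⊆ Metric.ball 0 r := by
    obtain ⟨r, hr⟩ := hκ.2.isCompact.isBounded.subset_ball 0
    exact ⟨max r 1, by positivity, hr.trans (Metric.ball_subset_ball (le_max_left _ _))⟩
  set B := Metric.ball (0 : E) (r + 1) with hB
  have hC0 : 0 ≤ |C| := abs_nonneg C
  have hlip : ∀ R : ℝ, 0 < R → ∀ y ∈ Metric.ball (0 : E) 1, ∀ y' ∈ Metric.ball (0 : E) 1,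
      ‖G R y - G R y'‖ ≤
        -- Here r is a radius containing the support of κ, so for y in the unit ball only x with |x|
        -- < r + 1 contribute.
        |C| * (1 + Real.log (1 + R * (r + 1))) * (L * ‖y - y'‖) * volume.real B := by
    intro R hR y hy y' hy'
    have hi : ∀ y, Integrable fun x => gR R x * κ (x - y) := fun y => by
      have := integrable_mul_test (hgl R hR.ne') (hκ.comp_affine (c := 1) one_ne_zero (-y))
      simpa [sub_eq_add_neg] using this
    rw [hG]
    simp only [corr]
    rw [← integral_sub (hi y) (hi y')]
    have hz : ∀ x, x ∉ B → gR R x * κ (x - y) - gR R x * κ (x - y') = 0 := by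
      intro x hx
      have hk : ∀ y ∈ Metric.ball (0 : E) 1, κ (x - y) = 0 := by
        intro y hy
        refine image_eq_zero_of_notMem_tsupport fun hmem => hx ?_
        have h1 := hr hmem
        rw [mem_ball_zero_iff] at h1 hy ⊢
        calc ‖x‖ = ‖(x - y) + y‖ := by simp
          _ ≤ _ := norm_add_le _ _
          _ < r + 1 := by linarith
      simp [hk y hy, hk y' hy']
    rw [← setIntegral_eq_integral_of_forall_compl_eq_zero hz]
    have hbd : ∀ᵐ x ∂volume.restrict B, ‖gR R x * κ (x - y) - gR R x * κ (x - y')‖ ≤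
        |C| * (1 + Real.log (1 + R * (r + 1))) * (L * ‖y - y'‖) := by
      filter_upwards [ae_restrict_of_ae (hgb R hR.ne'), ae_restrict_mem measurableSet_ball]
        with x hx hxB
      rw [← mul_sub, norm_mul]
      have h1 : ‖gR R x‖ ≤ |C| * (1 + Real.log (1 + R * (r + 1))) := by
        refine hx.trans ?_
        have : ‖R • x‖ ≤ R * (r + 1) := by
          rw [norm_smul, Real.norm_of_nonneg hR.le]
          exact mul_le_mul_of_nonneg_left (mem_ball_zero_iff.1 hxB).le hR.le
        have hl : Real.log (1 + ‖R • x‖) ≤ Real.log (1 + R * (r + 1)) :=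
          Real.log_le_log (by positivity) (by linarith)
        have hl0 : 0 ≤ Real.log (1 + ‖R • x‖) := Real.log_nonneg (by linarith [norm_nonneg (R • x)])
        calc C * (1 + Real.log (1 + ‖R • x‖)) ≤ |C| * (1 + Real.log (1 + ‖R • x‖)) :=
              mul_le_mul_of_nonneg_right (le_abs_self C) (by positivity)
          _ ≤ _ := by gcongr
      have h2 : ‖κ (x - y) - κ (x - y')‖ ≤ L * ‖y - y'‖ := by
        have := hL.dist_le_mul (x - y) (x - y')
        rw [dist_eq_norm, dist_eq_norm] at this
        rw [norm_sub_rev y y']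
        simpa using this
      exact mul_le_mul h1 h2 (norm_nonneg _) ((norm_nonneg _).trans h1)
    exact norm_setIntegral_le_of_norm_le_const_ae measure_ball_lt_top hbd
  have hconst : ∀ x x', G 1 x = G 1 x' := by
    intro x x'
    have hlim : Tendsto (fun R : ℝ => |C| * (R⁻¹ + Real.log (1 + R * (r + 1)) / R) *
        (L * ‖x - x'‖) * volume.real B) atTop (𝓝 0) := by
      have t1 : Tendsto (fun R : ℝ => R⁻¹) atTop (𝓝 0) := tendsto_inv_atTop_zero
      have t2 : Tendsto (fun R : ℝ => Real.log (1 + R * (r + 1)) / R) atTop (𝓝 0) := by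
        have a1 : Tendsto (fun R : ℝ => Real.log (1 + R * (r + 1)) / (1 + R * (r + 1))) atTop (𝓝 0) := by
          have : Tendsto (fun R : ℝ => 1 + R * (r + 1)) atTop atTop :=
            tendsto_atTop_add_const_left _ _ (tendsto_id.atTop_mul_const (by positivity))
          exact (Real.isLittleO_log_id_atTop.tendsto_div_nhds_zero).comp this
        have a2 : Tendsto (fun R : ℝ => R⁻¹ + (r + 1)) atTop (𝓝 (0 + (r + 1))) := t1.add_const _
        have := a1.mul a2
        rw [zero_mul] at this
        refine this.congr' ?_
        filter_upwards [eventually_gt_atTop 0] with R hR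
        have : 1 + R * (r + 1) ≠ 0 := by positivity
        field_simp
      have := (((t1.add t2).const_mul |C|).mul_const (L * ‖x - x'‖)).mul_const (volume.real B)
      simpa using this
    have hle : ‖G 1 x - G 1 x'‖ ≤ 0 := by
      refine ge_of_tendsto hlim ?_
      filter_upwards [eventually_gt_atTop (max ‖x‖ ‖x'‖), eventually_gt_atTop 0] with R hR hR0
      have hin : ∀ z : E, ‖z‖ < R → R⁻¹ • z ∈ Metric.ball (0 : E) 1 := by
        intro z hz
        rw [mem_ball_zero_iff, norm_smul, Real.norm_of_nonneg (by positivity), inv_mul_lt_iff₀ hR0]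
        simpa using hz
      have := hlip R hR0 _ (hin x ((le_max_left _ _).trans_lt hR)) _
        (hin x' ((le_max_right _ _).trans_lt hR))
      rw [← hscale R hR0, ← hscale R hR0, smul_smul, smul_smul, mul_inv_cancel₀ hR0.ne', one_smul,
        one_smul, ← smul_sub, norm_smul, Real.norm_of_nonneg (by positivity)] at this
      refine this.trans (le_of_eq ?_)
      field_simp
    exact sub_eq_zero.1 (norm_le_zero_iff.1 hle)
  refine ⟨-G 1 0, ?_⟩
  have := hrep 1 one_ne_zero
  simp only [gR, one_smul] at this
  filter_upwards [this] with x hx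
  rw [hx, hconst x 0]

/-! ### Hilbert-Schmidt operators on `L²` -/

lemma memLp_conj {α : Type*} [MeasurableSpace α] {μ : Measure α} {a : α → ℂ} {p : ℝ≥0∞}
    (ha : MemLp a p μ) : MemLp (fun y => conj (a y)) p μ :=
  ha.of_le (Complex.continuous_conj.comp_aestronglyMeasurable ha.1) (.of_forall fun x => by simp)

lemma integrable_mul_L2 {a : E → ℂ} (ha : MemLp a 2 volume) (ζ : L2) :
    Integrable fun y => a y * ζ y :=
  ha.integrable_mul (Lp.memLp ζ)

lemma integral_mul_L2 {a : E → ℂ} (ha : MemLp a 2 volume) (ζ : L2) :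
    ∫ y, a y * ζ y = inner ℂ ((memLp_conj ha).toLp _) ζ := by
  rw [L2.inner_def]
  refine integral_congr_ae ?_
  filter_upwards [(memLp_conj ha).coeFn_toLp] with y hy
  rw [hy]
  simp [mul_comm]

lemma norm_toLp_sq {a : E → ℂ} (ha : MemLp a 2 volume) : ‖ha.toLp a‖ ^ 2 = ∫ y, ‖a y‖ ^ 2 := by
  rw [← inner_self_eq_norm_sq (𝕜 := ℂ), L2.inner_def]
  have : ∀ᵐ y, inner ℂ (ha.toLp a y) (ha.toLp a y) = ((‖a y‖ ^ 2 : ℝ) : ℂ) := by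
    filter_upwards [ha.coeFn_toLp] with y hy
    rw [hy, inner_self_eq_norm_sq_to_K]
    norm_cast
  rw [integral_congr_ae this, integral_complex_ofReal]
  simp

lemma norm_integral_mul_L2_le {a : E → ℂ} (ha : MemLp a 2 volume) (ζ : L2) :
    ‖∫ y, a y * ζ y‖ ≤ Real.sqrt (∫ y, ‖a y‖ ^ 2) * ‖ζ‖ := by
  rw [integral_mul_L2 ha]
  refine (norm_inner_le_norm _ _).trans (mul_le_mul_of_nonneg_right ?_ (norm_nonneg _))
  refine Real.le_sqrt_of_sq_le ?_
  rw [norm_toLp_sq]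
  simp

lemma integral_norm_mul_L2_le {a : E → ℂ} (ha : MemLp a 2 volume) (ζ : L2) :
    ∫ y, ‖a y * ζ y‖ ≤ Real.sqrt (∫ y, ‖a y‖ ^ 2) * ‖ζ‖ := by
  have h1 : MemLp (fun y => (‖a y‖ : ℂ)) 2 volume := by
    exact ha.norm.ofReal
  have h2 : MemLp (fun y => (‖ζ y‖ : ℂ)) 2 volume := (Lp.memLp ζ).norm.ofReal
  have h3 := norm_integral_mul_L2_le h1 (h2.toLp _)
  have h4 : ∫ y, (‖a y‖ : ℂ) * (h2.toLp _) y = ((∫ y, ‖a y * ζ y‖ : ℝ) : ℂ) := by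
    rw [← integral_complex_ofReal]
    refine integral_congr_ae ?_
    filter_upwards [h2.coeFn_toLp] with y hy
    rw [hy]; simp
  have h5 : ‖h2.toLp _‖ = ‖ζ‖ := by
    rw [Lp.norm_toLp, Lp.norm_def]
    congr 1
    exact eLpNorm_congr_norm_ae (.of_forall fun y => by simp)
  rw [h4, h5, Complex.norm_real, Real.norm_of_nonneg (by positivity)] at h3
  simpa using h3

section HilbertSchmidt

variable {k : E × E → ℂ}

lemma integrable_normSq_kernel (hk : MemLp k 2 volume) : Integrable fun p => ‖k p‖ ^ 2 :=
  (memLp_two_iff_integrable_sq_norm hk.1).1 hk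

lemma memLp_kernel_section (hk : MemLp k 2 volume) :
    ∀ᵐ x : E, MemLp (fun y => k (x, y)) 2 volume := by
  filter_upwards [(integrable_normSq_kernel hk).prod_right_ae, hk.1.prodMk_left] with x hx hm
  exact (memLp_two_iff_integrable_sq_norm hm).2 hx

lemma aestronglyMeasurable_kernel_apply (hk : MemLp k 2 volume) (ζ : L2) :
    AEStronglyMeasurable (fun x => ∫ y, k (x, y) * ζ y) volume :=
  (hk.1.mul (Lp.aestronglyMeasurable ζ).comp_snd).integral_prod_right'

lemma norm_kernel_apply_sq_le (hk : MemLp k 2 volume) (ζ : L2) :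
    ∀ᵐ x : E, ‖∫ y, k (x, y) * ζ y‖ ^ 2 ≤ (∫ y, ‖k (x, y)‖ ^ 2) * ‖ζ‖ ^ 2 := by
  filter_upwards [memLp_kernel_section hk] with x hx
  have := norm_integral_mul_L2_le hx ζ
  calc _ ≤ (Real.sqrt (∫ y, ‖k (x, y)‖ ^ 2) * ‖ζ‖) ^ 2 := by gcongr
    _ = _ := by rw [mul_pow, Real.sq_sqrt (integral_nonneg fun y => by positivity)]

lemma memLp_kernel_apply (hk : MemLp k 2 volume) (ζ : L2) :
    MemLp (fun x => ∫ y, k (x, y) * ζ y) 2 volume := by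
  rw [memLp_two_iff_integrable_sq_norm (aestronglyMeasurable_kernel_apply hk ζ)]
  refine ((integrable_normSq_kernel hk).integral_prod_left.mul_const (‖ζ‖ ^ 2)).mono'
    ((aestronglyMeasurable_kernel_apply hk ζ).norm.pow 2) ?_
  filter_upwards [norm_kernel_apply_sq_le hk ζ] with x hx
  rwa [Real.norm_of_nonneg (by positivity)]

/-- The Hilbert-Schmidt operator with a square integrable kernel. -/
def kernelOp (hk : MemLp k 2 volume) : L2 →L[ℂ] L2 :=
  LinearMap.mkContinuous
    { toFun := fun ζ => (memLp_kernel_apply hk ζ).toLp _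
      map_add' := fun a b => by
        rw [← MemLp.toLp_add]
        refine MemLp.toLp_congr _ _ ?_
        filter_upwards [memLp_kernel_section hk] with x hx
        rw [Pi.add_apply, ← integral_add (integrable_mul_L2 hx a) (integrable_mul_L2 hx b)]
        refine integral_congr_ae ?_
        filter_upwards [Lp.coeFn_add a b] with y hy
        rw [hy, Pi.add_apply, mul_add]
      map_smul' := fun c a => by
        rw [RingHom.id_apply, ← MemLp.toLp_const_smul]
        refine MemLp.toLp_congr _ _ (.of_forall fun x => ?_)
        rw [Pi.smul_apply, smul_eq_mul, ← integral_const_mul]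
        refine integral_congr_ae ?_
        filter_upwards [Lp.coeFn_smul c a] with y hy
        rw [hy, Pi.smul_apply, smul_eq_mul]
        ring }
    (Real.sqrt (∫ x, ∫ y, ‖k (x, y)‖ ^ 2)) (fun ζ => by
      refine abs_le_of_sq_le_sq' ?_ (by positivity) |>.2
      change ‖(memLp_kernel_apply hk ζ).toLp _‖ ^ 2 ≤ _
      rw [norm_toLp_sq, mul_pow, Real.sq_sqrt (by positivity), ← integral_mul_const]
      refine integral_mono_ae
        ((memLp_two_iff_integrable_sq_norm (aestronglyMeasurable_kernel_apply hk ζ)).1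
          (memLp_kernel_apply hk ζ))
        ((integrable_normSq_kernel hk).integral_prod_left.mul_const (‖ζ‖ ^ 2))
        (norm_kernel_apply_sq_le hk ζ))

lemma kernelOp_apply (hk : MemLp k 2 volume) (ζ : L2) :
    kernelOp hk ζ =ᵐ[volume] fun x => ∫ y, k (x, y) * ζ y :=
  (memLp_kernel_apply hk ζ).coeFn_toLp

/-- Sequential Banach-Alaoglu in the dual, available because L² is separable, transported by the
Riesz isometry. That isometry is antilinear, which accounts for the conjugations. -/
lemma exists_weakly_convergent_subseq {u : ℕ → L2} {r : ℝ} (hu : ∀ n, ‖u n‖ ≤ r) :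
    ∃ ζ : L2, ‖ζ‖ ≤ r ∧ ∃ φ : ℕ → ℕ, StrictMono φ ∧
      ∀ h : L2, Tendsto (fun n => inner ℂ h (u (φ n))) atTop (𝓝 (inner ℂ h ζ)) := by
  have : Fact ((2 : ℝ≥0∞) ≠ ⊤) := ⟨by simp⟩
  have : TopologicalSpace.SeparableSpace L2 := inferInstance
  have hc := WeakDual.isSeqCompact_closedBall ℂ L2 0 r
  obtain ⟨f, hf, φ, hφ, hlim⟩ := hc
    (x := fun n => WeakDual.toStrongDual.symm (InnerProductSpace.toDual ℂ L2 (u n))) (fun n => by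
      simp only [Set.mem_preimage, LinearEquiv.apply_symm_apply, mem_closedBall_zero_iff,
        LinearIsometryEquiv.norm_map]
      exact hu n)
  refine ⟨(InnerProductSpace.toDual ℂ L2).symm (WeakDual.toStrongDual f), ?_, φ, hφ, fun h => ?_⟩
  · rw [LinearIsometryEquiv.norm_map]
    simpa using hf
  · have h1 := ((WeakDual.eval_continuous (𝕜 := ℂ) h).tendsto f).comp hlim
    have h2 := (Complex.continuous_conj.tendsto _).comp h1
    have e1 : conj (f h) =
        inner ℂ h ((InnerProductSpace.toDual ℂ L2).symm (WeakDual.toStrongDual f)) := by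
      rw [← inner_conj_symm, InnerProductSpace.toDual_symm_apply]
      rfl
    rw [← e1]
    refine h2.congr fun n => ?_
    rw [← inner_conj_symm]
    rfl

/-- Along a weakly convergent sequence the images converge pointwise almost everywhere, since almost
every section k(x, ·) is in L². They are dominated by a multiple of the L² norm of the section, so
they converge in norm. -/
lemma isCompactOperator_kernelOp (hk : MemLp k 2 volume) : IsCompactOperator (kernelOp hk) := by
  refine (isCompactOperator_iff_image_closedBall_subset_compact
    (kernelOp hk : L2 →ₗ[ℂ] L2) one_pos).2 ⟨_, ?_, subset_rfl⟩
  refine IsSeqCompact.isCompact fun w hw => ?_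
  choose u hu huw using hw
  obtain ⟨ζ, hζ, φ, hφ, hlim⟩ := exists_weakly_convergent_subseq (u := u) (r := 1)
    fun n => by simpa using hu n
  refine ⟨kernelOp hk ζ, ⟨ζ, by simpa using hζ, rfl⟩, φ, hφ, ?_⟩
  rw [tendsto_iff_norm_sub_tendsto_zero]
  have hform : ∀ n, ‖(w ∘ φ) n - kernelOp hk ζ‖ ^ 2 =
      ∫ x, ‖∫ y, k (x, y) * (u (φ n) - ζ) y‖ ^ 2 := by
    intro n
    have : (w ∘ φ) n - kernelOp hk ζ = kernelOp hk (u (φ n) - ζ) := by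
      rw [map_sub, Function.comp_apply, ← huw]; rfl
    rw [this]
    exact norm_toLp_sq (memLp_kernel_apply hk _)
  have hsq : Tendsto (fun n => ‖(w ∘ φ) n - kernelOp hk ζ‖ ^ 2) atTop (𝓝 0) := by
    simp only [hform]
    rw [← integral_zero E ℝ]
    refine tendsto_integral_of_dominated_convergence (fun x => (∫ y, ‖k (x, y)‖ ^ 2) * 2 ^ 2)
      (fun n => (aestronglyMeasurable_kernel_apply hk _).norm.pow 2)
      ((integrable_normSq_kernel hk).integral_prod_left.mul_const _) (fun n => ?_) ?_
    · filter_upwards [norm_kernel_apply_sq_le hk (u (φ n) - ζ)] with x hx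
      rw [Real.norm_of_nonneg (by positivity)]
      refine hx.trans ?_
      have : ‖u (φ n) - ζ‖ ≤ 2 := by
        refine (norm_sub_le _ _).trans ?_
        have : ‖u (φ n)‖ ≤ 1 := by simpa using hu (φ n)
        linarith
      have : 0 ≤ ∫ y, ‖k (x, y)‖ ^ 2 := integral_nonneg fun y => by positivity
      gcongr
    · filter_upwards [memLp_kernel_section hk] with x hx
      have h1 : Tendsto (fun n => ∫ y, k (x, y) * (u (φ n) - ζ) y) atTop (𝓝 0) := by
        simp only [integral_mul_L2 hx, inner_sub_right]
        have := (hlim ((memLp_conj hx).toLp _)).sub_const (inner ℂ ((memLp_conj hx).toLp _) ζ)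
        simpa using this
      simpa using h1.norm.pow 2
  have := hsq.sqrt
  simpa [Real.sqrt_sq] using this

lemma inner_kernelOp (hk : MemLp k 2 volume) (hsymm : ∀ x y, k (y, x) = conj (k (x, y))) (ζ η : L2) :
    inner ℂ (kernelOp hk ζ) η = inner ℂ ζ (kernelOp hk η) := by
  have hi : Integrable fun p : E × E => conj (k p * ζ p.2) * η p.1 := by
    have h1 : MemLp (fun p : E × E => ζ p.2 * conj (η p.1)) 2 volume := by
      refine (memLp_two_iff_integrable_sq_norm (((Lp.aestronglyMeasurable ζ).comp_snd).mul
        (Complex.continuous_conj.comp_aestronglyMeasurable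
          (Lp.aestronglyMeasurable η).comp_fst))).2 ?_
      have a1 := (memLp_two_iff_integrable_sq_norm (Lp.aestronglyMeasurable ζ)).1 (Lp.memLp ζ)
      have a2 := (memLp_two_iff_integrable_sq_norm (Lp.aestronglyMeasurable η)).1 (Lp.memLp η)
      refine (a2.mul_prod a1).congr (.of_forall fun p => ?_)
      simp only [Pi.mul_apply, norm_mul, RCLike.norm_conj]
      ring
    have h2 := memLp_one_iff_integrable.1 (memLp_conj (memLp_one_iff_integrable.2 (hk.integrable_mul h1)))
    refine h2.congr (.of_forall fun p => ?_)
    simp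
    ring
  rw [L2.inner_def, L2.inner_def]
  have e1 : ∀ᵐ x, inner ℂ (kernelOp hk ζ x) (η x) = ∫ y, conj (k (x, y) * ζ y) * η x := by
    filter_upwards [kernelOp_apply hk ζ] with x hx
    rw [hx, integral_mul_const, integral_conj]
    simp [mul_comm]
  have e2 : ∀ᵐ y, inner ℂ (ζ y) (kernelOp hk η y) = ∫ x, conj (k (x, y) * ζ y) * η x := by
    filter_upwards [kernelOp_apply hk η] with y hy
    rw [hy, RCLike.inner_apply, ← integral_mul_const]
    refine integral_congr_ae (.of_forall fun x => ?_)
    simp only [hsymm x y, map_mul]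
    ring
  rw [integral_congr_ae e1, integral_congr_ae e2]
  exact integral_integral_swap hi

end HilbertSchmidt

/-! ### Logarithmic estimates -/

/-- `log|z|` near the origin. -/
def nearLog (z : E) : ℝ := if ‖z‖ < 1 then |Real.log ‖z‖| else 0

/-- `|z|⁻ˢ` near the origin. -/
def nearPow (s : ℝ) (z : E) : ℝ := if ‖z‖ < 1 then ‖z‖ ^ (-s) else 0

/-- The logarithmic kernel, normalized at infinity. -/
def logKer (x y : E) : ℝ := Real.log ‖x - y‖ - Real.log (1 + ‖x‖)

lemma nearLog_nonneg (z : E) : 0 ≤ nearLog z := by unfold nearLog; split_ifs <;> positivity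

lemma nearPow_nonneg (s : ℝ) (z : E) : 0 ≤ nearPow s z := by
  unfold nearPow; split_ifs <;> positivity

lemma measurable_nearPow (s : ℝ) : Measurable (nearPow s) :=
  Measurable.ite (measurableSet_lt measurable_norm measurable_const)
    (measurable_norm.pow_const _) measurable_const

lemma integrable_nearPow {s : ℝ} (hs : s < 4) : Integrable (nearPow s) := by
  have := (integrableOn_ball_rpow hs 1).integrable_indicator measurableSet_ball
  refine this.congr (.of_forall fun x => ?_)
  simp [nearPow, Set.indicator]

lemma nearLog_le {s : ℝ} (hs : 0 < s) (z : E) : nearLog z ≤ s⁻¹ * nearPow s z := by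
  unfold nearLog nearPow
  split_ifs with h
  · rcases (norm_nonneg z).eq_or_lt with h0 | h0
    · rw [← h0]; simp; positivity
    · have := Real.abs_log_mul_self_rpow_lt ‖z‖ s h0 h.le hs
      rw [abs_mul, abs_of_pos (Real.rpow_pos_of_pos h0 s)] at this
      rw [Real.rpow_neg h0.le, ← div_eq_mul_inv, le_div_iff₀ (Real.rpow_pos_of_pos h0 s)]
      simpa using this.le
  · simp

lemma nearLog_sq_le {s : ℝ} (hs : 0 < s) (z : E) : nearLog z ^ 2 ≤ (2 / s) ^ 2 * nearPow s z := by
  have h1 := nearLog_le (half_pos hs) z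
  have h2 : nearPow (s / 2) z ^ 2 = nearPow s z := by
    unfold nearPow
    split_ifs
    · rw [← Real.rpow_natCast, ← Real.rpow_mul (norm_nonneg z)]
      congr 1; push_cast; ring
    · simp
  calc nearLog z ^ 2 ≤ ((s / 2)⁻¹ * nearPow (s / 2) z) ^ 2 :=
        pow_le_pow_left₀ (nearLog_nonneg z) h1 2
    _ = _ := by rw [mul_pow, h2, inv_div]

/-- The function 1 + |·| is submultiplicative, so log(1 + |x|) and log(1 + |x - y|) differ by at
most log(1 + |y|). Replacing 1 + |x - y| by |x - y| costs log 2 when |x - y| ≥ 1; otherwise the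
singular part `nearLog` pays. -/
lemma abs_logKer_le (x y : E) :
    |logKer x y| ≤ Real.log (1 + ‖y‖) + Real.log 2 + nearLog (x - y) := by
  have hx := norm_nonneg x
  have hy := norm_nonneg y
  have hly : 0 ≤ Real.log (1 + ‖y‖) := Real.log_nonneg (by linarith)
  have hlx : 0 ≤ Real.log (1 + ‖x‖) := Real.log_nonneg (by linarith)
  have hl2 : 0 ≤ Real.log 2 := Real.log_nonneg (by norm_num)
  have hn := nearLog_nonneg (x - y)
  rcases (norm_nonneg (x - y)).eq_or_lt with h0 | h0
  -- On the diagonal the convention log 0 = 0 leaves only log(1 + |x|).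
  · have hxy : x = y := sub_eq_zero.1 (norm_eq_zero.1 h0.symm)
    subst hxy
    simp only [logKer, sub_self, norm_zero, Real.log_zero, zero_sub, abs_neg]
    rw [sub_self] at hn
    rw [abs_of_nonneg hlx]
    linarith
  have t1 : ‖x‖ ≤ ‖x - y‖ + ‖y‖ := by simpa using norm_add_le (x - y) y
  have t2 : ‖x - y‖ ≤ ‖x‖ + ‖y‖ := norm_sub_le x y
  have u1 : Real.log ‖x - y‖ ≤ Real.log (1 + ‖x‖) + Real.log (1 + ‖y‖) := by
    rw [← Real.log_mul (by positivity) (by positivity)]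
    exact Real.log_le_log h0 (by nlinarith)
  have u2 : Real.log (1 + ‖x‖) ≤ Real.log (1 + ‖x - y‖) + Real.log (1 + ‖y‖) := by
    rw [← Real.log_mul (by positivity) (by positivity)]
    exact Real.log_le_log (by positivity) (by nlinarith)
  unfold logKer
  rcases lt_or_ge ‖x - y‖ 1 with h1 | h1
  · have u3 : Real.log (1 + ‖x - y‖) ≤ Real.log 2 := Real.log_le_log (by positivity) (by linarith)
    have u4 : nearLog (x - y) = |Real.log ‖x - y‖| := by simp [nearLog, h1]
    have u5 := neg_abs_le (Real.log ‖x - y‖)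
    rw [abs_le]
    constructor <;> linarith
  · have u3 : Real.log (1 + ‖x - y‖) ≤ Real.log 2 + Real.log ‖x - y‖ := by
      rw [← Real.log_mul (by positivity) (by positivity)]
      exact Real.log_le_log (by positivity) (by linarith)
    rw [abs_le]
    constructor <;> linarith

lemma log_one_add_le {t : ℝ} (ht : 0 ≤ t) : Real.log (1 + t) ≤ Real.log 2 + |Real.log t| := by
  rcases le_or_gt t 1 with h | h
  · have : Real.log (1 + t) ≤ Real.log 2 := Real.log_le_log (by positivity) (by linarith)
    have := abs_nonneg (Real.log t)
    linarith
  · have : Real.log (1 + t) ≤ Real.log (2 * t) := Real.log_le_log (by positivity) (by linarith)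
    rw [Real.log_mul (by norm_num) (by positivity)] at this
    have := le_abs_self (Real.log t)
    linarith

lemma log_two_le_one : Real.log 2 ≤ 1 := by
  have := Real.log_le_sub_one_of_pos (x := 2) (by norm_num)
  linarith

lemma log_one_add_sq_le {t : ℝ} (ht : 0 ≤ t) : Real.log (1 + t) ^ 2 ≤ 2 * (1 + Real.log t ^ 2) := by
  have h1 := log_one_add_le ht
  have h2 := log_two_le_one
  have h0 : 0 ≤ Real.log (1 + t) := Real.log_nonneg (by linarith)
  rw [← sq_abs (Real.log t)]
  have h3 : Real.log (1 + t) ≤ 1 + |Real.log t| := by linarith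
  nlinarith [sq_nonneg (1 - |Real.log t|), abs_nonneg (Real.log t)]

/-- An exponent q = ∞ is traded for 2, since |W|² ≤ ‖W‖∞ |W|. -/
lemma exists_rpow_integrable {W : E → ℝ} {q : ℝ≥0∞} (hq : 1 < q) (h1 : MemLp W 1 volume)
    (h2 : MemLp W q volume) : ∃ r : ℝ, 1 < r ∧ Integrable fun x => |W x| ^ r := by
  rcases eq_or_ne q ⊤ with rfl | hq'
  · refine ⟨2, one_lt_two, ?_⟩
    have hi := (memLp_one_iff_integrable.1 h1).abs
    have hb := ae_le_eLpNormEssSup (f := W) (μ := volume)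
    have hfin : eLpNormEssSup W volume ≠ ⊤ := by
      have := h2.2.ne; rwa [eLpNorm_exponent_top] at this
    refine (hi.mul_const (eLpNormEssSup W volume).toReal).mono' ?_ ?_
    · exact (h1.1.norm.aemeasurable.pow_const _).aestronglyMeasurable
    · filter_upwards [hb] with x hx
      rw [Real.rpow_two, Real.norm_of_nonneg (by positivity), sq]
      refine mul_le_mul_of_nonneg_left ?_ (abs_nonneg _)
      have := ENNReal.toReal_mono hfin hx
      simpa using this
  · refine ⟨q.toReal, ?_, ?_⟩
    · have := (ENNReal.toReal_lt_toReal (by simp) hq').2 hq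
      simpa using this
    · simpa using h2.integrable_norm_rpow (by rintro rfl; simp at hq) hq'

/-- With p conjugate to the exponent r > 1 and s = 1/p, Young's inequality bounds the integrand by
|x - y|⁻¹ near the diagonal plus |W|ʳ. Both integrals are finite and independent of x. -/
lemma exists_nearPow_bound {W : E → ℝ} {q : ℝ≥0∞} (hq : 1 < q) (h1 : MemLp W 1 volume)
    (h2 : MemLp W q volume) : ∃ s : ℝ, 0 < s ∧ s ≤ 1 ∧ ∃ C : ℝ, 0 ≤ C ∧ ∀ x,
      Integrable (fun y => nearPow s (x - y) * |W y|) ∧ ∫ y, nearPow s (x - y) * |W y| ≤ C := by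
  obtain ⟨r, hr, hi⟩ := exists_rpow_integrable hq h1 h2
  have hconj := Real.HolderConjugate.conjExponent hr
  set p := r.conjExponent
  have hp : 1 < p := hconj.symm.lt
  have hN := integrable_nearPow (s := 1) (by norm_num)
  refine ⟨p⁻¹, by positivity, inv_le_one_of_one_le₀ hp.le, (∫ z, nearPow 1 z) + ∫ y, |W y| ^ r,
    add_nonneg (integral_nonneg fun z => nearPow_nonneg _ z)
      (integral_nonneg fun y => by positivity), fun x => ?_⟩
  have hNx : Integrable fun y => nearPow 1 (x - y) := hN.comp_sub_left x
  have hpt : ∀ y, nearPow p⁻¹ (x - y) * |W y| ≤ nearPow 1 (x - y) + |W y| ^ r := by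
    intro y
    have h3 := Real.young_inequality_of_nonneg (nearPow_nonneg p⁻¹ (x - y)) (abs_nonneg (W y))
      hconj.symm
    have h4 : nearPow p⁻¹ (x - y) ^ p = nearPow 1 (x - y) := by
      unfold nearPow
      split_ifs
      · rw [← Real.rpow_mul (norm_nonneg _), neg_mul, inv_mul_cancel₀ (by positivity)]
      · rw [Real.zero_rpow (by positivity)]
    rw [h4] at h3
    have h5 : nearPow 1 (x - y) / p ≤ nearPow 1 (x - y) := div_le_self (nearPow_nonneg _ _) hp.le
    have h6 : |W y| ^ r / r ≤ |W y| ^ r := div_le_self (by positivity) hr.le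
    linarith
  have hint : Integrable (fun y => nearPow p⁻¹ (x - y) * |W y|) := by
    refine (hNx.add hi).mono' ?_ (.of_forall fun y => ?_)
    · exact ((measurable_nearPow _).comp (measurable_const.sub measurable_id)).aestronglyMeasurable.mul
        h1.1.norm
    · rw [Real.norm_of_nonneg (mul_nonneg (nearPow_nonneg _ _) (abs_nonneg _))]
      exact hpt y
  refine ⟨hint, (integral_mono hint (hNx.add hi) hpt).trans ?_⟩
  simp only [Pi.add_apply]
  rw [integral_add hNx hi, integral_sub_left_eq_self (nearPow 1) volume x]

/-! ### Weighted integrability of the potential -/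

section Potential

variable {V : E → ℝ}

/-- The polynomial weight `⟨x⟩ᵏ`. -/
def wt (k : ℝ) (x : E) : ℝ := (1 + ‖x‖ ^ 2) ^ (k / 2)

lemma wt_pos (k : ℝ) (x : E) : 0 < wt k x := Real.rpow_pos_of_pos (by positivity) _

lemma continuous_wt (k : ℝ) : Continuous (wt k) := by
  unfold wt
  exact Continuous.rpow_const (by fun_prop) fun x => Or.inl (by positivity)

lemma LogDecay.aestronglyMeasurable {k : ℝ} (hV : LogDecay k V) : AEStronglyMeasurable V volume := by
  obtain ⟨q, -, h1, -⟩ := hV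
  have hm : Measurable fun x : E => ((1 + Real.log ‖x‖ ^ 2) * wt k x)⁻¹ :=
    ((measurable_const.add (measurable_log_norm.pow_const 2)).mul (continuous_wt k).measurable).inv
  refine (hm.aestronglyMeasurable.mul h1.1).congr (.of_forall fun x => ?_)
  have := wt_pos k x
  have h0 : (1 + Real.log ‖x‖ ^ 2) * wt k x ≠ 0 := by positivity
  simp only [Pi.mul_apply]
  change ((1 + Real.log ‖x‖ ^ 2) * wt k x)⁻¹ * ((1 + Real.log ‖x‖ ^ 2) * wt k x * V x) = V x
  rw [← mul_assoc, inv_mul_cancel₀ h0, one_mul]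

lemma LogDecay.integrable {k : ℝ} (hV : LogDecay k V) :
    Integrable fun x => (1 + Real.log ‖x‖ ^ 2) * wt k x * |V x| := by
  obtain ⟨q, -, h1, -⟩ := hV
  refine (memLp_one_iff_integrable.1 h1).abs.congr (.of_forall fun x => ?_)
  have := wt_pos k x
  change |(1 + Real.log ‖x‖ ^ 2) * wt k x * V x| = _
  rw [abs_mul, abs_of_pos (by positivity)]

lemma LogDecay.integrable_wt {k : ℝ} (hV : LogDecay k V) :
    Integrable fun x => wt k x * |V x| := by
  refine hV.integrable.mono' ((continuous_wt k).aestronglyMeasurable.mul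
    hV.aestronglyMeasurable.norm) (.of_forall fun x => ?_)
  have := wt_pos k x
  rw [Real.norm_of_nonneg (by positivity)]
  nlinarith [mul_nonneg (mul_nonneg (sq_nonneg (Real.log ‖x‖)) this.le) (abs_nonneg (V x))]

lemma LogDecay.exists_nearPow {k : ℝ} (hV : LogDecay k V) : ∃ s : ℝ, 0 < s ∧ s ≤ 1 ∧ ∃ C : ℝ, 0 ≤ C ∧
    ∀ x, Integrable (fun y => nearPow s (x - y) * (wt k y * |V y|)) ∧
      ∫ y, nearPow s (x - y) * (wt k y * |V y|) ≤ C := by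
  have hm := hV.aestronglyMeasurable
  obtain ⟨q, hq, h1, h2⟩ := hV
  have hle : ∀ p : ℝ≥0∞, MemLp (fun x : E => (1 + Real.log ‖x‖ ^ 2) *
      (1 + ‖x‖ ^ 2) ^ (k / 2) * V x) p volume → MemLp (fun x => wt k x * |V x|) p volume := by
    intro p h
    refine h.of_le ((continuous_wt k).aestronglyMeasurable.mul hm.norm) (.of_forall fun x => ?_)
    have := wt_pos k x
    change _ ≤ ‖(1 + Real.log ‖x‖ ^ 2) * wt k x * V x‖
    rw [norm_mul, norm_mul, norm_mul, Real.norm_of_nonneg this.le,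
      Real.norm_of_nonneg (show 0 ≤ 1 + Real.log ‖x‖ ^ 2 by positivity), norm_abs_eq_norm]
    have h5 : 0 ≤ wt k x * ‖V x‖ := by positivity
    nlinarith [mul_nonneg (sq_nonneg (Real.log ‖x‖)) h5]
  obtain ⟨s, hs, hs1, C, hC, h⟩ := exists_nearPow_bound hq (hle 1 h1) (hle q h2)
  refine ⟨s, hs, hs1, C, hC, fun x => ?_⟩
  have e : ∀ y, abs (wt k y * |V y|) = wt k y * |V y| := fun y =>
    abs_of_nonneg (mul_nonneg (wt_pos k y).le (abs_nonneg _))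
  simpa only [e] using h x

lemma wt_zero (x : E) : wt 0 x = 1 := by simp [wt]

lemma LogDecay.integrable_abs (hV : LogDecay 0 V) : Integrable fun x => |V x| := by
  simpa [wt_zero] using hV.integrable_wt

lemma LogDecay.integrable_log_sq (hV : LogDecay 0 V) :
    Integrable fun x => Real.log (1 + ‖x‖) ^ 2 * |V x| := by
  refine (hV.integrable.const_mul 2).mono' ?_ (.of_forall fun x => ?_)
  · refine Measurable.aestronglyMeasurable ?_ |>.mul hV.aestronglyMeasurable.norm
    exact (Real.measurable_log.comp (measurable_const.add measurable_norm)).pow_const 2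
  · rw [Real.norm_of_nonneg (by positivity), wt_zero, mul_one, ← mul_assoc]
    exact mul_le_mul_of_nonneg_right (log_one_add_sq_le (norm_nonneg x)) (abs_nonneg _)

lemma measurable_logKer (x : E) : Measurable (logKer x) :=
  (measurable_log_norm.comp (measurable_const.sub measurable_id)).sub measurable_const

/-- The uniformity in x is what later makes Φ bounded. The logarithmic growth in y is paid by the
squared logarithmic weight, and the moving singularity by `LogDecay.exists_nearPow`. -/
lemma LogDecay.exists_logKer_bound (hV : LogDecay 0 V) : ∃ C : ℝ, 0 ≤ C ∧ ∀ x,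
    Integrable (fun y => logKer x y ^ 2 * |V y|) ∧ ∫ y, logKer x y ^ 2 * |V y| ≤ C := by
  obtain ⟨s, hs, -, C, hC, h⟩ := hV.exists_nearPow
  simp only [wt_zero, one_mul] at h
  have i1 := hV.integrable_log_sq
  have i2 := hV.integrable_abs
  refine ⟨3 * (∫ y, Real.log (1 + ‖y‖) ^ 2 * |V y|) + 3 * (∫ y, |V y|) + 3 * (2 / s) ^ 2 * C, by
    have : 0 ≤ ∫ y, Real.log (1 + ‖y‖) ^ 2 * |V y| := integral_nonneg fun y => by positivity
    have : 0 ≤ ∫ y, |V y| := integral_nonneg fun y => by positivity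
    positivity, fun x => ?_⟩
  have hpt : ∀ y, logKer x y ^ 2 * |V y| ≤ 3 * (Real.log (1 + ‖y‖) ^ 2 * |V y|) + 3 * |V y| +
      3 * (2 / s) ^ 2 * (nearPow s (x - y) * |V y|) := by
    intro y
    have a1 := abs_logKer_le x y
    have a2 := nearLog_sq_le hs (x - y)
    have a3 := log_two_le_one
    have a4 : 0 ≤ Real.log 2 := Real.log_nonneg (by norm_num)
    set a := Real.log (1 + ‖y‖)
    set b := Real.log 2
    set c := nearLog (x - y)
    have a5 : logKer x y ^ 2 ≤ (a + b + c) ^ 2 := by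
      rw [← sq_abs (logKer x y)]
      exact pow_le_pow_left₀ (abs_nonneg _) a1 2
    have a6 : logKer x y ^ 2 ≤ 3 * a ^ 2 + 3 + 3 * (2 / s) ^ 2 * nearPow s (x - y) := by
      nlinarith [sq_nonneg (a - b), sq_nonneg (b - c), sq_nonneg (a - c)]
    have := mul_le_mul_of_nonneg_right a6 (abs_nonneg (V y))
    linarith
  have i12 : Integrable fun y => 3 * (Real.log (1 + ‖y‖) ^ 2 * |V y|) + 3 * |V y| :=
    (i1.const_mul 3).add (i2.const_mul 3)
  have hi : Integrable fun y => 3 * (Real.log (1 + ‖y‖) ^ 2 * |V y|) + 3 * |V y| +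
      3 * (2 / s) ^ 2 * (nearPow s (x - y) * |V y|) :=
    i12.add ((h x).1.const_mul _)
  have hint : Integrable fun y => logKer x y ^ 2 * |V y| := by
    refine hi.mono' (((measurable_logKer x).pow_const 2).aestronglyMeasurable.mul
      hV.aestronglyMeasurable.norm) (.of_forall fun y => ?_)
    rw [Real.norm_of_nonneg (by positivity)]
    exact hpt y
  refine ⟨hint, (integral_mono hint hi hpt).trans ?_⟩
  rw [integral_add i12 ((h x).1.const_mul _),
    integral_add (i1.const_mul 3) (i2.const_mul 3), integral_const_mul, integral_const_mul,
    integral_const_mul]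
  have := (h x).2
  gcongr

end Potential

/-! ### The operator `T₀` and the Fredholm alternative -/

lemma part_apply (K : Submodule ℂ L2) [CompleteSpace K] (A : L2 →L[ℂ] L2) (z : K) :
    part K A z = K.orthogonalProjectionOnto (A z) := rfl

lemma part_eq_zero_iff {K : Submodule ℂ L2} [CompleteSpace K] {A : L2 →L[ℂ] L2} {z : K} :
    part K A z = 0 ↔ A z ∈ Kᗮ := by
  rw [part_apply, Submodule.orthogonalProjectionOnto_eq_zero_iff]

lemma mem_kerPart_iff {K : Submodule ℂ L2} [CompleteSpace K] {A : L2 →L[ℂ] L2} {ζ : L2} :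
    ζ ∈ kerPart K A ↔ ζ ∈ K ∧ A ζ ∈ Kᗮ := by
  rw [kerPart, Submodule.mem_map]
  constructor
  · rintro ⟨z, hz, rfl⟩
    rw [LinearMap.mem_ker] at hz
    exact ⟨z.2, part_eq_zero_iff.1 hz⟩
  · rintro ⟨h1, h2⟩
    refine ⟨⟨ζ, h1⟩, ?_, rfl⟩
    rw [LinearMap.mem_ker]
    exact part_eq_zero_iff.2 h2

lemma P_mem (V : E → ℝ) (ζ : L2) : P V ζ ∈ ℂ ∙ vVec V := Submodule.starProjection_apply_mem _ _

lemma P_eq_self {V : E → ℝ} {ζ : L2} (h : ζ ∈ ℂ ∙ vVec V) : P V ζ = ζ :=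
  Submodule.starProjection_eq_self_iff.2 h

lemma P_eq_zero_iff {V : E → ℝ} {ζ : L2} : P V ζ = 0 ↔ ζ ∈ QL2 V :=
  Submodule.starProjection_apply_eq_zero_iff _

lemma mem_QL2_iff {V : E → ℝ} {ζ : L2} : ζ ∈ QL2 V ↔ inner ℂ (vVec V) ζ = 0 :=
  Submodule.mem_orthogonal_singleton_iff_inner_right

lemma orthogonal_QL2 (V : E → ℝ) : (QL2 V)ᗮ = ℂ ∙ vVec V := Submodule.orthogonal_orthogonal _

lemma isCompactOperator_P (V : E → ℝ) : IsCompactOperator (P V) := by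
  have h : IsCompactOperator ((ℂ ∙ vVec V).orthogonalProjectionOnto) := by
    have : ProperSpace (ℂ ∙ vVec V) := FiniteDimensional.proper_rclike ℂ _
    exact isCompactOperator_of_locallyCompactSpace_dom _
  exact h.clm_comp (ℂ ∙ vVec V).subtypeL

/-- The operator D is chosen so that U + D = (1 - p)T(1 - p) + p, which acts as the compressed
operator on ker p and is injective by hypothesis. Since U is an involution, U + D = U(1 + UD) with
UD compact, and the Fredholm alternative makes it surjective. -/
theorem exists_of_compact_perturbation {H : Type*} [NormedAddCommGroup H] [NormedSpace ℂ H]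
    [CompleteSpace H] {U C p : H →L[ℂ] H} (hU : ∀ ζ, U (U ζ) = ζ) (hC : IsCompactOperator C)
    (hpc : IsCompactOperator p) (hpp : ∀ ζ, p (p ζ) = p ζ)
    (h : ∀ ζ, p ζ = 0 → (U + C) ζ = p ((U + C) ζ) → ζ = 0) (η : H) (hη : p η = 0) :
    ∃ ζ, p ζ = 0 ∧ (U + C) ζ = η + p ((U + C) ζ) := by
  set T := U + C with hT
  set D : H →L[ℂ] H := C - p ∘L T - T ∘L p + p ∘L T ∘L p + p with hD
  have hDc : IsCompactOperator D := by
    have h1 : IsCompactOperator (p ∘L T) := hpc.comp_clm T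
    have h2 : IsCompactOperator (T ∘L p) := hpc.clm_comp T
    have h3 : IsCompactOperator (p ∘L T ∘L p) := hpc.comp_clm (T ∘L p)
    exact (((hC.sub h1).sub h2).add h3).add hpc
  have hB : ∀ ζ, U ζ + D ζ = (T (ζ - p ζ) - p (T (ζ - p ζ))) + p ζ := by
    intro ζ
    simp only [hD, hT, _root_.add_apply, _root_.sub_apply, ContinuousLinearMap.comp_apply, map_sub,
      map_add]
    abel
  -- This identity ensures that a solution of (U + D)ζ = η with pη = 0 satisfies pζ = 0.
  have hpB : ∀ ζ, p (U ζ + D ζ) = p ζ := by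
    intro ζ
    rw [hB, map_add, map_sub, hpp, sub_self, zero_add, hpp]
  have hinj : ∀ ζ, U ζ + D ζ = 0 → ζ = 0 := by
    intro ζ hζ
    have h1 : p ζ = 0 := by rw [← hpB, hζ, map_zero]
    have h2 := hB ζ
    rw [hζ, h1, sub_zero, add_zero] at h2
    exact h ζ h1 (sub_eq_zero.1 h2.symm)
  have hUD : IsCompactOperator (-(U ∘L D)) := by
    have : IsCompactOperator (U ∘L D) := hDc.clm_comp U
    exact this.neg
  have hunit : IsUnit (1 + U ∘L D) := by
    rcases hUD.hasEigenvalue_or_mem_resolventSet (μ := (1 : ℂ)) one_ne_zero with he | hr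
    · exfalso
      obtain ⟨z, hz⟩ := he.exists_hasEigenvector
      have h1 : -(U (D z)) = (1 : ℂ) • z := hz.apply_eq_smul
      apply hz.2
      apply hinj
      rw [one_smul] at h1
      have h2 : z + U (D z) = 0 := by rw [add_comm]; exact neg_eq_iff_add_eq_zero.1 h1
      rw [← hU (U z + D z), map_add U, hU, h2, map_zero]
    · rw [spectrum.mem_resolventSet_iff] at hr
      simpa using hr
  obtain ⟨ζ, hζ⟩ := (ContinuousLinearMap.isUnit_iff_bijective.1 hunit).2 (U η)
  have h1 : U ζ + D ζ = η := by
    have : ζ + U (D ζ) = U η := hζ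
    rw [← hU (D ζ), ← map_add, this, hU]
  have h2 : p ζ = 0 := by rw [← hpB, h1, hη]
  refine ⟨ζ, h2, ?_⟩
  have h3 := hB ζ
  rw [h1, h2, sub_zero, add_zero] at h3
  rw [h3, sub_add_cancel]

theorem isUnit_part_of_forall {V : E → ℝ} {U C : L2 →L[ℂ] L2} (hU : ∀ ζ, U (U ζ) = ζ)
    (hC : IsCompactOperator C) (h : ∀ ζ ∈ QL2 V, (U + C) ζ ∈ ℂ ∙ vVec V → ζ = 0) :
    IsUnit (part (QL2 V) (U + C)) := by
  rw [ContinuousLinearMap.isUnit_iff_bijective]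
  constructor
  · rw [injective_iff_map_eq_zero]
    intro z hz
    have h1 := part_eq_zero_iff.1 hz
    rw [orthogonal_QL2] at h1
    exact Subtype.ext (h _ z.2 h1)
  · intro η
    obtain ⟨ζ, h1, h2⟩ := exists_of_compact_perturbation (p := P V) hU hC (isCompactOperator_P V)
      (fun ζ => P_eq_self (P_mem V ζ))
      (fun ζ h1 h2 => h ζ (P_eq_zero_iff.1 h1) (h2 ▸ P_mem V _)) η (P_eq_zero_iff.2 η.2)
    refine ⟨⟨ζ, P_eq_zero_iff.1 h1⟩, ?_⟩
    have h3 : (QL2 V).orthogonalProjectionOnto (P V ((U + C) ζ)) = 0 := by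
      rw [Submodule.orthogonalProjectionOnto_eq_zero_iff, orthogonal_QL2]
      exact P_mem V _
    rw [part_apply, h2, map_add, h3, add_zero]
    exact Submodule.orthogonalProjectionOnto_mem_subspace_eq_self η

section Potential

variable {V : E → ℝ}

lemma vFun_sq (x : E) : vFun V x ^ 2 = |V x| := Real.sq_sqrt (abs_nonneg _)

lemma uFun_sq (x : E) : uFun V x * uFun V x = 1 := by
  unfold uFun; split_ifs <;> norm_num

lemma abs_uFun (x : E) : |uFun V x| = 1 := by
  unfold uFun; split_ifs <;> norm_num

lemma vFun_mul_wFun (x : E) : vFun V x * wFun V x = V x := by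
  have : wFun V x * vFun V x = uFun V x * vFun V x ^ 2 := by unfold wFun; ring
  rw [mul_comm, this, vFun_sq]
  unfold uFun
  split_ifs with h
  · rw [abs_of_nonneg h, one_mul]
  · rw [abs_of_neg (not_le.1 h)]; ring

lemma uFun_mul_wFun (x : E) : uFun V x * wFun V x = vFun V x := by
  unfold wFun; rw [← mul_assoc, uFun_sq, one_mul]

lemma LogDecay.aesm_vFun {k : ℝ} (hV : LogDecay k V) : AEStronglyMeasurable (vFun V) volume :=
  (Real.continuous_sqrt.comp continuous_abs).comp_aestronglyMeasurable hV.aestronglyMeasurable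

lemma LogDecay.aesm_uFun {k : ℝ} (hV : LogDecay k V) : AEStronglyMeasurable (uFun V) volume := by
  have h : Measurable fun t : ℝ => if 0 ≤ t then (1 : ℝ) else -1 :=
    Measurable.ite measurableSet_Ici measurable_const measurable_const
  exact (h.comp_aemeasurable hV.aestronglyMeasurable.aemeasurable).aestronglyMeasurable

lemma aesm_ofReal {f : E → ℝ} (h : AEStronglyMeasurable f volume) :
    AEStronglyMeasurable (fun x => (f x : ℂ)) volume :=
  Complex.continuous_ofReal.comp_aestronglyMeasurable h

lemma LogDecay.memLp_vFun (hV : LogDecay 0 V) : MemLp (fun x => (vFun V x : ℂ)) 2 volume := by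
  rw [memLp_two_iff_integrable_sq_norm (aesm_ofReal hV.aesm_vFun)]
  refine hV.integrable_abs.congr (.of_forall fun x => ?_)
  simp only [Complex.norm_real, Real.norm_eq_abs, sq_abs, vFun_sq]

lemma LogDecay.vVec_ae (hV : LogDecay 0 V) : vVec V =ᵐ[volume] fun x => (vFun V x : ℂ) := by
  unfold vVec
  rw [dif_pos hV.memLp_vFun]
  exact hV.memLp_vFun.coeFn_toLp

lemma LogDecay.inner_vVec (hV : LogDecay 0 V) (ζ : L2) :
    inner ℂ (vVec V) ζ = ∫ y, (vFun V y : ℂ) * ζ y := by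
  rw [L2.inner_def]
  refine integral_congr_ae ?_
  filter_upwards [hV.vVec_ae] with y hy
  rw [hy]; simp [mul_comm]

lemma LogDecay.vVec_ne_zero (hV : LogDecay 0 V) (hV0 : ¬ V =ᵐ[volume] 0) : vVec V ≠ 0 := by
  intro h
  apply hV0
  have h1 := hV.vVec_ae
  rw [h] at h1
  filter_upwards [h1, Lp.coeFn_zero ℂ 2 (volume : Measure E)] with x hx h0
  rw [h0] at hx
  have : vFun V x = 0 := by simpa using hx.symm
  rw [← vFun_mul_wFun (V := V) x, this]; simp

lemma LogDecay.integrable_vL2 (hV : LogDecay 0 V) (ζ : L2) :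
    Integrable fun y => (vFun V y : ℂ) * ζ y := integrable_mul_L2 hV.memLp_vFun ζ

lemma N0_sub_eq (x y : E) :
    N0 (x - y) = (-(1 / (8 * Real.pi ^ 2)) : ℝ) * ((logKer x y + Real.log (1 + ‖x‖) : ℝ) : ℂ) := by
  simp only [N0, logKer]
  push_cast
  ring

lemma measurable_N0 : Measurable N0 :=
  Complex.measurable_ofReal.comp (measurable_log_norm.neg.div_const _)

lemma LogDecay.memLp_logKer (hV : LogDecay 0 V) (x : E) :
    MemLp (fun y => (logKer x y : ℂ) * (vFun V y : ℂ)) 2 volume := by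
  obtain ⟨C, -, h⟩ := hV.exists_logKer_bound
  have hm : AEStronglyMeasurable (fun y => (logKer x y : ℂ) * (vFun V y : ℂ)) volume :=
    (Complex.measurable_ofReal.comp (measurable_logKer x)).aestronglyMeasurable.mul
      (aesm_ofReal hV.aesm_vFun)
  rw [memLp_two_iff_integrable_sq_norm hm]
  refine (h x).1.congr (.of_forall fun y => ?_)
  simp only [norm_mul, Complex.norm_real, Real.norm_eq_abs, mul_pow, sq_abs, vFun_sq]

lemma LogDecay.integrable_logKer (hV : LogDecay 0 V) (ζ : L2) (x : E) :
    Integrable fun y => (logKer x y : ℂ) * ((vFun V y : ℂ) * ζ y) := by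
  simpa only [mul_assoc] using integrable_mul_L2 (hV.memLp_logKer x) ζ

lemma LogDecay.N0v_eq (hV : LogDecay 0 V) (ζ : L2) (x : E) :
    N0v V ζ x = (-(1 / (8 * Real.pi ^ 2)) : ℝ) * ((∫ y, (logKer x y : ℂ) * ((vFun V y : ℂ) * ζ y)) +
      (Real.log (1 + ‖x‖) : ℝ) * ∫ y, (vFun V y : ℂ) * ζ y) := by
  rw [← integral_const_mul, ← integral_add (hV.integrable_logKer ζ x)
    ((hV.integrable_vL2 ζ).const_mul _), ← integral_const_mul, N0v]
  refine integral_congr_ae (.of_forall fun y => ?_)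
  simp only [N0_sub_eq]
  push_cast
  ring

lemma LogDecay.integrable_N0v (hV : LogDecay 0 V) (ζ : L2) (x : E) :
    Integrable fun y => N0 (x - y) * ((vFun V y : ℂ) * ζ y) := by
  refine ((((hV.integrable_logKer ζ x).add ((hV.integrable_vL2 ζ).const_mul
    (Real.log (1 + ‖x‖) : ℂ))).const_mul ((-(1 / (8 * Real.pi ^ 2)) : ℝ) : ℂ))).congr
    (.of_forall fun y => ?_)
  simp only [N0_sub_eq, Pi.add_apply]
  push_cast
  ring

/-- The kernel of `M_v N₀ M_v`. -/
def vN0v (V : E → ℝ) (p : E × E) : ℂ := (vFun V p.1 : ℂ) * N0 (p.1 - p.2) * (vFun V p.2 : ℂ)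

/-- Splitting off log(1 + |x|) from the kernel bounds the square integral of the section at x by a
multiple of |V(x)| (1 + log²(1 + |x|)), which is integrable. -/
lemma LogDecay.memLp_vN0v (hV : LogDecay 0 V) : MemLp (vN0v V) 2 volume := by
  have hm : AEStronglyMeasurable (vN0v V) volume :=
    ((aesm_ofReal hV.aesm_vFun).comp_fst.mul
      (measurable_N0.comp (measurable_fst.sub measurable_snd)).aestronglyMeasurable).mul
      (aesm_ofReal hV.aesm_vFun).comp_snd
  rw [memLp_two_iff_integrable_sq_norm hm]
  obtain ⟨C, hC, h⟩ := hV.exists_logKer_bound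
  set c : ℝ := (1 / (8 * Real.pi ^ 2)) ^ 2 with hc
  have hsec : ∀ x y, ‖vN0v V (x, y)‖ ^ 2 ≤
      c * |V x| * (2 * (logKer x y ^ 2 * |V y|) + 2 * Real.log (1 + ‖x‖) ^ 2 * |V y|) := by
    intro x y
    simp only [vN0v, N0_sub_eq, norm_mul, Complex.norm_real, Real.norm_eq_abs, mul_pow, sq_abs,
      vFun_sq, neg_sq]
    have : (logKer x y + Real.log (1 + ‖x‖)) ^ 2 ≤
        2 * logKer x y ^ 2 + 2 * Real.log (1 + ‖x‖) ^ 2 := by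
      nlinarith [sq_nonneg (logKer x y - Real.log (1 + ‖x‖))]
    have h0 : 0 ≤ c * |V x| * |V y| := by positivity
    nlinarith [mul_le_mul_of_nonneg_left this h0]
  have hsi : ∀ x, Integrable fun y => c * |V x| *
      (2 * (logKer x y ^ 2 * |V y|) + 2 * Real.log (1 + ‖x‖) ^ 2 * |V y|) := fun x =>
    (((h x).1.const_mul 2).add (hV.integrable_abs.const_mul _)).const_mul _
  have hint : ∀ᵐ x, Integrable fun y => ‖vN0v V (x, y)‖ ^ 2 := by
    filter_upwards [(hm.norm.pow 2).prodMk_left] with x hx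
    refine (hsi x).mono' hx (.of_forall fun y => ?_)
    rw [Real.norm_of_nonneg (by positivity)]
    exact hsec x y
  refine (integrable_prod_iff (hm.norm.pow 2)).2 ⟨hint, ?_⟩
  have hdom : Integrable fun x => c * (2 * C * |V x| +
      2 * (∫ y, |V y|) * (Real.log (1 + ‖x‖) ^ 2 * |V x|)) :=
    ((hV.integrable_abs.const_mul _).add (hV.integrable_log_sq.const_mul _)).const_mul _
  refine hdom.mono' (hm.norm.pow 2).norm.integral_prod_right' ?_
  filter_upwards [hint] with x hx
  simp only [Pi.pow_apply, norm_pow, norm_norm] at hx ⊢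
  rw [Real.norm_of_nonneg (integral_nonneg fun y => by positivity)]
  refine (integral_mono hx (hsi x) (hsec x)).trans ?_
  rw [integral_const_mul, integral_add ((h x).1.const_mul 2) (hV.integrable_abs.const_mul _),
    integral_const_mul, integral_const_mul]
  have h1 := (h x).2
  have h2 : 0 ≤ c * |V x| := by positivity
  nlinarith [mul_le_mul_of_nonneg_left h1 h2]

lemma vN0v_symm (x y : E) : vN0v V (y, x) = conj (vN0v V (x, y)) := by
  simp only [vN0v, N0, map_mul, Complex.conj_ofReal]
  rw [norm_sub_rev]
  ring

lemma memLp_uFun_mul {k : ℝ} (hV : LogDecay k V) (ζ : L2) :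
    MemLp (fun x => (uFun V x : ℂ) * ζ x) 2 volume :=
  (Lp.memLp ζ).of_le ((aesm_ofReal hV.aesm_uFun).mul (Lp.aestronglyMeasurable ζ))
    (.of_forall fun x => by simp [abs_uFun])

/-- Multiplication by the sign of the potential. -/
def mulU {k : ℝ} (hV : LogDecay k V) : L2 →L[ℂ] L2 :=
  LinearMap.mkContinuous
    { toFun := fun ζ => (memLp_uFun_mul hV ζ).toLp _
      map_add' := fun a b => by
        rw [← MemLp.toLp_add]
        refine MemLp.toLp_congr _ _ ?_
        filter_upwards [Lp.coeFn_add a b] with x hx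
        simp only [hx, Pi.add_apply, mul_add]
      map_smul' := fun c a => by
        rw [RingHom.id_apply, ← MemLp.toLp_const_smul]
        refine MemLp.toLp_congr _ _ ?_
        filter_upwards [Lp.coeFn_smul c a] with x hx
        simp only [hx, Pi.smul_apply, smul_eq_mul]
        ring } 1 (fun ζ => by
      rw [one_mul]
      change ‖(memLp_uFun_mul hV ζ).toLp _‖ ≤ ‖ζ‖
      rw [Lp.norm_toLp, Lp.norm_def]
      refine le_of_eq (congrArg _ (eLpNorm_congr_norm_ae (.of_forall fun x => ?_)))
      simp [abs_uFun])

lemma mulU_ae {k : ℝ} (hV : LogDecay k V) (ζ : L2) :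
    mulU hV ζ =ᵐ[volume] fun x => (uFun V x : ℂ) * ζ x :=
  (memLp_uFun_mul hV ζ).coeFn_toLp

lemma mulU_mulU {k : ℝ} (hV : LogDecay k V) (ζ : L2) : mulU hV (mulU hV ζ) = ζ := by
  refine Lp.ext ?_
  filter_upwards [mulU_ae hV ζ, mulU_ae hV (mulU hV ζ)] with x h1 h2
  rw [h2, h1, ← mul_assoc]
  norm_cast
  rw [uFun_sq]; simp

lemma inner_mulU {k : ℝ} (hV : LogDecay k V) (ζ η : L2) :
    inner ℂ (mulU hV ζ) η = inner ℂ ζ (mulU hV η) := by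
  rw [L2.inner_def, L2.inner_def]
  refine integral_congr_ae ?_
  filter_upwards [mulU_ae hV ζ, mulU_ae hV η] with x h1 h2
  rw [h1, h2]
  simp
  ring

lemma LogDecay.isT0 (hV : LogDecay 0 V) : IsT0 V (mulU hV + kernelOp hV.memLp_vN0v) := by
  intro ζ
  filter_upwards [Lp.coeFn_add (mulU hV ζ) (kernelOp hV.memLp_vN0v ζ), mulU_ae hV ζ,
    kernelOp_apply hV.memLp_vN0v ζ] with x h1 h2 h3
  have h4 : (mulU hV + kernelOp hV.memLp_vN0v) ζ = mulU hV ζ + kernelOp hV.memLp_vN0v ζ := rfl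
  rw [h4, h1, Pi.add_apply, h2, h3, N0v, ← integral_const_mul]
  congr 1
  refine integral_congr_ae (.of_forall fun y => ?_)
  simp only [vN0v]
  ring

theorem LogDecay.isT0_T0 (hV : LogDecay 0 V) : IsT0 V (T0 V) := by
  have h : ∃ T, IsT0 V T := ⟨_, hV.isT0⟩
  unfold T0
  rw [dif_pos h]
  exact h.choose_spec

lemma LogDecay.T0_eq (hV : LogDecay 0 V) : T0 V = mulU hV + kernelOp hV.memLp_vN0v := by
  ext1 ζ
  exact Lp.ext ((hV.isT0_T0 ζ).trans (hV.isT0 ζ).symm)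

lemma LogDecay.inner_T0 (hV : LogDecay 0 V) (ζ η : L2) :
    inner ℂ (T0 V ζ) η = inner ℂ ζ (T0 V η) := by
  rw [hV.T0_eq, _root_.add_apply, _root_.add_apply, inner_add_left,
    inner_add_right, inner_mulU, inner_kernelOp _ vN0v_symm]

lemma mem_S1_iff {ζ : L2} :
    ζ ∈ S1 V ↔ inner ℂ (vVec V) ζ = 0 ∧ T0 V ζ ∈ ℂ ∙ vVec V := by
  rw [S1, mem_kerPart_iff, mem_QL2_iff, orthogonal_QL2]

/-- An invertible operator has trivial kernel; the converse is the Fredholm alternative for T₀ = U +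
compact. -/
theorem LogDecay.isSingularAtZero_iff (hV : LogDecay 0 V) : IsSingularAtZero V ↔ S1 V ≠ ⊥ := by
  rw [IsSingularAtZero, not_iff_not]
  constructor
  · intro h
    rw [ContinuousLinearMap.isUnit_iff_bijective] at h
    rw [eq_bot_iff]
    intro ζ hζ
    obtain ⟨h1, h2⟩ := mem_kerPart_iff.1 hζ
    have h3 : part (QL2 V) (T0 V) ⟨ζ, h1⟩ = 0 := part_eq_zero_iff.2 h2
    have := h.1 (h3.trans (map_zero _).symm)
    simpa using congrArg Subtype.val this
  · intro h
    rw [hV.T0_eq]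
    refine isUnit_part_of_forall (mulU_mulU hV) (isCompactOperator_kernelOp _) fun ζ h1 h2 => ?_
    have : ζ ∈ S1 V := mem_S1_iff.2 ⟨mem_QL2_iff.1 h1, by rwa [hV.T0_eq]⟩
    rw [h] at this
    simpa using this

end Potential

/-! ### Bounded solutions -/

section Potential

variable {V : E → ℝ}

/-- The constant in the definition of `Phi`. -/
def cst (V : E → ℝ) (ζ : L2) : ℂ := ((‖vVec V‖ ^ 2)⁻¹ : ℝ) * inner ℂ (vVec V) (P V (T0 V ζ))

lemma Phi_eq (ζ : L2) (x : E) : Phi V ζ x = N0v V ζ x - cst V ζ := rfl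

lemma cst_eq_of_T0_eq (hv : vVec V ≠ 0) {ζ : L2} {c : ℂ} (h : T0 V ζ = c • vVec V) :
    cst V ζ = c := by
  have h1 : ((‖vVec V‖ ^ 2 : ℝ) : ℂ) ≠ 0 := by
    have := norm_ne_zero_iff.2 hv
    exact_mod_cast pow_ne_zero 2 this
  rw [cst, h, P_eq_self (Submodule.smul_mem _ _ (Submodule.mem_span_singleton_self _)),
    inner_smul_right, inner_self_eq_norm_sq_to_K]
  push_cast at h1 ⊢
  field_simp
  exact mul_div_cancel_right₀ _ h1

lemma T0_eq_cst (hv : vVec V ≠ 0) {ζ : L2} (hζ : ζ ∈ S1 V) : T0 V ζ = cst V ζ • vVec V := by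
  obtain ⟨c, hc⟩ := Submodule.mem_span_singleton.1 (mem_S1_iff.1 hζ).2
  rw [cst_eq_of_T0_eq hv hc.symm, hc]

lemma norm_cst_le (ζ : L2) : ‖cst V ζ‖ ≤ (‖vVec V‖ ^ 2)⁻¹ * (‖vVec V‖ * ‖T0 V‖) * ‖ζ‖ := by
  rw [cst, norm_mul, Complex.norm_real, Real.norm_of_nonneg (by positivity), mul_assoc]
  refine mul_le_mul_of_nonneg_left ((norm_inner_le_norm _ _).trans ?_) (by positivity)
  rw [mul_assoc]
  refine mul_le_mul_of_nonneg_left ?_ (norm_nonneg _)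
  exact ((Submodule.norm_starProjection_apply_le _ _).trans ((T0 V).le_opNorm ζ))

/-- Multiply Uζ + vN₀(vζ) = cv by U and use U² = 1. -/
lemma LogDecay.eq_neg_wFun_mul (hV : LogDecay 0 V) {ζ : L2} {c : ℂ} (h : T0 V ζ = c • vVec V) :
    ζ =ᵐ[volume] fun x => -((wFun V x : ℂ) * (N0v V ζ x - c)) := by
  have h1 := hV.isT0_T0 ζ
  rw [h] at h1
  filter_upwards [h1, Lp.coeFn_smul c (vVec V), hV.vVec_ae] with x h1 h2 h3
  rw [h2, Pi.smul_apply, h3, smul_eq_mul] at h1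
  have hu : (uFun V x : ℂ) * uFun V x = 1 := by exact_mod_cast uFun_sq x
  have h4 : ζ x = uFun V x * (uFun V x * ζ x) := by rw [← mul_assoc, hu, one_mul]
  have h5 : (uFun V x : ℂ) * ζ x = c * vFun V x - vFun V x * N0v V ζ x := by rw [h1]; ring
  rw [h4, h5, wFun]
  push_cast
  ring

lemma LogDecay.aesm_N0v (hV : LogDecay 0 V) (ζ : L2) : AEStronglyMeasurable (N0v V ζ) volume := by
  have : AEStronglyMeasurable (fun p : E × E => N0 (p.1 - p.2) * ((vFun V p.2 : ℂ) * ζ p.2))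
      (volume.prod volume) :=
    (measurable_N0.comp (measurable_fst.sub measurable_snd)).aestronglyMeasurable.mul
      ((aesm_ofReal hV.aesm_vFun).mul (Lp.aestronglyMeasurable ζ)).comp_snd
  exact this.integral_prod_right'

lemma LogDecay.exists_logKer_norm_bound (hV : LogDecay 0 V) : ∃ M : ℝ, 0 ≤ M ∧ ∀ (ζ : L2) (x : E),
    ∫ y, ‖(logKer x y : ℂ) * ((vFun V y : ℂ) * ζ y)‖ ≤ M * ‖ζ‖ := by
  obtain ⟨C, hC, h⟩ := hV.exists_logKer_bound
  refine ⟨Real.sqrt C, Real.sqrt_nonneg _, fun ζ x => ?_⟩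
  have h1 := integral_norm_mul_L2_le (hV.memLp_logKer x) ζ
  simp only [mul_assoc] at h1
  refine h1.trans (mul_le_mul_of_nonneg_right (Real.sqrt_le_sqrt ?_) (norm_nonneg _))
  simp only [norm_mul, Complex.norm_real, Real.norm_eq_abs, mul_pow, sq_abs, vFun_sq]
  exact (h x).2

lemma LogDecay.exists_N0_norm_bound (hV : LogDecay 0 V) (ζ : L2) : ∃ M : ℝ, 0 ≤ M ∧ ∀ x : E,
    ∫ y, ‖N0 (x - y) * ((vFun V y : ℂ) * ζ y)‖ ≤ M * (1 + Real.log (1 + ‖x‖)) := by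
  obtain ⟨M, hM, h⟩ := hV.exists_logKer_norm_bound
  set c : ℝ := 1 / (8 * Real.pi ^ 2) with hc
  have hc0 : 0 ≤ c := by positivity
  set I := ∫ y, ‖(vFun V y : ℂ) * ζ y‖ with hI
  have hI0 : 0 ≤ I := integral_nonneg fun y => norm_nonneg _
  refine ⟨c * (M * ‖ζ‖ + I), by positivity, fun x => ?_⟩
  have hl : 0 ≤ Real.log (1 + ‖x‖) := Real.log_nonneg (by linarith [norm_nonneg x])
  have hb : ∀ y, ‖N0 (x - y) * ((vFun V y : ℂ) * ζ y)‖ ≤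
      c * (‖(logKer x y : ℂ) * ((vFun V y : ℂ) * ζ y)‖ +
        Real.log (1 + ‖x‖) * ‖(vFun V y : ℂ) * ζ y‖) := by
    intro y
    rw [N0_sub_eq, norm_mul, norm_mul, norm_mul (logKer x y : ℂ), ← add_mul, ← mul_assoc]
    refine mul_le_mul_of_nonneg_right ?_ (norm_nonneg _)
    rw [Complex.norm_real, Complex.norm_real, Complex.norm_real, norm_neg,
      Real.norm_of_nonneg hc0]
    refine mul_le_mul_of_nonneg_left ((norm_add_le _ _).trans ?_) hc0
    rw [Real.norm_of_nonneg hl]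
  have i1 := (hV.integrable_logKer ζ x).norm
  have i2 := ((hV.integrable_vL2 ζ).norm.const_mul (Real.log (1 + ‖x‖)))
  refine (integral_mono (hV.integrable_N0v ζ x).norm ((i1.add i2).const_mul c) hb).trans ?_
  simp only [Pi.add_apply]
  rw [integral_const_mul, integral_add i1 i2, integral_const_mul, mul_assoc c]
  refine mul_le_mul_of_nonneg_left ?_ hc0
  have h1 := h ζ x
  have h2 : 0 ≤ M * ‖ζ‖ := by positivity
  nlinarith [mul_nonneg h2 hl]

lemma LogDecay.integrable_N0v_mul (hV : LogDecay 0 V) (ζ : L2) {ψ : E → ℂ} (hψ : IsTest ψ) :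
    Integrable fun p : E × E => N0 (p.1 - p.2) * ((vFun V p.2 : ℂ) * ζ p.2) * ψ p.1 := by
  have hm : AEStronglyMeasurable
      (fun p : E × E => N0 (p.1 - p.2) * ((vFun V p.2 : ℂ) * ζ p.2) * ψ p.1) volume :=
    ((measurable_N0.comp (measurable_fst.sub measurable_snd)).aestronglyMeasurable.mul
      ((aesm_ofReal hV.aesm_vFun).mul (Lp.aestronglyMeasurable ζ)).comp_snd).mul
      (hψ.continuous.comp continuous_fst).aestronglyMeasurable
  refine (integrable_prod_iff hm).2 ⟨.of_forall fun x => (hV.integrable_N0v ζ x).mul_const (ψ x), ?_⟩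
  obtain ⟨M, hM, h⟩ := hV.exists_N0_norm_bound ζ
  have hd : Integrable fun x => M * (1 + Real.log (1 + ‖x‖)) * ‖ψ x‖ :=
    ((continuous_const.mul continuous_one_add_log).mul
      hψ.continuous.norm).integrable_of_hasCompactSupport hψ.2.norm.mul_left
  refine hd.mono' hm.norm.integral_prod_right' (.of_forall fun x => ?_)
  rw [Real.norm_of_nonneg (integral_nonneg fun y => norm_nonneg _)]
  simp only [norm_mul _ (ψ _)]
  rw [integral_mul_const]
  exact mul_le_mul_of_nonneg_right (h x) (norm_nonneg _)

lemma integral_N0_sub_bilap {ψ : E → ℂ} (hψ : IsTest ψ) (y : E) :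
    ∫ x, N0 (x - y) * lapIter 2 ψ x = ψ y := by
  have h1 := hψ.comp_affine (c := 1) one_ne_zero y
  have h2 : ∫ x, N0 x * lapIter 2 (fun x => ψ ((1 : ℝ) • x + y)) x = ψ ((1 : ℝ) • 0 + y) :=
    integral_N0_bilap h1
  rw [lapIter_comp_affine hψ.1] at h2
  simp only [Complex.ofReal_one, one_pow, one_mul, one_smul, zero_add] at h2
  rw [← h2, ← integral_sub_right_eq_self (fun x => N0 x * lapIter 2 ψ (x + y)) y]
  simp only [sub_add_cancel]

/-- Fubini and Δ²N₀ = δ: the weak form of Δ²N₀(vζ) = vζ. -/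
lemma LogDecay.integral_N0v_bilap (hV : LogDecay 0 V) (ζ : L2) {ψ : E → ℂ} (hψ : IsTest ψ) :
    ∫ x, N0v V ζ x * lapIter 2 ψ x = ∫ y, (vFun V y : ℂ) * ζ y * ψ y := by
  simp only [N0v, ← integral_mul_const]
  rw [integral_integral_swap (hV.integrable_N0v_mul ζ (hψ.lapIter 2))]
  refine integral_congr_ae (.of_forall fun y => ?_)
  dsimp only
  rw [← integral_N0_sub_bilap hψ y, ← integral_const_mul]
  refine integral_congr_ae (.of_forall fun x => ?_)
  dsimp only
  ring

lemma integral_lapIter_succ {ψ : E → ℂ} (hψ : IsTest ψ) (k : ℕ) : ∫ x, lapIter (k + 1) ψ x = 0 := by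
  have := integral_mul_lap (M := fun _ => 1) contDiff_const (hψ.lapIter k)
  rw [lapIter_succ]
  simpa using this

/-- Orthogonality to v removes the only growing term, log(1 + |x|)∫ vζ. Cauchy-Schwarz bounds the
rest uniformly in x, with a constant linear in ‖ζ‖, so that Φ is also continuous into L^∞. -/
lemma LogDecay.exists_Phi_bound (hV : LogDecay 0 V) : ∃ M : ℝ, 0 ≤ M ∧ ∀ ζ ∈ S1 V, ∀ x,
    ‖Phi V ζ x‖ ≤ M * ‖ζ‖ := by
  obtain ⟨M, hM, h⟩ := hV.exists_logKer_norm_bound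
  set c : ℝ := 1 / (8 * Real.pi ^ 2) with hc
  have hc0 : 0 ≤ c := by positivity
  refine ⟨c * M + (‖vVec V‖ ^ 2)⁻¹ * (‖vVec V‖ * ‖T0 V‖), by positivity, fun ζ hζ x => ?_⟩
  rw [Phi_eq]
  refine (norm_sub_le _ _).trans ?_
  rw [add_mul]
  refine add_le_add ?_ (norm_cst_le ζ)
  have h0 := (mem_S1_iff.1 hζ).1
  rw [hV.inner_vVec] at h0
  rw [hV.N0v_eq, h0, mul_zero, add_zero, norm_mul, Complex.norm_real, norm_neg,
    Real.norm_of_nonneg hc0, mul_assoc]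
  exact mul_le_mul_of_nonneg_left ((norm_integral_le_integral_norm _).trans (h ζ x)) hc0

lemma LogDecay.aesm_Phi (hV : LogDecay 0 V) (ζ : L2) : AEStronglyMeasurable (Phi V ζ) volume :=
  (hV.aesm_N0v ζ).sub aestronglyMeasurable_const

lemma LogDecay.memLp_Phi (hV : LogDecay 0 V) {ζ : L2} (hζ : ζ ∈ S1 V) : MemLp (Phi V ζ) ⊤ volume := by
  obtain ⟨M, -, h⟩ := hV.exists_Phi_bound
  exact memLp_top_of_bound (hV.aesm_Phi ζ) _ (.of_forall (h ζ hζ))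

lemma LogDecay.ae_eq_neg_wFun_mul_Phi (hV : LogDecay 0 V) (hv : vVec V ≠ 0) {ζ : L2}
    (hζ : ζ ∈ S1 V) : ζ =ᵐ[volume] fun x => -((wFun V x : ℂ) * Phi V ζ x) :=
  hV.eq_neg_wFun_mul (T0_eq_cst hv hζ)

lemma LogDecay.vFun_mul_ae (hV : LogDecay 0 V) (hv : vVec V ≠ 0) {ζ : L2}
    (hζ : ζ ∈ S1 V) : (fun x => (vFun V x : ℂ) * ζ x) =ᵐ[volume] fun x => -((V x : ℂ) * Phi V ζ x) := by
  filter_upwards [hV.ae_eq_neg_wFun_mul_Phi hv hζ] with x hx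
  rw [hx, ← vFun_mul_wFun (V := V) x]
  push_cast
  ring

lemma LogDecay.integral_Phi_bilap (hV : LogDecay 0 V) {ζ : L2} {ψ : E → ℂ} (hψ : IsTest ψ) :
    ∫ x, Phi V ζ x * lapIter 2 ψ x = ∫ y, (vFun V y : ℂ) * ζ y * ψ y := by
  simp only [Phi_eq, sub_mul]
  rw [integral_sub, hV.integral_N0v_bilap ζ hψ, integral_const_mul, integral_lapIter_succ hψ,
    mul_zero, sub_zero]
  · refine (hV.integrable_N0v_mul ζ (hψ.lapIter 2)).integral_prod_left.congr (.of_forall fun x => ?_)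
    simp only [N0v, integral_mul_const]
  · exact (hψ.lapIter 2).integrable.const_mul _

lemma integrable_bdd_mul_test {u ψ : E → ℂ} (hu : MemLp u ⊤ volume) (hψ : IsTest ψ) :
    Integrable fun x => u x * ψ x :=
  integrable_mul_test (hu.locallyIntegrable le_top) hψ

lemma LogDecay.integrable_V_mul (hV : LogDecay 0 V) {u ψ : E → ℂ} (hu : MemLp u ⊤ volume)
    (hψ : MemLp ψ ⊤ volume) : Integrable fun x => (V x : ℂ) * u x * ψ x := by
  have h1 : MemLp (fun x => (V x : ℂ)) 1 volume := by
    refine MemLp.ofReal ?_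
    rw [memLp_one_iff_integrable]
    exact (integrable_norm_iff hV.aestronglyMeasurable).1 (by simpa using hV.integrable_abs)
  have h2 : MemLp (fun x => u x * ψ x) ⊤ volume := hψ.mul hu
  have := memLp_one_iff_integrable.1 (h2.mul (r := 1) h1)
  refine this.congr (.of_forall fun x => ?_)
  simp [mul_assoc]

lemma IsTest.memLp_top {ψ : E → ℂ} (hψ : IsTest ψ) : MemLp ψ ⊤ volume :=
  hψ.continuous.memLp_top_of_hasCompactSupport hψ.2 _

lemma LogDecay.Phi_mem_NInf (hV : LogDecay 0 V) (hv : vVec V ≠ 0) {ζ : L2} (hζ : ζ ∈ S1 V) :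
    (hV.memLp_Phi hζ).toLp _ ∈ NInf V := by
  intro ψ hψ
  have hae := (hV.memLp_Phi hζ).coeFn_toLp
  have hcongr : (fun x => (hV.memLp_Phi hζ).toLp _ x * Δ (Δ ψ) x +
      (V x : ℂ) * (hV.memLp_Phi hζ).toLp _ x * ψ x) =ᵐ[volume]
      fun x => Phi V ζ x * lapIter 2 ψ x + (V x : ℂ) * Phi V ζ x * ψ x := by
    filter_upwards [hae] with x hx
    rw [hx]; rfl
  have i1 := integrable_bdd_mul_test (hV.memLp_Phi hζ) (hψ.lapIter 2)
  have i2 := hV.integrable_V_mul (hV.memLp_Phi hζ) hψ.memLp_top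
  refine ⟨(integrable_congr hcongr).2 (i1.add i2), ?_⟩
  rw [integral_congr_ae hcongr, integral_add i1 i2, hV.integral_Phi_bilap hψ]
  have : ∀ᵐ x, (vFun V x : ℂ) * ζ x * ψ x = -((V x : ℂ) * Phi V ζ x * ψ x) := by
    filter_upwards [hV.vFun_mul_ae hv hζ] with x hx
    rw [hx]; ring
  rw [integral_congr_ae this, integral_neg, neg_add_cancel]

lemma LogDecay.memLp_wFun_mul (hV : LogDecay 0 V) (φ : LInf) :
    MemLp (fun x => -((wFun V x : ℂ) * φ x)) 2 volume := by
  have h1 : MemLp (fun x => (wFun V x : ℂ)) 2 volume := by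
    refine hV.memLp_vFun.of_le (aesm_ofReal (hV.aesm_uFun.mul hV.aesm_vFun)) (.of_forall fun x => ?_)
    simp [wFun, abs_uFun]
  exact ((Lp.memLp φ).mul (r := 2) h1).neg

/-- The map `φ ↦ -wφ`. -/
def negW (hV : LogDecay 0 V) (φ : LInf) : L2 := (hV.memLp_wFun_mul φ).toLp _

lemma negW_ae (hV : LogDecay 0 V) (φ : LInf) :
    negW hV φ =ᵐ[volume] fun x => -((wFun V x : ℂ) * φ x) := (hV.memLp_wFun_mul φ).coeFn_toLp

lemma exists_norm_gt_of_ae {p : E → Prop} (hp : ∀ᵐ x, p x) (R : ℝ) : ∃ x, R < ‖x‖ ∧ p x := by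
  have hopen : IsOpen {x : E | R < ‖x‖} := isOpen_lt continuous_const continuous_norm
  have hne : {x : E | R < ‖x‖}.Nonempty := NormedSpace.exists_lt_norm ℝ E R
  by_contra! h
  have : volume {x : E | R < ‖x‖} = 0 := measure_mono_null (fun x hx => h x hx) hp
  exact (hopen.measure_pos volume hne).ne' this

lemma ae_norm_le_LInf (φ : LInf) : ∀ᵐ x, ‖φ x‖ ≤ ‖φ‖ := by
  have h := ae_le_eLpNormEssSup (f := φ) (μ := volume)
  filter_upwards [h] with x hx
  rw [Lp.norm_def, eLpNorm_exponent_top]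
  have hfin : eLpNormEssSup φ volume ≠ ⊤ := by
    have := (Lp.memLp φ).2.ne; rwa [eLpNorm_exponent_top] at this
  simpa using ENNReal.toReal_mono hfin hx

/-- For ζ = -wφ one has vζ = -Vφ, so φ and N₀(vζ) have the same bilaplacian and differ by a constant
c, by Liouville's theorem. The mean ∫ vζ must vanish, as otherwise N₀(vζ) would grow like log|x|.
Then T₀ζ = -cv follows by substitution. -/
theorem LogDecay.negW_spec (hV : LogDecay 0 V) (hv : vVec V ≠ 0) {φ : LInf} (hφ : φ ∈ NInf V) :
    negW hV φ ∈ S1 V ∧ φ =ᵐ[volume] Phi V (negW hV φ) := by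
  set ζ := negW hV φ with hζdef
  have hvz : (fun x => (vFun V x : ℂ) * ζ x) =ᵐ[volume] fun x => -((V x : ℂ) * φ x) := by
    filter_upwards [negW_ae hV φ] with x hx
    rw [hx, ← vFun_mul_wFun (V := V) x]
    push_cast
    ring
  obtain ⟨M, hM, hNb⟩ := hV.exists_N0_norm_bound ζ
  have hN : ∀ x, ‖N0v V ζ x‖ ≤ M * (1 + Real.log (1 + ‖x‖)) := fun x =>
    (norm_integral_le_integral_norm _).trans (hNb x)
  obtain ⟨c, hc⟩ := ae_eq_const_of_bilap_eq_zero (g := fun x => φ x - N0v V ζ x) (C := ‖φ‖ + M)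
    ((Lp.aestronglyMeasurable φ).sub (hV.aesm_N0v ζ)) (by
      filter_upwards [ae_norm_le_LInf φ] with x hx
      refine (norm_sub_le _ _).trans ?_
      have := hN x
      have hl : 0 ≤ Real.log (1 + ‖x‖) := Real.log_nonneg (by linarith [norm_nonneg x])
      nlinarith [mul_nonneg (norm_nonneg φ) hl]) (by
      intro ψ hψ
      obtain ⟨hi, h0⟩ := hφ ψ hψ
      have i1 := integrable_bdd_mul_test (Lp.memLp φ) (hψ.lapIter 2)
      have i2 := hV.integrable_V_mul (Lp.memLp φ) hψ.memLp_top
      have i3 : Integrable fun x => N0v V ζ x * lapIter 2 ψ x := by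
        refine (hV.integrable_N0v_mul ζ (hψ.lapIter 2)).integral_prod_left.congr
          (.of_forall fun x => ?_)
        simp only [N0v, integral_mul_const]
      simp only [sub_mul]
      rw [integral_sub i1 i3, hV.integral_N0v_bilap ζ hψ]
      have h1 : ∀ᵐ x, (vFun V x : ℂ) * ζ x * ψ x = -((V x : ℂ) * φ x * ψ x) := by
        filter_upwards [hvz] with x hx
        rw [hx]; ring
      rw [integral_congr_ae h1, integral_neg, sub_neg_eq_add, ← integral_add i1 i2]
      exact h0)
  have hm0 : ∫ y, (vFun V y : ℂ) * ζ y = 0 := by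
    by_contra hm
    obtain ⟨M', hM', hK⟩ := hV.exists_logKer_norm_bound
    set m := ∫ y, (vFun V y : ℂ) * ζ y with hmdef
    have hm' : 0 < ‖m‖ := norm_pos_iff.2 hm
    set k : ℝ := 1 / (8 * Real.pi ^ 2)
    have hk : 0 < k := by positivity
    -- The threshold at which k‖m‖ log(1 + |x|) exceeds all the bounded terms. A point beyond radius
    -- exp L at which the almost everywhere relations hold gives the contradiction.
    set L := (‖φ‖ + ‖c‖ + k * (M' * ‖ζ‖)) / (k * ‖m‖) with hL
    obtain ⟨x, hxR, hx1, hx2⟩ := exists_norm_gt_of_ae (hc.and (ae_norm_le_LInf φ)) (Real.exp L)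
    have h1 : N0v V ζ x = φ x - c := by
      have : φ x - N0v V ζ x = c := hx1
      rw [← this]; ring
    rw [hV.N0v_eq] at h1
    set I := ∫ y, (logKer x y : ℂ) * ((vFun V y : ℂ) * ζ y) with hI
    have hIb : ‖I‖ ≤ M' * ‖ζ‖ := (norm_integral_le_integral_norm _).trans (hK ζ x)
    have h2 : (k : ℂ) * (Real.log (1 + ‖x‖) : ℝ) * m = c - φ x - k * I := by
      have h3 : ((-k : ℝ) : ℂ) * (I + (Real.log (1 + ‖x‖) : ℝ) * m) = φ x - c := h1
      push_cast at h3 ⊢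
      linear_combination -h3
    have h3 : L < Real.log (1 + ‖x‖) := by
      rw [Real.lt_log_iff_exp_lt (by positivity)]
      linarith
    have hL0 : 0 ≤ L := by positivity
    have h4 := congrArg norm h2
    rw [norm_mul, norm_mul, Complex.norm_real, Complex.norm_real, Real.norm_of_nonneg hk.le,
      Real.norm_of_nonneg (by linarith)] at h4
    have h5 : ‖c - φ x - k * I‖ ≤ ‖φ‖ + ‖c‖ + k * (M' * ‖ζ‖) := by
      refine (norm_sub_le _ _).trans ?_
      have a1 := norm_sub_le c (φ x)
      have a2 : ‖(k : ℂ) * I‖ ≤ k * (M' * ‖ζ‖) := by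
        rw [norm_mul, Complex.norm_real, Real.norm_of_nonneg hk.le]
        exact mul_le_mul_of_nonneg_left hIb hk.le
      linarith
    have h6 : L * (k * ‖m‖) = ‖φ‖ + ‖c‖ + k * (M' * ‖ζ‖) := by
      rw [hL]; field_simp
    have h7 : L * (k * ‖m‖) < Real.log (1 + ‖x‖) * (k * ‖m‖) :=
      mul_lt_mul_of_pos_right h3 (by positivity)
    nlinarith
  have hT : T0 V ζ = (-c) • vVec V := by
    refine Lp.ext ?_
    filter_upwards [hV.isT0_T0 ζ, Lp.coeFn_smul (-c) (vVec V), hV.vVec_ae, hc, negW_ae hV φ]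
      with x h1 h2 h3 h4 h5
    rw [h1, h2, Pi.smul_apply, h3, smul_eq_mul, h5]
    have hN : N0v V ζ x = φ x - c := by
      have : φ x - N0v V ζ x = c := h4
      rw [← this]; ring
    have hu : (uFun V x : ℂ) * wFun V x = vFun V x := by exact_mod_cast uFun_mul_wFun x
    rw [hN]
    linear_combination (-(φ x)) * hu
  refine ⟨mem_S1_iff.2 ⟨by rw [hV.inner_vVec, hm0], ?_⟩, ?_⟩
  · rw [hT]; exact Submodule.smul_mem _ _ (Submodule.mem_span_singleton_self _)
  · filter_upwards [hc] with x hx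
    have : φ x - N0v V ζ x = c := hx
    rw [Phi_eq, cst_eq_of_T0_eq hv hT, ← this]
    ring

/-- The linear map `φ ↦ -wφ` from `N_∞(H)` to `S₁ L²`. -/
def negWLin (hV : LogDecay 0 V) (hv : vVec V ≠ 0) : NInf V →ₗ[ℂ] S1 V where
  toFun φ := ⟨negW hV φ, (hV.negW_spec hv φ.2).1⟩
  map_add' a b := by
    refine Subtype.ext (Lp.ext ?_)
    filter_upwards [negW_ae hV (a + b : LInf), negW_ae hV a, negW_ae hV b,
      Lp.coeFn_add (a : LInf) b, Lp.coeFn_add (negW hV a) (negW hV b)] with x h1 h2 h3 h4 h5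
    change negW hV (a + b : LInf) x = (negW hV a + negW hV b : L2) x
    rw [h1, h5, Pi.add_apply, h2, h3, h4, Pi.add_apply]
    ring
  map_smul' c a := by
    refine Subtype.ext (Lp.ext ?_)
    filter_upwards [negW_ae hV (c • (a : LInf)), negW_ae hV a,
      Lp.coeFn_smul c (a : LInf), Lp.coeFn_smul c (negW hV a)] with x h1 h2 h4 h5
    change negW hV (c • (a : LInf)) x = (c • negW hV a : L2) x
    rw [h1, h5, Pi.smul_apply, h2, h4, Pi.smul_apply, smul_eq_mul, smul_eq_mul]
    ring

lemma norm_negW_le (hV : LogDecay 0 V) (φ : LInf) : ‖negW hV φ‖ ≤ ‖vVec V‖ * ‖φ‖ := by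
  have h : ∀ᵐ x, ‖negW hV φ x‖ ≤ ‖(‖φ‖ : ℂ) • vVec V x‖ := by
    filter_upwards [negW_ae hV φ, ae_norm_le_LInf φ, hV.vVec_ae] with x h1 h2 h3
    rw [h1, h3, norm_neg, norm_mul, norm_smul]
    simp only [wFun, Complex.norm_real, norm_mul, norm_norm]
    rw [Real.norm_eq_abs (uFun V x), abs_uFun, one_mul, mul_comm]
    exact mul_le_mul_of_nonneg_right h2 (norm_nonneg _)
  have h2 := Lp.norm_le_norm_of_ae_le (f := negW hV φ) (g := (‖φ‖ : ℂ) • vVec V) (by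
    filter_upwards [h, Lp.coeFn_smul (‖φ‖ : ℂ) (vVec V)] with x hx hs
    rw [hs]; exact hx)
  rw [norm_smul, Complex.norm_real, norm_norm] at h2
  rwa [mul_comm]

lemma negWLin_bijective (hV : LogDecay 0 V) (hv : vVec V ≠ 0) :
    Function.Bijective (negWLin hV hv) := by
  constructor
  · intro a b hab
    have h0 : negW hV a = negW hV b := congrArg Subtype.val hab
    refine Subtype.ext (Lp.ext ?_)
    have h1 := (hV.negW_spec hv a.2).2
    have h2 := (hV.negW_spec hv b.2).2
    rw [h0] at h1
    exact h1.trans h2.symm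
  · intro ζ
    refine ⟨⟨_, hV.Phi_mem_NInf hv ζ.2⟩, Subtype.ext (Lp.ext ?_)⟩
    filter_upwards [negW_ae hV ((hV.memLp_Phi ζ.2).toLp _), (hV.memLp_Phi ζ.2).coeFn_toLp,
      hV.ae_eq_neg_wFun_mul_Phi hv ζ.2] with x h1 h2 h3
    change negW hV ((hV.memLp_Phi ζ.2).toLp _) x = (ζ : L2) x
    rw [h1, h2, ← h3]

/-- The inverse φ ↦ -wφ is linear and bijective, and the bounds for Φ and for multiplication by w
make both directions continuous. -/
theorem LogDecay.exists_equiv (hV : LogDecay 0 V) (hv : vVec V ≠ 0) :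
    ∃ e : S1 V ≃L[ℂ] NInf V, (∀ ζ : S1 V, (e ζ : LInf) =ᵐ[volume] Phi V (ζ : L2)) ∧
      ∀ φ : NInf V, (e.symm φ : L2) =ᵐ[volume] fun x => -((wFun V x : ℂ) * (φ : LInf) x) := by
  set e0 := (LinearEquiv.ofBijective _ (negWLin_bijective hV hv)).symm with he0
  have hsymm : ∀ φ : NInf V, (e0.symm φ : L2) = negW hV φ := fun φ => rfl
  have hto : ∀ ζ : S1 V, (e0 ζ : LInf) =ᵐ[volume] Phi V (ζ : L2) := by
    intro ζ
    have h := (hV.negW_spec hv (e0 ζ).2).2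
    rwa [← hsymm, e0.symm_apply_apply] at h
  obtain ⟨M, hM, hb⟩ := hV.exists_Phi_bound
  have hle : ∀ ζ : S1 V, ‖e0 ζ‖ ≤ M * ‖ζ‖ := by
    intro ζ
    change ‖(e0 ζ : LInf)‖ ≤ M * ‖(ζ : L2)‖
    have h1 : eLpNormEssSup (e0 ζ : LInf) volume ≤ ENNReal.ofReal (M * ‖(ζ : L2)‖) := by
      refine eLpNormEssSup_le_of_ae_bound ?_
      filter_upwards [hto ζ] with x hx
      rw [hx]; exact hb _ ζ.2 x
    rw [Lp.norm_def, eLpNorm_exponent_top]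
    exact (ENNReal.toReal_le_of_le_ofReal (by positivity) h1)
  refine ⟨e0.toContinuousLinearEquivOfBounds M ‖vVec V‖ hle fun φ => ?_, hto, fun φ => ?_⟩
  · exact norm_negW_le hV φ
  · exact negW_ae hV φ

end Potential

/-! ### The limit at infinity and singularities of the first kind -/

lemma tendsto_logKer (y : E) : Tendsto (fun x => logKer x y) (comap norm atTop) (𝓝 0) := by
  have hn : Tendsto (fun x : E => ‖x‖) (comap norm atTop) atTop := tendsto_comap
  have h1 : Tendsto (fun t : ℝ => Real.log ((t - ‖y‖) / (1 + t))) atTop (𝓝 0) := by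
    have h : Tendsto (fun t : ℝ => 1 - (‖y‖ + 1) / (1 + t)) atTop (𝓝 1) := by
      simpa using tendsto_const_nhds.sub
        ((tendsto_atTop_add_const_left atTop (1 : ℝ) tendsto_id).const_div_atTop (‖y‖ + 1))
    have h' := (Real.continuousAt_log one_ne_zero).tendsto.comp h
    rw [Real.log_one] at h'
    refine h'.congr' ?_
    filter_upwards [eventually_gt_atTop 0] with t ht
    simp only [Function.comp_apply]
    congr 1
    field_simp
    ring
  have h2 : Tendsto (fun t : ℝ => Real.log ((t + ‖y‖) / (1 + t))) atTop (𝓝 0) := by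
    have h : Tendsto (fun t : ℝ => 1 + (‖y‖ - 1) / (1 + t)) atTop (𝓝 1) := by
      simpa using tendsto_const_nhds.add
        ((tendsto_atTop_add_const_left atTop (1 : ℝ) tendsto_id).const_div_atTop (‖y‖ - 1))
    have h' := (Real.continuousAt_log one_ne_zero).tendsto.comp h
    rw [Real.log_one] at h'
    refine h'.congr' ?_
    filter_upwards [eventually_gt_atTop 0] with t ht
    simp only [Function.comp_apply]
    congr 1
    field_simp
    ring
  have hy : ∀ᶠ x : E in comap norm atTop, ‖y‖ < ‖x‖ := hn.eventually (eventually_gt_atTop ‖y‖)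
  refine tendsto_of_tendsto_of_tendsto_of_le_of_le' (h1.comp hn) (h2.comp hn) ?_ ?_
  · filter_upwards [hy] with x hx
    have h3 : ‖x‖ - ‖y‖ ≤ ‖x - y‖ := norm_sub_norm_le x y
    have h4 : 0 < 1 + ‖x‖ := by positivity
    simp only [Function.comp_apply, logKer]
    rw [Real.log_div (by linarith) h4.ne']
    gcongr
  · filter_upwards [hy] with x hx
    have h3 : ‖x‖ - ‖y‖ ≤ ‖x - y‖ := norm_sub_norm_le x y
    have h4 : 0 < 1 + ‖x‖ := by positivity
    have h5 : ‖x - y‖ ≤ ‖x‖ + ‖y‖ := norm_sub_le x y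
    simp only [Function.comp_apply, logKer]
    rw [Real.log_div (by linarith [norm_nonneg y]) h4.ne']
    gcongr
    linarith

section Potential

variable {V : E → ℝ}

/-- A truncation splitting: the part of |t| above 1/δ is at most δt². -/
lemma abs_le_mul_sq_add_min {t δ : ℝ} (hδ : 0 < δ) : |t| ≤ δ * t ^ 2 + min |t| δ⁻¹ := by
  rcases le_total |t| δ⁻¹ with h | h
  · rw [min_eq_left h]
    have : 0 ≤ δ * t ^ 2 := by positivity
    linarith
  · have h1 : 0 ≤ min |t| δ⁻¹ := le_min (abs_nonneg _) (by positivity)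
    have h2 : |t| * 1 ≤ |t| * (δ * |t|) := by
      refine mul_le_mul_of_nonneg_left ?_ (abs_nonneg _)
      calc (1 : ℝ) = δ * δ⁻¹ := (mul_inv_cancel₀ hδ.ne').symm
        _ ≤ δ * |t| := by gcongr
    rw [← sq_abs]
    nlinarith

lemma LogDecay.norm_vFun_mul_le (hV : LogDecay 0 V) (hv : vVec V ≠ 0) {ζ : L2} (hζ : ζ ∈ S1 V) :
    ∃ M : ℝ, 0 ≤ M ∧ ∀ᵐ x, ‖(vFun V x : ℂ) * ζ x‖ ≤ M * |V x| := by
  obtain ⟨M, hM, h⟩ := hV.exists_Phi_bound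
  refine ⟨M * ‖ζ‖, by positivity, ?_⟩
  filter_upwards [hV.vFun_mul_ae hv hζ] with x hx
  rw [hx, norm_neg, norm_mul, Complex.norm_real, Real.norm_eq_abs, mul_comm]
  exact mul_le_mul_of_nonneg_right (h ζ hζ x) (abs_nonneg _)

/-- Dominated convergence does not apply directly, since the singularity at y = x moves with x. The
kernel is truncated at height 1/δ: the truncated integrals converge by domination, and the excess is
O(δ) uniformly in x because |vζ| ≤ M|V| and the squared kernel is uniformly integrable against |V|.
-/
lemma LogDecay.tendsto_integral_logKer (hV : LogDecay 0 V) (hv : vVec V ≠ 0) {ζ : L2}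
    (hζ : ζ ∈ S1 V) :
    Tendsto (fun x => ∫ y, (logKer x y : ℂ) * ((vFun V y : ℂ) * ζ y)) (comap norm atTop) (𝓝 0) := by
  obtain ⟨M, hM, hf⟩ := hV.norm_vFun_mul_le hv hζ
  obtain ⟨C, hC, hb⟩ := hV.exists_logKer_bound
  have hfi := (hV.integrable_vL2 ζ).norm
  rw [Metric.tendsto_nhds]
  intro ε hε
  set δ : ℝ := ε / (2 * (M * C + 1)) with hδ
  have hδ0 : 0 < δ := by positivity
  have hmin : ∀ x, AEStronglyMeasurable
      (fun y => min |logKer x y| δ⁻¹ * ‖(vFun V y : ℂ) * ζ y‖) volume := fun x =>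
    ((measurable_logKer x).abs.min measurable_const).aestronglyMeasurable.mul hfi.1
  have hle : ∀ x y, ‖min |logKer x y| δ⁻¹ * ‖(vFun V y : ℂ) * ζ y‖‖ ≤
      δ⁻¹ * ‖(vFun V y : ℂ) * ζ y‖ := by
    intro x y
    rw [Real.norm_of_nonneg (mul_nonneg (le_min (abs_nonneg _) (by positivity)) (norm_nonneg _))]
    exact mul_le_mul_of_nonneg_right (min_le_right _ _) (norm_nonneg _)
  have hlim : Tendsto (fun x => ∫ y, min |logKer x y| δ⁻¹ * ‖(vFun V y : ℂ) * ζ y‖)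
      (comap norm atTop) (𝓝 0) := by
    have h := tendsto_integral_filter_of_dominated_convergence (μ := volume)
      (F := fun x y => min |logKer x y| δ⁻¹ * ‖(vFun V y : ℂ) * ζ y‖) (f := fun _ => 0)
      (l := comap (norm : E → ℝ) atTop) (fun y => δ⁻¹ * ‖(vFun V y : ℂ) * ζ y‖)
      (.of_forall hmin) (.of_forall fun x => .of_forall (hle x)) (hfi.const_mul _)
      (.of_forall fun y => ?_)
    · simpa using h
    · have h1 := ((tendsto_logKer y).abs.min (tendsto_const_nhds (x := δ⁻¹))).mul_const
        ‖(vFun V y : ℂ) * ζ y‖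
      simpa [min_eq_left (inv_pos.2 hδ0).le] using h1
  have hev := (Metric.tendsto_nhds.1 hlim) (ε / 2) (by positivity)
  filter_upwards [hev] with x hx
  have i1 : Integrable fun y => min |logKer x y| δ⁻¹ * ‖(vFun V y : ℂ) * ζ y‖ :=
    (hfi.const_mul δ⁻¹).mono' (hmin x) (.of_forall (hle x))
  have i2 : Integrable fun y => δ * M * (logKer x y ^ 2 * |V y|) := (hb x).1.const_mul _
  rw [dist_zero_right] at hx ⊢
  rw [Real.norm_of_nonneg (integral_nonneg fun y =>
    mul_nonneg (le_min (abs_nonneg _) (by positivity)) (norm_nonneg _))] at hx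
  calc ‖∫ y, (logKer x y : ℂ) * ((vFun V y : ℂ) * ζ y)‖
      ≤ ∫ y, ‖(logKer x y : ℂ) * ((vFun V y : ℂ) * ζ y)‖ := norm_integral_le_integral_norm _
    _ ≤ ∫ y, (δ * M * (logKer x y ^ 2 * |V y|) +
          min |logKer x y| δ⁻¹ * ‖(vFun V y : ℂ) * ζ y‖) := by
        refine integral_mono_ae (hV.integrable_logKer ζ x).norm (i2.add i1) ?_
        filter_upwards [hf] with y hy
        rw [norm_mul, Complex.norm_real, Real.norm_eq_abs]
        have h1 := mul_le_mul_of_nonneg_right (abs_le_mul_sq_add_min (t := logKer x y) hδ0)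
          (norm_nonneg ((vFun V y : ℂ) * ζ y))
        have h2 := mul_le_mul_of_nonneg_left hy (show 0 ≤ δ * logKer x y ^ 2 by positivity)
        linarith
    _ = δ * M * (∫ y, logKer x y ^ 2 * |V y|) +
          ∫ y, min |logKer x y| δ⁻¹ * ‖(vFun V y : ℂ) * ζ y‖ := by
        rw [integral_add i2 i1, integral_const_mul]
    _ < ε := by
        have h1 : δ * M * (∫ y, logKer x y ^ 2 * |V y|) ≤ δ * M * C :=
          mul_le_mul_of_nonneg_left (hb x).2 (by positivity)
        have h2 : δ * (M * C + 1) = ε / 2 := by rw [hδ]; field_simp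
        nlinarith

lemma LogDecay.tendsto_Phi (hV : LogDecay 0 V) (hv : vVec V ≠ 0) {ζ : L2} (hζ : ζ ∈ S1 V) :
    Tendsto (Phi V ζ) nearInfinity (𝓝 (-cst V ζ)) := by
  have h0 := (mem_S1_iff.1 hζ).1
  rw [hV.inner_vVec] at h0
  have h1 := ((hV.tendsto_integral_logKer hv hζ).const_mul
    (((-(1 / (8 * Real.pi ^ 2)) : ℝ) : ℂ))).sub_const (cst V ζ)
  rw [mul_zero, zero_sub] at h1
  rw [nearInfinity, ← Metric.cobounded_eq_cocompact, ← comap_norm_atTop]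
  refine (h1.mono_left inf_le_left).congr fun x => ?_
  rw [Phi_eq, hV.N0v_eq, h0, mul_zero, add_zero]

lemma LogDecay.inNInf_Phi (hV : LogDecay 0 V) (hv : vVec V ≠ 0) {ζ : L2} (hζ : ζ ∈ S1 V)
    (h0 : ζ ≠ 0) : InNInf V (Phi V ζ) := by
  have hae := (hV.memLp_Phi hζ).coeFn_toLp
  refine ⟨_, hV.Phi_mem_NInf hv hζ, fun h => h0 (Lp.ext ?_), hae.symm⟩
  rw [h] at hae
  filter_upwards [hae, Lp.coeFn_zero ℂ ∞ (volume : Measure E), hV.ae_eq_neg_wFun_mul_Phi hv hζ,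
    Lp.coeFn_zero ℂ 2 (volume : Measure E)] with x h1 h2 h3 h4
  rw [h3, ← h1, h2, h4]
  simp

lemma LogDecay.isSWave_Phi (hV : LogDecay 0 V) (hv : vVec V ≠ 0) {ζ : L2} (hζ : ζ ∈ S1 V)
    (hc : cst V ζ ≠ 0) : IsSWave V (Phi V ζ) := by
  refine ⟨hV.inNInf_Phi hv hζ fun h => hc ?_, _, hc, hV.tendsto_Phi hv hζ⟩
  rw [h]; simp [cst]

lemma T0_eq_zero_of_cst (hv : vVec V ≠ 0) {ζ : L2} (hζ : ζ ∈ S1 V) (hc : cst V ζ = 0) :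
    T0 V ζ = 0 := by
  rw [T0_eq_cst hv hζ, hc, zero_smul]

/-- T₀ is symmetric and T₀ζ is a multiple of v, so (T₁ζ, ζ) = ‖T₀ζ‖², which vanishes only if the
multiple does. -/
lemma LogDecay.mem_S2_iff (hV : LogDecay 0 V) (hv : vVec V ≠ 0) {ζ : L2} :
    ζ ∈ S2 V ↔ ζ ∈ S1 V ∧ cst V ζ = 0 := by
  rw [S2, mem_kerPart_iff]
  refine and_congr_right fun hζ => ⟨fun h => ?_, fun h => ?_⟩
  · have h1 := (Submodule.mem_orthogonal _ _).1 h ζ hζ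
    rw [ContinuousLinearMap.comp_apply, ContinuousLinearMap.comp_apply, ← hV.inner_T0,
      T0_eq_cst hv hζ,
      P_eq_self (Submodule.smul_mem _ _ (Submodule.mem_span_singleton_self _)),
      inner_self_eq_zero] at h1
    exact (smul_eq_zero.1 h1).resolve_right hv
  · rw [ContinuousLinearMap.comp_apply, ContinuousLinearMap.comp_apply, T0_eq_zero_of_cst hv hζ h]
    simp

/-- The linear functional `ζ ↦ c₀` on `S₁ L²`. -/
def cstLin (V : E → ℝ) : S1 V →ₗ[ℂ] ℂ where
  toFun ζ := cst V ζ
  map_add' a b := by simp only [cst, Submodule.coe_add, map_add, inner_add_right, mul_add]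
  map_smul' c a := by
    simp only [cst, Submodule.coe_smul, map_smul, inner_smul_right, smul_eq_mul, RingHom.id_apply]
    ring

lemma cst_ne_zero_of_isFirstKind (hv : vVec V ≠ 0) (h : IsFirstKind V) {ζ : L2} (hζ : ζ ∈ S1 V)
    (h0 : ζ ≠ 0) : cst V ζ ≠ 0 := by
  intro hc
  obtain ⟨u, hu⟩ := h.2
  have h1 : part (S1 V) (T0 V ∘L P V ∘L T0 V) ⟨ζ, hζ⟩ = 0 := by
    rw [part_apply, ContinuousLinearMap.comp_apply, ContinuousLinearMap.comp_apply]
    simp [T0_eq_zero_of_cst hv hζ hc]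
  have h2 : ((↑u⁻¹ : S1 V →L[ℂ] S1 V) * (u : S1 V →L[ℂ] S1 V)) ⟨ζ, hζ⟩ = 0 := by
    change (↑u⁻¹ : S1 V →L[ℂ] S1 V) ((u : S1 V →L[ℂ] S1 V) ⟨ζ, hζ⟩) = 0
    rw [hu, h1, map_zero]
  rw [Units.inv_mul] at h2
  exact h0 (congrArg Subtype.val h2)

/-- The scalar functional c is injective on S₁L², so the dimension is at most one; singularity
excludes zero. -/
lemma LogDecay.finrank_S1 (hV : LogDecay 0 V) (hv : vVec V ≠ 0) (h : IsFirstKind V) :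
    Module.finrank ℂ (S1 V) = 1 := by
  have hinj : Function.Injective (cstLin V) := by
    rw [← LinearMap.ker_eq_bot, LinearMap.ker_eq_bot']
    intro ζ hζ
    by_contra h0
    exact cst_ne_zero_of_isFirstKind hv h ζ.2 (fun h => h0 (Subtype.ext h)) hζ
  have hfd : FiniteDimensional ℂ (S1 V) := FiniteDimensional.of_injective _ hinj
  have h1 := LinearMap.finrank_le_finrank_of_injective hinj
  rw [Module.finrank_self] at h1
  have h2 : Module.finrank ℂ (S1 V) ≠ 0 := fun h2 =>
    (hV.isSingularAtZero_iff).1 h.1 (Submodule.finrank_eq_zero.1 h2)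
  omega

lemma LogDecay.isSWave_of_isFirstKind (hV : LogDecay 0 V) (hv : vVec V ≠ 0) (h : IsFirstKind V)
    {φ : LInf} (hφ : φ ∈ NInf V) (h0 : φ ≠ 0) : IsSWave V φ := by
  obtain ⟨hS, hae⟩ := hV.negW_spec hv hφ
  have h1 : negW hV φ ≠ 0 := by
    intro h1
    have h2 := (negWLin_bijective hV hv).1 (a₁ := ⟨φ, hφ⟩) (a₂ := 0) (Subtype.ext (by
      rw [map_zero]; exact h1))
    exact h0 (congrArg Subtype.val h2)
  have hc := cst_ne_zero_of_isFirstKind hv h hS h1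
  refine ⟨⟨φ, hφ, h0, ae_eq_rfl⟩, _, hc, ?_⟩
  exact (hV.tendsto_Phi hv hS).congr' (hae.symm.filter_mono inf_le_right)

end Potential

/-! ### Multipole expansion of the logarithmic kernel -/

/-- The remainder of the second order expansion of `log|x - y|` at `y = 0`. -/
def logRem (x y : E) : ℝ :=
  Real.log ‖x - y‖ - Real.log ‖x‖ + inner ℝ x y / ‖x‖ ^ 2 - ‖y‖ ^ 2 / (2 * ‖x‖ ^ 2) +
    inner ℝ x y ^ 2 / ‖x‖ ^ 4

/-- With a = x·y/|x|² and r = |y|/|x| this is the expansion of log(|x - y|/|x|). Put t = 2a - r², so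
|t| ≤ 9r/4 ≤ 9/16. The cubic remainder of log(1 - t) is O(r³), and so is the surplus ar² - r⁴/4 from
t²/2. The constant 150 is generous. -/
lemma abs_log_taylor_le {a r : ℝ} (hr : 0 ≤ r) (ha : |a| ≤ r) (hr' : r ≤ 1 / 4) :
    |Real.log (1 - 2 * a + r ^ 2) / 2 + a - r ^ 2 / 2 + a ^ 2| ≤ 150 * r ^ 3 := by
  set t := 2 * a - r ^ 2 with ht
  have hat := abs_le.1 ha
  have h1 : |t| ≤ 9 / 4 * r := by
    rw [abs_le]; constructor <;> nlinarith
  have h2 : |t| ≤ 9 / 16 := by linarith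
  have h3 := Real.abs_log_sub_add_sum_range_le (x := t) (by linarith) 2
  rw [Finset.sum_range_succ, Finset.sum_range_succ, Finset.sum_range_zero] at h3
  have h4 : |t| ^ (2 + 1) / (1 - |t|) ≤ 32 * r ^ 3 := by
    rw [div_le_iff₀ (by linarith)]
    have h5 : |t| ^ 3 ≤ (9 / 4 * r) ^ 3 := by gcongr
    have h6 : 0 ≤ r ^ 3 := by positivity
    have h7 : 32 * r ^ 3 * (7 / 16) ≤ 32 * r ^ 3 * (1 - |t|) := by gcongr; linarith
    norm_num at h5 ⊢
    nlinarith
  have h5 := h3.trans h4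
  norm_num at h5
  have h6 : |a * r ^ 2 - r ^ 4 / 4| ≤ 2 * r ^ 3 := by
    have h7 : 0 ≤ r ^ 2 := by positivity
    have h8 : r ^ 4 ≤ r ^ 3 := by
      have : 0 ≤ r ^ 3 := by positivity
      nlinarith
    have h9 : 0 ≤ r ^ 4 := by positivity
    rw [abs_le]; constructor <;> nlinarith
  have h7 : Real.log (1 - 2 * a + r ^ 2) / 2 + a - r ^ 2 / 2 + a ^ 2 =
      (t + t ^ 2 / 2 + Real.log (1 - t)) / 2 + (a * r ^ 2 - r ^ 4 / 4) := by
    rw [ht]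
    have : 1 - (2 * a - r ^ 2) = 1 - 2 * a + r ^ 2 := by ring
    rw [this]; ring
  have h8 : 0 ≤ r ^ 3 := by positivity
  rw [h7]
  refine (abs_add_le _ _).trans ?_
  rw [abs_div, abs_two]
  linarith

/-- For |y| ≤ |x|/4 this is Taylor's formula. For |y| > |x|/4 one has 1 ≤ 64|y|³/|x|³, so each term
of the remainder can be estimated crudely; the singularity at y = x is kept in `nearLog`. -/
lemma abs_logRem_le {x : E} (hx : 1 ≤ ‖x‖) (y : E) : |logRem x y| ≤
    ‖y‖ ^ 3 / ‖x‖ ^ 3 * (64 * Real.log (1 + ‖y‖) + 150 + 64 * nearLog (x - y)) := by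
  have hx0 : 0 < ‖x‖ := by linarith
  set r := ‖y‖ / ‖x‖ with hr
  set a := inner ℝ x y / ‖x‖ ^ 2 with ha
  have hr0 : 0 ≤ r := by positivity
  have har : |a| ≤ r := by
    rw [ha, hr, abs_div, abs_of_pos (by positivity : 0 < ‖x‖ ^ 2), div_le_div_iff₀ (by positivity) hx0]
    have := abs_real_inner_le_norm x y
    nlinarith
  have hl : 0 ≤ Real.log (1 + ‖y‖) := Real.log_nonneg (by linarith [norm_nonneg y])
  have hn := nearLog_nonneg (x - y)
  have hR : logRem x y = Real.log ‖x - y‖ - Real.log ‖x‖ + a - r ^ 2 / 2 + a ^ 2 := by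
    rw [logRem, ha, hr]; field_simp
  have hr3 : ‖y‖ ^ 3 / ‖x‖ ^ 3 = r ^ 3 := by rw [hr, div_pow]
  have hr30 : 0 ≤ r ^ 3 := by positivity
  rw [hr3, hR]
  rcases le_or_gt r (1 / 4) with h | h
  · have h1 : ‖x - y‖ ^ 2 = ‖x‖ ^ 2 * (1 - 2 * a + r ^ 2) := by
      rw [norm_sub_sq_real, ha, hr]; field_simp
    have h2 : 0 < 1 - 2 * a + r ^ 2 := by nlinarith [abs_le.1 har]
    have h3 : Real.log ‖x - y‖ - Real.log ‖x‖ = Real.log (1 - 2 * a + r ^ 2) / 2 := by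
      have := congrArg Real.log h1
      rw [Real.log_mul (by positivity) h2.ne', Real.log_pow, Real.log_pow] at this
      push_cast at this
      linarith
    rw [h3]
    refine (abs_log_taylor_le hr0 har h).trans ?_
    rw [mul_comm]
    gcongr
    linarith
  · have h1 := abs_logKer_le x y
    have h2 : |Real.log (1 + ‖x‖) - Real.log ‖x‖| ≤ 1 := by
      rw [← Real.log_div (by positivity) hx0.ne', abs_of_nonneg (Real.log_nonneg (by
        rw [le_div_iff₀ hx0]; linarith))]
      refine (Real.log_le_log (by positivity) ?_).trans log_two_le_one
      rw [div_le_iff₀ hx0]; linarith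
    have h3 : Real.log ‖x - y‖ - Real.log ‖x‖ + a - r ^ 2 / 2 + a ^ 2 =
      logKer x y + (Real.log (1 + ‖x‖) - Real.log ‖x‖) + (a - r ^ 2 / 2 + a ^ 2) := by
      rw [logKer]; ring
    have h4 : |a - r ^ 2 / 2 + a ^ 2| ≤ r + 3 / 2 * r ^ 2 := by
      have := abs_le.1 har
      have h5 : a ^ 2 ≤ r ^ 2 := sq_le_sq' this.1 this.2
      rw [abs_le]; constructor <;> nlinarith [sq_nonneg a]
    have h5 : 1 ≤ 64 * r ^ 3 := by
      have : (1 / 4 : ℝ) ^ 3 ≤ r ^ 3 := by gcongr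
      linarith
    have h6 : r + 3 / 2 * r ^ 2 ≤ 22 * r ^ 3 := by nlinarith
    have h7 := log_two_le_one
    rw [h3]
    refine (abs_add_le _ _).trans ((add_le_add (abs_add_le _ _) le_rfl).trans ?_)
    have h8 : 0 ≤ Real.log (1 + ‖y‖) + nearLog (x - y) + 2 := by linarith
    nlinarith [mul_le_mul_of_nonneg_right h5 h8]

lemma real_inner_eq_sum (x y : E) : inner ℝ x y = ∑ i, x i * y i := by
  rw [PiLp.inner_apply]
  exact Finset.sum_congr rfl fun i _ => by simp [mul_comm]

lemma abs_apply_le (x : E) (i : Fin 4) : |x i| ≤ ‖x‖ := PiLp.norm_apply_le x i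

/-! ### Moments -/

/-- `f` has absolute moments up to order `n`. -/
def HasMoments (n : ℕ) (f : E → ℂ) : Prop :=
  AEStronglyMeasurable f volume ∧ Integrable fun y => (1 + ‖y‖) ^ n * ‖f y‖

lemma HasMoments.integrable_mul {n : ℕ} {f : E → ℂ} (hf : HasMoments n f) {p : E → ℂ}
    (hp : Continuous p) {C : ℝ} (hC : ∀ y, ‖p y‖ ≤ C * (1 + ‖y‖) ^ n) :
    Integrable fun y => p y * f y := by
  refine (hf.2.const_mul C).mono' (hp.aestronglyMeasurable.mul hf.1) (.of_forall fun y => ?_)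
  rw [norm_mul, ← mul_assoc]
  exact mul_le_mul_of_nonneg_right (hC y) (norm_nonneg _)

lemma HasMoments.mono {m n : ℕ} (h : m ≤ n) {f : E → ℂ} (hf : HasMoments n f) : HasMoments m f := by
  refine ⟨hf.1, hf.2.mono' (Continuous.aestronglyMeasurable (by fun_prop) |>.mul hf.1.norm)
    (.of_forall fun y => ?_)⟩
  rw [Real.norm_of_nonneg (by positivity)]
  gcongr
  linarith [norm_nonneg y]

lemma HasMoments.conj {n : ℕ} {f : E → ℂ} (hf : HasMoments n f) :
    HasMoments n fun y => conj (f y) :=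
  ⟨Complex.continuous_conj.comp_aestronglyMeasurable hf.1, by simpa using hf.2⟩

lemma HasMoments.integrable {n : ℕ} {f : E → ℂ} (hf : HasMoments n f) : Integrable f := by
  have := (hf.mono (Nat.zero_le n)).integrable_mul (p := fun _ => 1) continuous_const (C := 1)
    (by simp)
  simpa using this

lemma norm_pow_le_one_add (y : E) {m n : ℕ} (h : m ≤ n) : ‖y‖ ^ m ≤ (1 + ‖y‖) ^ n :=
  (pow_le_pow_left₀ (norm_nonneg y) (by linarith) m).trans
    (pow_le_pow_right₀ (by linarith [norm_nonneg y]) h)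

lemma HasMoments.integrable_norm_pow {n m : ℕ} {f : E → ℂ} (hf : HasMoments n f) (h : m ≤ n) :
    Integrable fun y => ((‖y‖ ^ m : ℝ) : ℂ) * f y :=
  hf.integrable_mul (C := 1) (by fun_prop) fun y => by
    rw [Complex.norm_real, Real.norm_of_nonneg (by positivity), one_mul]
    exact norm_pow_le_one_add y h

lemma HasMoments.integrable_coord {n : ℕ} {f : E → ℂ} (hf : HasMoments n f) (h : 1 ≤ n) (i : Fin 4) :
    Integrable fun y => (y i : ℂ) * f y :=
  hf.integrable_mul (C := 1) (by fun_prop) fun y => by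
    rw [Complex.norm_real, one_mul]
    exact (abs_apply_le y i).trans (by simpa using norm_pow_le_one_add y h)

lemma HasMoments.integrable_coord_mul {n : ℕ} {f : E → ℂ} (hf : HasMoments n f) (h : 2 ≤ n)
    (i j : Fin 4) : Integrable fun y => ((y i : ℂ) * (y j : ℂ)) * f y :=
  hf.integrable_mul (C := 1) (by fun_prop) fun y => by
    rw [norm_mul, Complex.norm_real, Complex.norm_real, one_mul]
    refine (mul_le_mul (abs_apply_le y i) (abs_apply_le y j) (abs_nonneg _) (norm_nonneg _)).trans ?_
    rw [← sq]
    exact norm_pow_le_one_add y h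

lemma HasMoments.integrable_coord_norm {n : ℕ} {f : E → ℂ} (hf : HasMoments n f) (h : 3 ≤ n)
    (i : Fin 4) : Integrable fun y => ((‖y‖ ^ 2 : ℝ) * (y i : ℂ)) * f y :=
  hf.integrable_mul (C := 1) (by fun_prop) fun y => by
    rw [norm_mul, Complex.norm_real, Complex.norm_real, one_mul, Real.norm_of_nonneg (by positivity)]
    refine (mul_le_mul_of_nonneg_left (abs_apply_le y i) (by positivity)).trans ?_
    rw [← pow_succ]
    exact norm_pow_le_one_add y h

/-- First moments. -/
def mom (f : E → ℂ) (i : Fin 4) : ℂ := ∫ y, (y i : ℂ) * f y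

/-- Second moments. -/
def mom₂ (f : E → ℂ) (i j : Fin 4) : ℂ := ∫ y, ((y i : ℂ) * (y j : ℂ)) * f y

lemma mom_conj (f : E → ℂ) (i : Fin 4) : mom (fun y => conj (f y)) i = conj (mom f i) := by
  rw [mom, mom, ← integral_conj]
  simp

lemma mom₂_conj (f : E → ℂ) (i j : Fin 4) : mom₂ (fun y => conj (f y)) i j = conj (mom₂ f i j) := by
  rw [mom₂, mom₂, ← integral_conj]
  simp

lemma HasMoments.integral_inner {n : ℕ} {f : E → ℂ} (hf : HasMoments n f) (h : 1 ≤ n) (x : E) :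
    Integrable (fun y => ((inner ℝ x y : ℝ) : ℂ) * f y) ∧
    ∫ y, ((inner ℝ x y : ℝ) : ℂ) * f y = ∑ i, (x i : ℂ) * mom f i := by
  have h1 : (fun y => ((inner ℝ x y : ℝ) : ℂ) * f y) =
      fun y => ∑ i, (x i : ℂ) * ((y i : ℂ) * f y) := by
    ext y
    rw [real_inner_eq_sum, Complex.ofReal_sum, Finset.sum_mul]
    exact Finset.sum_congr rfl fun i _ => by push_cast; ring
  have h2 : ∀ i ∈ Finset.univ, Integrable fun y => (x i : ℂ) * ((y i : ℂ) * f y) :=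
    fun i _ => (hf.integrable_coord h i).const_mul _
  rw [h1]
  refine ⟨integrable_finsetSum _ h2, ?_⟩
  rw [integral_finsetSum _ h2]
  exact Finset.sum_congr rfl fun i _ => integral_const_mul _ _

lemma HasMoments.integral_inner_sq {n : ℕ} {f : E → ℂ} (hf : HasMoments n f) (h : 2 ≤ n) (x : E) :
    Integrable (fun y => ((inner ℝ x y ^ 2 : ℝ) : ℂ) * f y) ∧
    ∫ y, ((inner ℝ x y ^ 2 : ℝ) : ℂ) * f y = ∑ i, ∑ j, ((x i : ℂ) * (x j : ℂ)) * mom₂ f i j := by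
  have h1 : (fun y => ((inner ℝ x y ^ 2 : ℝ) : ℂ) * f y) =
      fun y => ∑ i, ∑ j, ((x i : ℂ) * (x j : ℂ)) * (((y i : ℂ) * (y j : ℂ)) * f y) := by
    ext y
    rw [real_inner_eq_sum, sq, Finset.sum_mul_sum, Complex.ofReal_sum, Finset.sum_mul]
    refine Finset.sum_congr rfl fun i _ => ?_
    rw [Complex.ofReal_sum, Finset.sum_mul]
    exact Finset.sum_congr rfl fun j _ => by push_cast; ring
  have h2 : ∀ i, ∀ j ∈ Finset.univ,
      Integrable fun y => ((x i : ℂ) * (x j : ℂ)) * (((y i : ℂ) * (y j : ℂ)) * f y) :=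
    fun i j _ => (hf.integrable_coord_mul h i j).const_mul _
  have h3 : ∀ i ∈ Finset.univ,
      Integrable fun y => ∑ j, ((x i : ℂ) * (x j : ℂ)) * (((y i : ℂ) * (y j : ℂ)) * f y) :=
    fun i _ => integrable_finsetSum _ (h2 i)
  rw [h1]
  refine ⟨integrable_finsetSum _ h3, ?_⟩
  rw [integral_finsetSum _ h3]
  refine Finset.sum_congr rfl fun i _ => ?_
  rw [integral_finsetSum _ (h2 i)]
  exact Finset.sum_congr rfl fun i _ => integral_const_mul _ _

lemma HasMoments.integral_norm_sq {n : ℕ} {f : E → ℂ} (hf : HasMoments n f) (h : 2 ≤ n) :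
    ∫ y, ((‖y‖ ^ 2 : ℝ) : ℂ) * f y = ∑ i, mom₂ f i i := by
  have h1 : (fun y : E => ((‖y‖ ^ 2 : ℝ) : ℂ) * f y) =
      fun y => ∑ i, ((y i : ℂ) * (y i : ℂ)) * f y := by
    ext y
    rw [← real_inner_self_eq_norm_sq, real_inner_eq_sum, Complex.ofReal_sum, Finset.sum_mul]
    exact Finset.sum_congr rfl fun i _ => by push_cast; ring
  rw [h1, integral_finsetSum _ fun i _ => hf.integrable_coord_mul h i i]
  rfl

/-! ### The expansion of `Φ(ζ)` at infinity -/

section Potential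

variable {V : E → ℝ}

lemma one_add_norm_pow_le_wt (n : ℕ) (y : E) : (1 + ‖y‖) ^ n ≤ 2 ^ n * wt n y := by
  have h1 : wt n y = Real.sqrt (1 + ‖y‖ ^ 2) ^ n := by
    rw [wt, Real.sqrt_eq_rpow, ← Real.rpow_natCast ((1 + ‖y‖ ^ 2) ^ (1 / 2 : ℝ)) n,
      ← Real.rpow_mul (by positivity)]
    congr 1; ring
  rw [h1, ← mul_pow]
  refine pow_le_pow_left₀ (by positivity) ?_ n
  have h2 : (1 + ‖y‖) / 2 ≤ Real.sqrt (1 + ‖y‖ ^ 2) := by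
    refine Real.le_sqrt_of_sq_le ?_
    nlinarith [sq_nonneg (1 - ‖y‖), sq_nonneg (‖y‖)]
  linarith

/-- The weight on V supplies n moments, and decay of order m of f relative to V supplies m more. -/
lemma LogDecay.hasMoments {n m : ℕ} (hV : LogDecay n V) {f : E → ℂ}
    (hf : AEStronglyMeasurable f volume) {C : ℝ}
    (h : ∀ᵐ y, (1 + ‖y‖) ^ m * ‖f y‖ ≤ C * |V y|) : HasMoments (n + m) f := by
  refine ⟨hf, ((hV.integrable_wt).const_mul (2 ^ n * C)).mono'
    (Continuous.aestronglyMeasurable (by fun_prop) |>.mul hf.norm) ?_⟩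
  filter_upwards [h] with y hy
  rw [Real.norm_of_nonneg (by positivity), pow_add]
  have h1 : 0 ≤ (1 + ‖y‖) ^ m * ‖f y‖ := by positivity
  calc (1 + ‖y‖) ^ n * (1 + ‖y‖) ^ m * ‖f y‖ = (1 + ‖y‖) ^ n * ((1 + ‖y‖) ^ m * ‖f y‖) := by ring
    _ ≤ 2 ^ n * wt n y * ((1 + ‖y‖) ^ m * ‖f y‖) :=
        mul_le_mul_of_nonneg_right (one_add_norm_pow_le_wt n y) h1
    _ ≤ 2 ^ n * wt n y * (C * |V y|) :=
        mul_le_mul_of_nonneg_left hy (mul_nonneg (by positivity) (wt_pos _ _).le)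
    _ = _ := by ring

/-- The density `vζ`. -/
def den (V : E → ℝ) (ζ : L2) (y : E) : ℂ := (vFun V y : ℂ) * ζ y

lemma LogDecay.aesm_den (hV : LogDecay 0 V) (ζ : L2) : AEStronglyMeasurable (den V ζ) volume :=
  (aesm_ofReal hV.aesm_vFun).mul (Lp.aestronglyMeasurable ζ)

lemma LogDecay.hasMoments_den (hV : LogDecay 0 V) (hV3 : LogDecay 3 V) (hv : vVec V ≠ 0) {ζ : L2}
    (hζ : ζ ∈ S1 V) : HasMoments 3 (den V ζ) := by
  obtain ⟨M, -, h⟩ := hV.norm_vFun_mul_le hv hζ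
  have hV3' : LogDecay (3 : ℕ) V := by exact_mod_cast hV3
  exact hV3'.hasMoments (m := 0) (hV.aesm_den ζ) (C := M) (by simpa [den] using h)

/-- The weight ⟨y⟩³ pays for |y|³, the logarithmic weight for log(1 + |y|), and the uniform bound on
`nearPow` for the singularity at y = x. -/
lemma LogDecay.exists_logRem_bound (hV3 : LogDecay 3 V) :
    ∃ C : ℝ, 0 ≤ C ∧ ∀ x : E, 1 ≤ ‖x‖ → ∀ f : E → ℂ, ∀ M : ℝ, 0 ≤ M → (∀ᵐ y, ‖f y‖ ≤ M * |V y|) →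
      ∫ y, ‖(logRem x y : ℂ) * f y‖ ≤ M * C / ‖x‖ ^ 3 := by
  obtain ⟨s, hs, -, C, hC, h⟩ := hV3.exists_nearPow
  have hi := hV3.integrable
  set J := ∫ y, (1 + Real.log ‖y‖ ^ 2) * wt 3 y * |V y| with hJ
  have hJ0 : 0 ≤ J := integral_nonneg fun y => mul_nonneg (mul_nonneg (by positivity)
    (wt_pos _ _).le) (abs_nonneg _)
  refine ⟨8 * (406 * J + 64 * s⁻¹ * C), by positivity, fun x hx f M hM hf => ?_⟩
  have hx0 : 0 < ‖x‖ := by linarith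
  have i1 := hi.const_mul (8 * M / ‖x‖ ^ 3 * 406)
  have i2 := (h x).1.const_mul (8 * M / ‖x‖ ^ 3 * (64 * s⁻¹))
  refine (integral_mono_of_nonneg (.of_forall fun y => norm_nonneg _) (i1.add i2) ?_).trans ?_
  · filter_upwards [hf] with y hy
    have hw := wt_pos 3 y
    have hy3 : ‖y‖ ^ 3 ≤ 8 * wt 3 y := by
      have h1 := one_add_norm_pow_le_wt 3 y
      have h2 := norm_pow_le_one_add y (le_refl 3)
      norm_num at h1
      linarith
    have hlog : 64 * Real.log (1 + ‖y‖) + 150 ≤ 406 * (1 + Real.log ‖y‖ ^ 2) := by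
      have := log_one_add_sq_le (norm_nonneg y)
      nlinarith [sq_nonneg (Real.log (1 + ‖y‖) - 1), sq_nonneg (Real.log ‖y‖)]
    have hn := nearLog_le hs (x - y)
    have hR := abs_logRem_le hx y
    have hL : 0 ≤ Real.log (1 + ‖y‖) := Real.log_nonneg (by linarith [norm_nonneg y])
    have hnn := nearLog_nonneg (x - y)
    change _ ≤ 8 * M / ‖x‖ ^ 3 * 406 * ((1 + Real.log ‖y‖ ^ 2) * wt 3 y * |V y|) +
      8 * M / ‖x‖ ^ 3 * (64 * s⁻¹) * (nearPow s (x - y) * (wt 3 y * |V y|))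
    rw [norm_mul, Complex.norm_real, Real.norm_eq_abs]
    calc |logRem x y| * ‖f y‖ ≤ (‖y‖ ^ 3 / ‖x‖ ^ 3 *
          (64 * Real.log (1 + ‖y‖) + 150 + 64 * nearLog (x - y))) * (M * |V y|) :=
          mul_le_mul hR hy (norm_nonneg _) (by positivity)
      _ ≤ (8 * wt 3 y / ‖x‖ ^ 3 * (406 * (1 + Real.log ‖y‖ ^ 2) +
          64 * (s⁻¹ * nearPow s (x - y)))) * (M * |V y|) := by
          refine mul_le_mul_of_nonneg_right ?_ (by positivity)
          refine mul_le_mul ?_ (by linarith) (by positivity) (by positivity)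
          exact div_le_div_of_nonneg_right hy3 (by positivity)
      _ = _ := by ring
  · simp only [Pi.add_apply]
    rw [integral_add i1 i2, integral_const_mul, integral_const_mul]
    have h1 := (h x).2
    have h2 : 8 * M / ‖x‖ ^ 3 * (64 * s⁻¹) * (∫ y, nearPow s (x - y) * (wt 3 y * |V y|)) ≤
      8 * M / ‖x‖ ^ 3 * (64 * s⁻¹) * C := mul_le_mul_of_nonneg_left h1 (by positivity)
    refine (add_le_add le_rfl h2).trans (le_of_eq ?_)
    ring

/-- The coefficient vector of the expansion of `Φ(ζ)`. -/
def dipole (V : E → ℝ) (ζ : L2) (i : Fin 4) : ℂ := (1 / (8 * Real.pi ^ 2) : ℝ) * mom (den V ζ) i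

/-- The coefficient matrix of the expansion of `Φ(ζ)`. -/
def quadrupole (V : E → ℝ) (ζ : L2) : Matrix (Fin 4) (Fin 4) ℂ := Matrix.of fun i j =>
  ((1 / (8 * Real.pi ^ 2) : ℝ) : ℂ) *
    (mom₂ (den V ζ) i j - if i = j then (∑ k, mom₂ (den V ζ) k k) / 2 else 0)

lemma mom₂_symm (f : E → ℂ) (i j : Fin 4) : mom₂ f i j = mom₂ f j i := by
  simp only [mom₂, mul_comm]

lemma isSymm_quadrupole (V : E → ℝ) (ζ : L2) : (quadrupole V ζ).IsSymm := by
  refine Matrix.IsSymm.ext fun i j => ?_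
  simp only [quadrupole, Matrix.of_apply, mom₂_symm _ j i, eq_comm (a := j) (b := i)]

lemma sum_coord_mul_self (x : E) : ∑ i, (x i : ℂ) * (x i : ℂ) = (‖x‖ : ℂ) ^ 2 := by
  have := real_inner_eq_sum x x
  rw [real_inner_self_eq_norm_sq] at this
  exact_mod_cast this.symm

lemma sum_quadrupole (V : E → ℝ) (ζ : L2) (x : E) :
    ∑ i, ∑ j, quadrupole V ζ i j * (x j : ℂ) * (x i : ℂ) = ((1 / (8 * Real.pi ^ 2) : ℝ) : ℂ) *
      ((∑ i, ∑ j, ((x i : ℂ) * (x j : ℂ)) * mom₂ (den V ζ) i j) -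
        (∑ k, mom₂ (den V ζ) k k) / 2 * (‖x‖ : ℂ) ^ 2) := by
  rw [← sum_coord_mul_self, Finset.mul_sum, ← Finset.sum_sub_distrib, Finset.mul_sum]
  refine Finset.sum_congr rfl fun i _ => ?_
  have h : (∑ k, mom₂ (den V ζ) k k) / 2 * ((x i : ℂ) * (x i : ℂ)) =
      ∑ j, if i = j then (∑ k, mom₂ (den V ζ) k k) / 2 * ((x i : ℂ) * (x j : ℂ)) else 0 := by
    simp
  rw [h, ← Finset.sum_sub_distrib, Finset.mul_sum]
  refine Finset.sum_congr rfl fun j _ => ?_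
  simp only [quadrupole, Matrix.of_apply]
  split_ifs <;> ring

lemma integral_add_five {α : Type*} [MeasurableSpace α] {μ : Measure α} {f₁ f₂ f₃ f₄ f₅ : α → ℂ}
    (h₁ : Integrable f₁ μ) (h₂ : Integrable f₂ μ) (h₃ : Integrable f₃ μ) (h₄ : Integrable f₄ μ)
    (h₅ : Integrable f₅ μ) : ∫ y, (f₁ y + f₂ y + f₃ y + f₄ y + f₅ y) ∂μ =
      ∫ y, f₁ y ∂μ + ∫ y, f₂ y ∂μ + ∫ y, f₃ y ∂μ + ∫ y, f₄ y ∂μ + ∫ y, f₅ y ∂μ := by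
  have j₁ : Integrable (fun y => f₁ y + f₂ y) μ := h₁.add h₂
  have j₂ : Integrable (fun y => f₁ y + f₂ y + f₃ y) μ := j₁.add h₃
  have j₃ : Integrable (fun y => f₁ y + f₂ y + f₃ y + f₄ y) μ := j₂.add h₄
  rw [integral_add j₃ h₅, integral_add j₂ h₄, integral_add j₁ h₃, integral_add h₁ h₂]

/-- The second order expansion is integrated against the density. The term log|x| is killed by the
vanishing mean, and the term |y|²/(2|x|²) becomes the trace correction in the quadrupole matrix. -/
lemma LogDecay.N0v_expansion (hV : LogDecay 0 V) {ζ : L2} (hm : HasMoments 3 (den V ζ))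
    (h0 : ∫ y, den V ζ y = 0) {x : E} (hx : x ≠ 0) :
    N0v V ζ x = (∑ i, dipole V ζ i * (x i : ℂ)) / (‖x‖ : ℂ) ^ 2 +
      (∑ i, ∑ j, quadrupole V ζ i j * (x j : ℂ) * (x i : ℂ)) / (‖x‖ : ℂ) ^ 4 -
      (1 / (8 * Real.pi ^ 2) : ℝ) * ∫ y, (logRem x y : ℂ) * den V ζ y := by
  set k : ℝ := 1 / (8 * Real.pi ^ 2) with hk
  have hk0 : (k : ℂ) ≠ 0 := by
    have : k ≠ 0 := by positivity
    exact_mod_cast this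
  have hx0 : (‖x‖ : ℂ) ≠ 0 := by exact_mod_cast norm_ne_zero_iff.2 hx
  have hN : ∀ y, N0 (x - y) * den V ζ y = -(k : ℂ) * ((Real.log ‖x - y‖ : ℂ) * den V ζ y) := by
    intro y; rw [N0, hk]; push_cast; ring
  have i0 : Integrable fun y => (Real.log ‖x - y‖ : ℂ) * den V ζ y := by
    refine ((hV.integrable_N0v ζ x).const_mul (-(k : ℂ)⁻¹)).congr (.of_forall fun y => ?_)
    change -(k : ℂ)⁻¹ * (N0 (x - y) * den V ζ y) = _
    rw [hN]; field_simp
  have i1 := hm.integrable.const_mul (-(Real.log ‖x‖ : ℂ))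
  obtain ⟨i2, e2⟩ := hm.integral_inner (by norm_num) x
  obtain ⟨i3, e3⟩ := hm.integral_inner_sq (by norm_num) x
  have i4 := hm.integrable_norm_pow (m := 2) (by norm_num)
  have e4 := hm.integral_norm_sq (by norm_num)
  have i2' := i2.const_mul (((‖x‖ : ℂ) ^ 2)⁻¹)
  have i3' := i3.const_mul (((‖x‖ : ℂ) ^ 4)⁻¹)
  have i4' := i4.const_mul (-((2 * (‖x‖ : ℂ) ^ 2)⁻¹))
  have e5 : ∫ y, (logRem x y : ℂ) * den V ζ y = (∫ y, (Real.log ‖x - y‖ : ℂ) * den V ζ y) +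
      ((‖x‖ : ℂ) ^ 2)⁻¹ * (∑ i, (x i : ℂ) * mom (den V ζ) i) -
      (2 * (‖x‖ : ℂ) ^ 2)⁻¹ * (∑ i, mom₂ (den V ζ) i i) +
      ((‖x‖ : ℂ) ^ 4)⁻¹ * ∑ i, ∑ j, ((x i : ℂ) * (x j : ℂ)) * mom₂ (den V ζ) i j := by
    have : ∀ y, (logRem x y : ℂ) * den V ζ y = (Real.log ‖x - y‖ : ℂ) * den V ζ y +
        -(Real.log ‖x‖ : ℂ) * den V ζ y +
        ((‖x‖ : ℂ) ^ 2)⁻¹ * (((inner ℝ x y : ℝ) : ℂ) * den V ζ y) +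
        -(2 * (‖x‖ : ℂ) ^ 2)⁻¹ * (((‖y‖ ^ 2 : ℝ) : ℂ) * den V ζ y) +
        ((‖x‖ : ℂ) ^ 4)⁻¹ * (((inner ℝ x y ^ 2 : ℝ) : ℂ) * den V ζ y) := by
      intro y; rw [logRem]; push_cast; ring
    refine (integral_congr_ae (.of_forall this)).trans
      ((integral_add_five i0 i1 i2' i4' i3').trans ?_)
    rw [integral_const_mul, integral_const_mul, integral_const_mul, integral_const_mul, e2, e3, e4, h0]
    ring
  have e6 : N0v V ζ x = -(k : ℂ) * ∫ y, (Real.log ‖x - y‖ : ℂ) * den V ζ y := by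
    rw [← integral_const_mul]
    exact integral_congr_ae (.of_forall hN)
  have e7 : ∑ i, dipole V ζ i * (x i : ℂ) = (k : ℂ) * ∑ i, (x i : ℂ) * mom (den V ζ) i := by
    rw [Finset.mul_sum]
    exact Finset.sum_congr rfl fun i _ => by rw [dipole]; ring
  rw [sum_quadrupole, e7, e6, e5]
  field_simp
  ring

lemma integral_den_eq_zero (hV : LogDecay 0 V) {ζ : L2} (hζ : ζ ∈ S1 V) : ∫ y, den V ζ y = 0 := by
  have h0 := (mem_S1_iff.1 hζ).1
  rwa [hV.inner_vVec] at h0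

lemma LogDecay.exists_expansion_bound (hV : LogDecay 0 V) (hV3 : LogDecay 3 V) (hv : vVec V ≠ 0)
    {ζ : L2} (hζ : ζ ∈ S1 V) : ∃ C : ℝ, 0 ≤ C ∧ ∀ x : E, 1 ≤ ‖x‖ →
      ‖Phi V ζ x - (-cst V ζ + (∑ i, dipole V ζ i * (x i : ℂ)) / (‖x‖ : ℂ) ^ 2 +
        (∑ i, ∑ j, quadrupole V ζ i j * (x j : ℂ) * (x i : ℂ)) / (‖x‖ : ℂ) ^ 4)‖ ≤
        C * (‖x‖ ^ 3)⁻¹ := by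
  obtain ⟨C, hC, h⟩ := hV3.exists_logRem_bound
  obtain ⟨M, hM, hf⟩ := hV.norm_vFun_mul_le hv hζ
  refine ⟨1 / (8 * Real.pi ^ 2) * (M * C), by positivity, fun x hx => ?_⟩
  rw [Phi_eq, hV.N0v_expansion (hV.hasMoments_den hV3 hv hζ) (integral_den_eq_zero hV hζ)
    (norm_pos_iff.1 (by linarith))]
  have h1 := (norm_integral_le_integral_norm _).trans (h x hx (den V ζ) M hM hf)
  have h2 : ∀ a b c d : ℂ, a + b - d - c - (-c + a + b) = -d := fun a b c d => by ring
  rw [h2, norm_neg, norm_mul, Complex.norm_real, Real.norm_of_nonneg (by positivity), mul_assoc]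
  exact mul_le_mul_of_nonneg_left h1 (by positivity)

theorem LogDecay.hasExpansion_Phi (hV : LogDecay 0 V) (hV3 : LogDecay 3 V) (hv : vVec V ≠ 0)
    {ζ : L2} (hζ : ζ ∈ S1 V) :
    HasExpansion (Phi V ζ) (cst V ζ) (dipole V ζ) (quadrupole V ζ) := by
  obtain ⟨C, -, h⟩ := hV.exists_expansion_bound hV3 hv hζ
  refine ⟨isSymm_quadrupole V ζ, IsBigO.mono ?_ inf_le_left⟩
  refine IsBigO.of_bound C ?_
  filter_upwards [(tendsto_norm_cocompact_atTop (E := E)).eventually (eventually_ge_atTop 1)] with x hx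
  rw [Real.norm_of_nonneg (by positivity)]
  exact h x hx

lemma norm_quadratic_le (A : Matrix (Fin 4) (Fin 4) ℂ) (x : E) :
    ‖∑ i, ∑ j, A i j * (x j : ℂ) * (x i : ℂ)‖ ≤ (∑ i, ∑ j, ‖A i j‖) * ‖x‖ ^ 2 := by
  rw [Finset.sum_mul]
  refine norm_sum_le_of_le _ fun i _ => ?_
  rw [Finset.sum_mul]
  refine norm_sum_le_of_le _ fun j _ => ?_
  rw [norm_mul, norm_mul, Complex.norm_real, Complex.norm_real, mul_assoc, sq]
  exact mul_le_mul_of_nonneg_left (mul_le_mul (abs_apply_le x j) (abs_apply_le x i) (abs_nonneg _)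
    (norm_nonneg _)) (norm_nonneg _)

lemma exists_one_add_norm_bound {u : E → ℂ} {B C : ℝ} {n : ℕ} (hB : ∀ x, ‖u x‖ ≤ B) (hC : 0 ≤ C)
    (h : ∀ x : E, 1 ≤ ‖x‖ → ‖u x‖ ≤ C * (‖x‖ ^ n)⁻¹) (x : E) :
    (1 + ‖x‖) ^ n * ‖u x‖ ≤ 2 ^ n * (B + C) := by
  have hB0 : 0 ≤ B := (norm_nonneg _).trans (hB x)
  rcases le_or_gt 1 ‖x‖ with hx | hx
  · have h1 : (1 + ‖x‖) ^ n ≤ (2 * ‖x‖) ^ n := pow_le_pow_left₀ (by positivity) (by linarith) n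
    have h2 : 0 < ‖x‖ ^ n := by positivity
    calc (1 + ‖x‖) ^ n * ‖u x‖ ≤ (2 * ‖x‖) ^ n * (C * (‖x‖ ^ n)⁻¹) :=
          mul_le_mul h1 (h x hx) (norm_nonneg _) (by positivity)
      _ = 2 ^ n * C := by rw [mul_pow]; field_simp
      _ ≤ _ := by gcongr; linarith
  · have h1 : (1 + ‖x‖) ^ n ≤ 2 ^ n := pow_le_pow_left₀ (by positivity) (by linarith) n
    exact mul_le_mul h1 ((hB x).trans (by linarith)) (norm_nonneg _) (by positivity)

lemma LogDecay.exists_Phi_decay_two (hV : LogDecay 0 V) (hV3 : LogDecay 3 V) (hv : vVec V ≠ 0)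
    {ζ : L2} (hζ : ζ ∈ S1 V) (hc : cst V ζ = 0) (hd : dipole V ζ = 0) :
    ∃ C : ℝ, 0 ≤ C ∧ ∀ x : E, (1 + ‖x‖) ^ 2 * ‖Phi V ζ x‖ ≤ C := by
  obtain ⟨C, hC, h⟩ := hV.exists_expansion_bound hV3 hv hζ
  obtain ⟨M, hM, hb⟩ := hV.exists_Phi_bound
  set A := ∑ i, ∑ j, ‖quadrupole V ζ i j‖ with hA
  have hA0 : 0 ≤ A := Finset.sum_nonneg fun i _ => Finset.sum_nonneg fun j _ => norm_nonneg _
  refine ⟨_, ?_, exists_one_add_norm_bound (n := 2) (C := A + C) (hb ζ hζ) (by positivity)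
    fun x hx => ?_⟩
  · positivity
  have h1 := h x hx
  rw [hc, hd] at h1
  simp only [neg_zero, Pi.zero_apply, zero_mul, Finset.sum_const_zero, zero_div, zero_add] at h1
  have h2 := norm_quadratic_le (quadrupole V ζ) x
  rw [← hA] at h2
  have hx0 : 0 < ‖x‖ := by linarith
  have h3 : ‖(∑ i, ∑ j, quadrupole V ζ i j * (x j : ℂ) * (x i : ℂ)) / (‖x‖ : ℂ) ^ 4‖ ≤
      A * (‖x‖ ^ 2)⁻¹ := by
    rw [norm_div, norm_pow, Complex.norm_real, norm_norm, div_le_iff₀ (by positivity)]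
    refine h2.trans (le_of_eq ?_)
    field_simp
  have h4 : C * (‖x‖ ^ 3)⁻¹ ≤ C * (‖x‖ ^ 2)⁻¹ := by gcongr; norm_num
  have h5 := norm_le_insert' (Phi V ζ x)
    ((∑ i, ∑ j, quadrupole V ζ i j * (x j : ℂ) * (x i : ℂ)) / (‖x‖ : ℂ) ^ 4)
  rw [add_mul]
  linarith

lemma LogDecay.exists_Phi_decay_three (hV : LogDecay 0 V) (hV3 : LogDecay 3 V) (hv : vVec V ≠ 0)
    {ζ : L2} (hζ : ζ ∈ S1 V) (hc : cst V ζ = 0) (hd : dipole V ζ = 0) (hq : quadrupole V ζ = 0) :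
    ∃ C : ℝ, 0 ≤ C ∧ ∀ x : E, (1 + ‖x‖) ^ 3 * ‖Phi V ζ x‖ ≤ C := by
  obtain ⟨C, hC, h⟩ := hV.exists_expansion_bound hV3 hv hζ
  obtain ⟨M, hM, hb⟩ := hV.exists_Phi_bound
  refine ⟨_, ?_, exists_one_add_norm_bound (n := 3) (C := C) (hb ζ hζ) hC fun x hx => ?_⟩
  · positivity
  have h1 := h x hx
  rw [hc, hd, hq] at h1
  simpa using h1

/-- A bootstrap: once the constant and the dipole vanish, Φ = O(|x|⁻²), and vζ = -VΦ gains two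
moments over V. This makes the form of T₃ absolutely convergent. -/
lemma LogDecay.hasMoments_den_five (hV : LogDecay 0 V) (hV3 : LogDecay 3 V) (hv : vVec V ≠ 0)
    {ζ : L2} (hζ : ζ ∈ S1 V) (hc : cst V ζ = 0) (hd : dipole V ζ = 0) :
    HasMoments 5 (den V ζ) := by
  obtain ⟨C, -, h⟩ := hV.exists_Phi_decay_two hV3 hv hζ hc hd
  have hV3' : LogDecay (3 : ℕ) V := by exact_mod_cast hV3
  refine hV3'.hasMoments (m := 2) (hV.aesm_den ζ) (C := C) ?_
  filter_upwards [hV.vFun_mul_ae hv hζ] with y hy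
  have : den V ζ y = -((V y : ℂ) * Phi V ζ y) := hy
  rw [this, norm_neg, norm_mul, Complex.norm_real, Real.norm_eq_abs]
  have := mul_le_mul_of_nonneg_right (h y) (abs_nonneg (V y))
  linarith

end Potential

/-! ### The forms of `T₂` and `T₃` -/

/-- `F` is integrable with integral `I`. -/
def HasInt (F : E × E → ℂ) (I : ℂ) : Prop := Integrable F ∧ ∫ p, F p = I

lemma HasInt.add {F G : E × E → ℂ} {I J : ℂ} (hF : HasInt F I) (hG : HasInt G J) :
    HasInt (fun p => F p + G p) (I + J) :=
  ⟨hF.1.add hG.1, by rw [integral_add hF.1 hG.1, hF.2, hG.2]⟩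

lemma HasInt.const_mul {F : E × E → ℂ} {I : ℂ} (hF : HasInt F I) (c : ℂ) :
    HasInt (fun p => c * F p) (c * I) :=
  ⟨hF.1.const_mul c, by rw [integral_const_mul, hF.2]⟩

lemma HasInt.sum {ι : Type*} (s : Finset ι) {F : ι → E × E → ℂ} {I : ι → ℂ}
    (hF : ∀ i, HasInt (F i) (I i)) : HasInt (fun p => ∑ i ∈ s, F i p) (∑ i ∈ s, I i) :=
  ⟨integrable_finsetSum _ fun i _ => (hF i).1, by
    rw [integral_finsetSum _ fun i _ => (hF i).1]
    exact Finset.sum_congr rfl fun i _ => (hF i).2⟩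

lemma HasInt.tensor {a b : E → ℂ} (ha : Integrable a) (hb : Integrable b) :
    HasInt (fun p => a p.1 * b p.2) ((∫ x, a x) * ∫ y, b y) :=
  ⟨ha.mul_prod hb, integral_prod_mul a b⟩

lemma HasInt.congr {F G : E × E → ℂ} {I J : ℂ} (hF : HasInt F I) (h : ∀ p, G p = F p) (hJ : J = I) :
    HasInt G J := by
  rw [funext h, hJ]; exact hF

/-- In |x|² - 2x·y + |y|² the pure squares integrate to zero by the vanishing means. The expansion
into tensor products also shows absolute convergence. -/
lemma hasInt_norm_sq {f g : E → ℂ} (hf : HasMoments 2 f) (hg : HasMoments 2 g)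
    (hf0 : ∫ y, f y = 0) (hg0 : ∫ y, g y = 0) :
    HasInt (fun p => ((‖p.1 - p.2‖ ^ 2 : ℝ) : ℂ) * f p.2 * g p.1) (-2 * ∑ i, mom g i * mom f i) := by
  have h1 := HasInt.tensor (hg.integrable_norm_pow (m := 2) le_rfl) hf.integrable
  have h2 := HasInt.tensor hg.integrable (hf.integrable_norm_pow (m := 2) le_rfl)
  have h3 := (HasInt.sum Finset.univ fun i => HasInt.tensor
    (hg.integrable_coord (by norm_num) i) (hf.integrable_coord (by norm_num) i)).const_mul (-2)
  refine ((h1.add h2).add h3).congr (fun p => ?_) ?_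
  · rw [norm_sub_sq_real, real_inner_eq_sum]
    have : ∑ i, (p.1 i : ℂ) * g p.1 * ((p.2 i : ℂ) * f p.2) =
        (∑ i, (p.1 i : ℂ) * (p.2 i : ℂ)) * (f p.2 * g p.1) := by
      rw [Finset.sum_mul]; exact Finset.sum_congr rfl fun i _ => by ring
    rw [this]
    push_cast
    ring
  · rw [hf0, hg0]; simp [mom]

/-- Expanding (|x|² - 2x·y + |y|²)², the terms of degree at most one in x or in y vanish with the
means and first moments; 2|x|²|y|² and 4(x·y)² remain. -/
lemma hasInt_norm_four {f g : E → ℂ} (hf : HasMoments 4 f) (hg : HasMoments 4 g)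
    (hf0 : ∫ y, f y = 0) (hg0 : ∫ y, g y = 0) (hf1 : ∀ i, mom f i = 0) (hg1 : ∀ i, mom g i = 0) :
    HasInt (fun p => ((‖p.1 - p.2‖ ^ 4 : ℝ) : ℂ) * f p.2 * g p.1)
      (2 * ((∑ i, mom₂ g i i) * ∑ i, mom₂ f i i) + 4 * ∑ i, ∑ j, mom₂ g i j * mom₂ f i j) := by
  have h1 := HasInt.tensor (hg.integrable_norm_pow (m := 4) le_rfl) hf.integrable
  have h2 := HasInt.tensor hg.integrable (hf.integrable_norm_pow (m := 4) le_rfl)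
  have h3 := (HasInt.tensor (hg.integrable_norm_pow (m := 2) (by norm_num))
    (hf.integrable_norm_pow (m := 2) (by norm_num))).const_mul 2
  have h4 := (HasInt.sum Finset.univ fun i => HasInt.tensor
    (hg.integrable_coord_norm (by norm_num) i) (hf.integrable_coord (by norm_num) i)).const_mul (-4)
  have h5 := (HasInt.sum Finset.univ fun i => HasInt.tensor
    (hg.integrable_coord (by norm_num) i) (hf.integrable_coord_norm (by norm_num) i)).const_mul (-4)
  have h6 := (HasInt.sum Finset.univ fun i => HasInt.sum Finset.univ fun j => HasInt.tensor
    (hg.integrable_coord_mul (by norm_num) i j)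
    (hf.integrable_coord_mul (by norm_num) i j)).const_mul 4
  refine (((((h1.add h2).add h3).add h4).add h5).add h6).congr (fun p => ?_) ?_
  · have e1 : ∑ i, ((‖p.1‖ ^ 2 : ℝ) : ℂ) * (p.1 i : ℂ) * g p.1 * ((p.2 i : ℂ) * f p.2) =
        (∑ i, (p.1 i : ℂ) * (p.2 i : ℂ)) * (((‖p.1‖ ^ 2 : ℝ) : ℂ) * (f p.2 * g p.1)) := by
      rw [Finset.sum_mul]; exact Finset.sum_congr rfl fun i _ => by ring
    have e2 : ∑ i, (p.1 i : ℂ) * g p.1 * (((‖p.2‖ ^ 2 : ℝ) : ℂ) * (p.2 i : ℂ) * f p.2) =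
        (∑ i, (p.1 i : ℂ) * (p.2 i : ℂ)) * (((‖p.2‖ ^ 2 : ℝ) : ℂ) * (f p.2 * g p.1)) := by
      rw [Finset.sum_mul]; exact Finset.sum_congr rfl fun i _ => by ring
    have e3 : ∑ i, ∑ j, (p.1 i : ℂ) * (p.1 j : ℂ) * g p.1 * ((p.2 i : ℂ) * (p.2 j : ℂ) * f p.2) =
        (∑ i, (p.1 i : ℂ) * (p.2 i : ℂ)) ^ 2 * (f p.2 * g p.1) := by
      rw [sq, Finset.sum_mul_sum, Finset.sum_mul]
      refine Finset.sum_congr rfl fun i _ => ?_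
      rw [Finset.sum_mul]
      exact Finset.sum_congr rfl fun j _ => by ring
    have e4 : ‖p.1 - p.2‖ ^ 4 = (‖p.1‖ ^ 2 - 2 * (∑ i, p.1 i * p.2 i) + ‖p.2‖ ^ 2) ^ 2 := by
      rw [← real_inner_eq_sum, ← norm_sub_sq_real]; ring
    rw [e1, e2, e3, e4]
    push_cast
    ring
  · have e1 : ∀ i, ∫ y, (y i : ℂ) * f y = 0 := hf1
    have e2 : ∀ i, ∫ y, (y i : ℂ) * g y = 0 := hg1
    simp only [hf0, hg0, e1, e2, hg.integral_norm_sq (by norm_num), hf.integral_norm_sq (by norm_num)]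
    simp [mom₂]

section Potential

variable {V : E → ℝ}

lemma HasInt.kernel_iff {k : E → ℝ} {f g : E → ℂ} {c J : ℂ} {G : E → ℂ} (hc : c ≠ 0)
    (hG : ∀ z, G z = c * k z) (h : HasInt (fun p => (k (p.1 - p.2) : ℂ) * f p.2 * g p.1) J) :
    (Integrable (fun p : E × E => G (p.1 - p.2) * f p.2 * g p.1) ∧
      ∫ p : E × E, G (p.1 - p.2) * f p.2 * g p.1 = 0) ↔ J = 0 := by
  have h' := (h.const_mul c).congr (G := fun p => G (p.1 - p.2) * f p.2 * g p.1)
    (fun p => by rw [hG]; ring) rfl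
  rw [h'.2]
  exact ⟨fun h => (mul_eq_zero.1 h.2).resolve_left hc, fun h => ⟨h'.1, by rw [h, mul_zero]⟩⟩

lemma mem_kerForm_iff {G : E → ℂ} {K : Submodule ℂ L2} {ζ : L2} : ζ ∈ kerForm V G K ↔
    ζ ∈ K ∧ ∀ η ∈ K, Integrable (fun p : E × E => G (p.1 - p.2) * den V ζ p.2 * conj (den V η p.1)) ∧
      ∫ p : E × E, G (p.1 - p.2) * den V ζ p.2 * conj (den V η p.1) = 0 := Iff.rfl

lemma integral_conj_eq_zero {f : E → ℂ} (h : ∫ y, f y = 0) : ∫ y, conj (f y) = 0 := by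
  rw [integral_conj, h, map_zero]

/-- On the diagonal η = ζ the form is a nonzero multiple of ∑ |momᵢ|², so its kernel is the common
zero set of the first moments. -/
lemma LogDecay.mem_S3_iff (hV : LogDecay 0 V) (hV3 : LogDecay 3 V) (hv : vVec V ≠ 0) {ζ : L2} :
    ζ ∈ S3 V ↔ ζ ∈ S2 V ∧ ∀ i, mom (den V ζ) i = 0 := by
  have key : ∀ {ζ}, ζ ∈ S2 V → ∀ η ∈ S2 V,
      ((Integrable (fun p : E × E => G2 (p.1 - p.2) * den V ζ p.2 * conj (den V η p.1)) ∧
      ∫ p : E × E, G2 (p.1 - p.2) * den V ζ p.2 * conj (den V η p.1) = 0) ↔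
      -2 * ∑ i, conj (mom (den V η) i) * mom (den V ζ) i = 0) := by
    intro ζ hζ η hη
    have hζ1 := ((hV.mem_S2_iff hv).1 hζ).1
    have hη1 := ((hV.mem_S2_iff hv).1 hη).1
    have h := hasInt_norm_sq ((hV.hasMoments_den hV3 hv hζ1).mono (by norm_num))
      ((hV.hasMoments_den hV3 hv hη1).mono (by norm_num)).conj
      (integral_den_eq_zero hV hζ1) (integral_conj_eq_zero (integral_den_eq_zero hV hη1))
    simp only [mom_conj] at h
    refine HasInt.kernel_iff (f := den V ζ) (g := fun x => conj (den V η x)) (k := fun z => ‖z‖ ^ 2) (c := -Complex.I * (1 / (4 ^ 4 * Real.pi) : ℝ))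
      ?_ (fun z => ?_) h
    · have : (1 / (4 ^ 4 * Real.pi) : ℝ) ≠ 0 := by positivity
      exact mul_ne_zero (neg_ne_zero.2 Complex.I_ne_zero) (by exact_mod_cast this)
    · rw [G2]; push_cast; ring
  rw [S3, mem_kerForm_iff]
  refine and_congr_right fun hζ => ⟨fun h i => ?_, fun h η hη => ?_⟩
  · have h1 := (key hζ ζ hζ).1 (h ζ hζ)
    rw [mul_eq_zero, or_iff_right (by norm_num)] at h1
    have h2 : ∑ i, ‖mom (den V ζ) i‖ ^ 2 = 0 := by
      have h3 : ((∑ i, ‖mom (den V ζ) i‖ ^ 2 : ℝ) : ℂ) = 0 := by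
        rw [← h1]; push_cast
        exact Finset.sum_congr rfl fun i _ => (Complex.conj_mul' _).symm
      exact_mod_cast h3
    have h4 := (Finset.sum_eq_zero_iff_of_nonneg fun i _ => by positivity).1 h2 i (Finset.mem_univ i)
    simpa using h4
  · exact (key hζ η hη).2 (by simp [h])

/-- On the diagonal the form is a positive multiple of 2|tr M|² + 4∑ |Mᵢⱼ|², which vanishes only
with all second moments. -/
lemma LogDecay.mem_S4_iff (hV : LogDecay 0 V) (hV3 : LogDecay 3 V) (hv : vVec V ≠ 0) {ζ : L2} :
    ζ ∈ S4 V ↔ ζ ∈ S3 V ∧ ∀ i j, mom₂ (den V ζ) i j = 0 := by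
  have hdip : ∀ {ζ}, ζ ∈ S3 V → ζ ∈ S1 V ∧ HasMoments 4 (den V ζ) ∧ ∀ i, mom (den V ζ) i = 0 := by
    intro ζ hζ
    obtain ⟨hζ2, hm⟩ := (hV.mem_S3_iff hV3 hv).1 hζ
    obtain ⟨hζ1, hc⟩ := (hV.mem_S2_iff hv).1 hζ2
    exact ⟨hζ1, (hV.hasMoments_den_five hV3 hv hζ1 hc
      (funext fun i => by simp [dipole, hm i])).mono (by norm_num), hm⟩
  have key : ∀ {ζ}, ζ ∈ S3 V → ∀ η ∈ S3 V,
      ((Integrable (fun p : E × E => G4 (p.1 - p.2) * den V ζ p.2 * conj (den V η p.1)) ∧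
      ∫ p : E × E, G4 (p.1 - p.2) * den V ζ p.2 * conj (den V η p.1) = 0) ↔
      2 * (conj (∑ i, mom₂ (den V η) i i) * ∑ i, mom₂ (den V ζ) i i) +
        4 * ∑ i, ∑ j, conj (mom₂ (den V η) i j) * mom₂ (den V ζ) i j = 0) := by
    intro ζ hζ η hη
    obtain ⟨hζ1, hζ2, hζ3⟩ := hdip hζ
    obtain ⟨hη1, hη2, hη3⟩ := hdip hη
    have h := hasInt_norm_four hζ2 hη2.conj
      (integral_den_eq_zero hV hζ1) (integral_conj_eq_zero (integral_den_eq_zero hV hη1)) hζ3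
      (fun i => by rw [mom_conj, hη3, map_zero])
    simp only [mom₂_conj, ← map_sum] at h
    refine HasInt.kernel_iff (f := den V ζ) (g := fun x => conj (den V η x)) (k := fun z => ‖z‖ ^ 4) (c := (1 / (3 * 4 ^ 3) : ℝ))
      ?_ (fun z => ?_) h
    · norm_num
    · rw [G4]; push_cast; ring
  rw [S4, mem_kerForm_iff]
  refine and_congr_right fun hζ => ⟨fun h i j => ?_, fun h η hη => ?_⟩
  · have h1 := (key hζ ζ hζ).1 (h ζ hζ)
    have h2 : 2 * ‖∑ i, mom₂ (den V ζ) i i‖ ^ 2 + 4 * ∑ i, ∑ j, ‖mom₂ (den V ζ) i j‖ ^ 2 = 0 := by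
      have h3 : ((2 * ‖∑ i, mom₂ (den V ζ) i i‖ ^ 2 +
          4 * ∑ i, ∑ j, ‖mom₂ (den V ζ) i j‖ ^ 2 : ℝ) : ℂ) = 0 := by
        rw [← h1]; push_cast
        simp only [Complex.conj_mul']
      exact_mod_cast h3
    have h4 : 0 ≤ ‖∑ i, mom₂ (den V ζ) i i‖ ^ 2 := by positivity
    have h5 : ∑ i, ∑ j, ‖mom₂ (den V ζ) i j‖ ^ 2 = 0 :=
      le_antisymm (by linarith) (by positivity)
    have h6 := (Finset.sum_eq_zero_iff_of_nonneg fun i _ => by positivity).1 h5 i (Finset.mem_univ i)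
    have h7 := (Finset.sum_eq_zero_iff_of_nonneg fun i _ => by positivity).1 h6 j (Finset.mem_univ j)
    simpa using h7
  · exact (key hζ η hη).2 (by simp [h])

lemma prefactor_ne_zero : ((1 / (8 * Real.pi ^ 2) : ℝ) : ℂ) ≠ 0 := by
  have : (1 / (8 * Real.pi ^ 2) : ℝ) ≠ 0 := by positivity
  exact_mod_cast this

lemma dipole_eq_zero_iff {ζ : L2} : dipole V ζ = 0 ↔ ∀ i, mom (den V ζ) i = 0 := by
  rw [funext_iff]
  exact forall_congr' fun i => by simp only [dipole, Pi.zero_apply, mul_eq_zero, prefactor_ne_zero, false_or]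

lemma quadrupole_eq_zero_iff {ζ : L2} : quadrupole V ζ = 0 ↔ ∀ i j, mom₂ (den V ζ) i j = 0 := by
  constructor
  · intro h
    have h1 : ∀ i j, mom₂ (den V ζ) i j = if i = j then (∑ k, mom₂ (den V ζ) k k) / 2 else 0 := by
      intro i j
      have h2 := congrFun (congrFun h i) j
      simp only [quadrupole, Matrix.of_apply, Matrix.zero_apply, mul_eq_zero, prefactor_ne_zero,
        false_or] at h2
      exact sub_eq_zero.1 h2
    set t := ∑ k, mom₂ (den V ζ) k k with ht
    -- Vanishing of the quadrupole makes M equal to t/2 times the identity, t being its trace;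
    -- taking the trace in dimension four gives t = 2t.
    have h2 : t = 2 * t := by
      conv_lhs => rw [ht, Finset.sum_congr rfl fun k _ => h1 k k]
      simp only [if_true, Finset.sum_const, Finset.card_univ, Fintype.card_fin, nsmul_eq_mul]
      push_cast; ring
    have h3 : t = 0 := by linear_combination -h2
    intro i j
    rw [h1, h3]; simp
  · intro h
    ext i j
    simp [quadrupole, h]

lemma LogDecay.isPWave_Phi (hV : LogDecay 0 V) (hV3 : LogDecay 3 V) (hv : vVec V ≠ 0) {ζ : L2}
    (hζ : ζ ∈ S2 V) (h0 : ζ ≠ 0) (h3 : ζ ∉ S3 V) : IsPWave V (Phi V ζ) := by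
  obtain ⟨h1, hc⟩ := (hV.mem_S2_iff hv).1 hζ
  refine ⟨hV.inNInf_Phi hv h1 h0, dipole V ζ, quadrupole V ζ, fun hd => h3 ?_, ?_⟩
  · exact (hV.mem_S3_iff hV3 hv).2 ⟨hζ, dipole_eq_zero_iff.1 hd⟩
  · rw [← hc]; exact hV.hasExpansion_Phi hV3 hv h1

lemma LogDecay.isDWave_Phi (hV : LogDecay 0 V) (hV3 : LogDecay 3 V) (hv : vVec V ≠ 0) {ζ : L2}
    (hζ : ζ ∈ S3 V) (h0 : ζ ≠ 0) (h4 : ζ ∉ S4 V) : IsDWave V (Phi V ζ) := by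
  obtain ⟨h2, hd⟩ := (hV.mem_S3_iff hV3 hv).1 hζ
  obtain ⟨h1, hc⟩ := (hV.mem_S2_iff hv).1 h2
  refine ⟨hV.inNInf_Phi hv h1 h0, quadrupole V ζ, fun hq => h4 ?_, ?_⟩
  · exact (hV.mem_S4_iff hV3 hv).2 ⟨hζ, quadrupole_eq_zero_iff.1 hq⟩
  · have := hV.hasExpansion_Phi hV3 hv h1
    rwa [hc, dipole_eq_zero_iff.2 hd] at this

end Potential

/-! ### Square integrability of potentials -/

/-- A kernel with an inverse square singularity, decaying as the inverse cube. -/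
def majKer (z : E) : ℝ := nearPow 2 z + ((1 + ‖z‖) ^ 3)⁻¹

lemma majKer_nonneg (z : E) : 0 ≤ majKer z := add_nonneg (nearPow_nonneg _ _) (by positivity)

lemma measurable_majKer : Measurable majKer :=
  (measurable_nearPow 2).add (by fun_prop)

/-- Cauchy-Schwarz through the discriminant of t ↦ ∫ (at² - 2ct + b), whose integrand is nonnegative
because c² = ab. -/
lemma sq_integral_le {a b c : E → ℝ} (ha : Integrable a) (hb : Integrable b) (hc : Integrable c)
    (ha0 : ∀ y, 0 ≤ a y) (hb0 : ∀ y, 0 ≤ b y) (h : ∀ y, c y ^ 2 = a y * b y) :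
    (∫ y, c y) ^ 2 ≤ (∫ y, a y) * ∫ y, b y := by
  have key : ∀ t : ℝ, 0 ≤ (∫ y, a y) * (t * t) + (-2 * ∫ y, c y) * t + ∫ y, b y := by
    intro t
    have i1 : Integrable fun y => a y * (t * t) := ha.mul_const _
    have i2 : Integrable fun y => -2 * c y * t := (hc.const_mul _).mul_const _
    have i3 : Integrable fun y => a y * (t * t) + -2 * c y * t := i1.add i2
    have : (∫ y, a y) * (t * t) + (-2 * ∫ y, c y) * t + ∫ y, b y =
        ∫ y, (a y * (t * t) + -2 * c y * t + b y) := by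
      rw [integral_add i3 hb, integral_add i1 i2, integral_mul_const, integral_mul_const,
        integral_const_mul]
    rw [this]
    refine integral_nonneg fun y => ?_
    change 0 ≤ a y * (t * t) + -2 * c y * t + b y
    rcases (ha0 y).eq_or_lt with h0 | h0
    · have hc0 : c y = 0 := by
        have := h y
        rw [← h0, zero_mul] at this
        exact pow_eq_zero_iff two_ne_zero |>.1 this
      rw [← h0, hc0]
      simpa using hb0 y
    · have h1 : 0 ≤ a y * (a y * (t * t) + -2 * c y * t + b y) := by
        have : a y * (a y * (t * t) + -2 * c y * t + b y) = (a y * t - c y) ^ 2 := by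
          linear_combination -h y
        rw [this]; positivity
      exact nonneg_of_mul_nonneg_right h1 h0
  have := discrim_le_zero key
  rw [discrim] at this
  nlinarith

lemma nearPow_two_sq {s : ℝ} (hs4 : s < 4) (z : E) :
    nearPow 2 z ^ 2 = nearPow (4 - s) z * nearPow s z := by
  unfold nearPow
  split_ifs with h
  · rcases (norm_nonneg z).eq_or_lt with h0 | h0
    · rw [← h0, Real.zero_rpow (by norm_num), Real.zero_rpow (by linarith)]; simp
    · rw [← Real.rpow_add h0, ← Real.rpow_natCast, ← Real.rpow_mul h0.le]
      congr 1; push_cast; ring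
  · simp

lemma integrable_kernel_mul {k F : E → ℝ} (hk : Integrable k) (hF : Integrable F) :
    Integrable fun p : E × E => k (p.1 - p.2) * F p.2 := by
  refine (hF.convolution_integrand (ContinuousLinearMap.mul ℝ ℝ) hk).congr (.of_forall fun p => ?_)
  simp [mul_comm]

lemma memLp_inv_cube : MemLp (fun x : E => ((1 + ‖x‖) ^ 3)⁻¹) 2 volume := by
  rw [memLp_two_iff_integrable_sq (Measurable.aestronglyMeasurable (by fun_prop))]
  refine (integrable_one_add_norm (E := E) (r := 6) (by rw [finrank_E]; norm_num)).congr
    (.of_forall fun x => ?_)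
  simp only
  rw [Real.rpow_neg (by positivity)]
  norm_cast
  rw [inv_pow, ← pow_mul]

lemma one_add_norm_le_mul (x y : E) : 1 + ‖x‖ ≤ (1 + ‖x - y‖) * (1 + ‖y‖) := by
  have : ‖x‖ ≤ ‖x - y‖ + ‖y‖ := by simpa using norm_add_le (x - y) y
  nlinarith [norm_nonneg (x - y), norm_nonneg y]

lemma inv_cube_sub_le (x y : E) :
    ((1 + ‖x - y‖) ^ 3)⁻¹ ≤ ((1 + ‖x‖) ^ 3)⁻¹ * (1 + ‖y‖) ^ 3 := by
  have h := pow_le_pow_left₀ (by positivity) (one_add_norm_le_mul x y) 3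
  rw [mul_pow] at h
  rw [inv_mul_eq_div, le_div_iff₀ (by positivity), inv_mul_le_iff₀ (by positivity)]
  exact h

lemma HasMoments.integrable_inv_cube_mul {f : E → ℂ} (hf : HasMoments 3 f) (x : E) :
    Integrable (fun y => ((1 + ‖x - y‖) ^ 3)⁻¹ * ‖f y‖) ∧
    ∫ y, ((1 + ‖x - y‖) ^ 3)⁻¹ * ‖f y‖ ≤ ((1 + ‖x‖) ^ 3)⁻¹ * ∫ y, (1 + ‖y‖) ^ 3 * ‖f y‖ := by
  have hle : ∀ y, ((1 + ‖x - y‖) ^ 3)⁻¹ * ‖f y‖ ≤ ((1 + ‖x‖) ^ 3)⁻¹ * ((1 + ‖y‖) ^ 3 * ‖f y‖) := by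
    intro y
    rw [← mul_assoc]
    exact mul_le_mul_of_nonneg_right (inv_cube_sub_le x y) (norm_nonneg _)
  have hi : Integrable fun y => ((1 + ‖x‖) ^ 3)⁻¹ * ((1 + ‖y‖) ^ 3 * ‖f y‖) := hf.2.const_mul _
  have hi' : Integrable (fun y => ((1 + ‖x - y‖) ^ 3)⁻¹ * ‖f y‖) := by
    refine hi.mono' ((Measurable.aestronglyMeasurable (by fun_prop)).mul hf.1.norm)
      (.of_forall fun y => ?_)
    rw [Real.norm_of_nonneg (by positivity)]
    exact hle y
  refine ⟨hi', (integral_mono hi' hi hle).trans (le_of_eq ?_)⟩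
  rw [integral_const_mul]

/-- Densities whose logarithmic potentials are controlled up to second derivatives. -/
structure IsDensity (f : E → ℂ) : Prop where
  hasMoments : HasMoments 3 f
  exists_nearPow : ∃ s : ℝ, 0 < s ∧ s ≤ 1 ∧ ∃ C : ℝ, ∀ x,
    Integrable (fun y => nearPow s (x - y) * ‖f y‖) ∧ ∫ y, nearPow s (x - y) * ‖f y‖ ≤ C

/-- The potential of `|f|` with kernel `majKer`. -/
def majPot (f : E → ℂ) (x : E) : ℝ := ∫ y, majKer (x - y) * ‖f y‖

lemma majPot_nonneg (f : E → ℂ) (x : E) : 0 ≤ majPot f x :=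
  integral_nonneg fun _ => mul_nonneg (majKer_nonneg _) (norm_nonneg _)

namespace IsDensity

variable {f : E → ℂ}

lemma integrable (hf : IsDensity f) : Integrable f := hf.hasMoments.integrable

lemma integrable_nearPow_two (hf : IsDensity f) :
    Integrable fun p : E × E => nearPow 2 (p.1 - p.2) * ‖f p.2‖ :=
  integrable_kernel_mul (integrable_nearPow (by norm_num)) hf.integrable.norm

/-- The singularity is shared: |z|⁻⁴ = |z|^(s-4) |z|^(-s). By Cauchy-Schwarz the squared potential
is at most the potential with exponent 4 - s, integrable in x because 4 - s < 4, times the uniformly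
bounded one with exponent s. -/
lemma memLp_nearPow_two (hf : IsDensity f) :
    MemLp (fun x => ∫ y, nearPow 2 (x - y) * ‖f y‖) 2 volume := by
  obtain ⟨s, hs, hs1, C, hC⟩ := hf.exists_nearPow
  have hp := integrable_kernel_mul (integrable_nearPow (s := 4 - s) (by linarith)) hf.integrable.norm
  have h2 := hf.integrable_nearPow_two
  rw [memLp_two_iff_integrable_sq h2.1.integral_prod_right']
  refine (hp.integral_prod_left.mul_const C).mono' (h2.1.integral_prod_right'.pow 2) ?_
  filter_upwards [hp.prod_right_ae, h2.prod_right_ae] with x hx1 hx2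
  rw [Real.norm_of_nonneg (by positivity)]
  refine (sq_integral_le hx1 (hC x).1 hx2 (fun y => mul_nonneg (nearPow_nonneg _ _) (norm_nonneg _))
    (fun y => mul_nonneg (nearPow_nonneg _ _) (norm_nonneg _)) fun y => ?_).trans ?_
  · rw [mul_pow, nearPow_two_sq (s := s) (by linarith)]; ring
  · exact mul_le_mul_of_nonneg_left (hC x).2 (integral_nonneg fun y =>
      mul_nonneg (nearPow_nonneg _ _) (norm_nonneg _))

lemma ae_integrable_majKer (hf : IsDensity f) :
    ∀ᵐ x, Integrable fun y => majKer (x - y) * ‖f y‖ := by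
  filter_upwards [hf.integrable_nearPow_two.prod_right_ae] with x hx
  refine (hx.add (hf.hasMoments.integrable_inv_cube_mul x).1).congr (.of_forall fun y => ?_)
  simp only [Pi.add_apply, majKer]
  ring

lemma memLp_majPot (hf : IsDensity f) : MemLp (majPot f) 2 volume := by
  have h1 := hf.memLp_nearPow_two.add
    (memLp_inv_cube.mul_const (∫ y, (1 + ‖y‖) ^ 3 * ‖f y‖))
  have hm : AEStronglyMeasurable (fun p : E × E => majKer (p.1 - p.2) * ‖f p.2‖)
      (volume.prod volume) :=
    (measurable_majKer.comp (measurable_fst.sub measurable_snd)).aestronglyMeasurable.mul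
      hf.hasMoments.1.norm.comp_snd
  refine h1.mono hm.integral_prod_right' ?_
  filter_upwards [hf.integrable_nearPow_two.prod_right_ae] with x hx
  obtain ⟨i1, h2⟩ := hf.hasMoments.integrable_inv_cube_mul x
  have h3 : majPot f x = ∫ y, (nearPow 2 (x - y) * ‖f y‖ + ((1 + ‖x - y‖) ^ 3)⁻¹ * ‖f y‖) :=
    integral_congr_ae (.of_forall fun y => by simp only [majKer]; ring)
  have h4 : 0 ≤ ∫ y, nearPow 2 (x - y) * ‖f y‖ := integral_nonneg fun y =>
    mul_nonneg (nearPow_nonneg _ _) (norm_nonneg _)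
  rw [Real.norm_of_nonneg (majPot_nonneg f x), h3, integral_add hx i1]
  refine le_trans ?_ (le_abs_self _)
  simpa using h2

end IsDensity

/-! ### The Laplacian of the potential -/

/-- The Laplacian of the logarithmic potential of `f`. -/
def lapPot (f : E → ℂ) (x : E) : ℂ := -∫ y, gam (x - y) * f y

/-- A difference of inverse squares gains one power of decay in x, at the price of powers of 1 +
|y|. -/
lemma inv_sq_sub_le (x y : E) : |(1 + ‖x - y‖ ^ 2)⁻¹ - (1 + ‖x‖ ^ 2)⁻¹| ≤
    8 * ((1 + ‖x‖) ^ 3)⁻¹ * (1 + ‖y‖) ^ 3 := by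
  set r := ‖x‖ with hr
  set t := ‖x - y‖ with ht
  set u := ‖y‖ with hu
  have hr0 : 0 ≤ r := norm_nonneg _
  have ht0 : 0 ≤ t := norm_nonneg _
  have hu0 : 0 ≤ u := norm_nonneg _
  have h1 : |r - t| ≤ u := by simpa [hr, ht, hu] using abs_norm_sub_norm_le x (x - y)
  have h2 : 1 + r ≤ (1 + t) * (1 + u) := one_add_norm_le_mul x y
  have e1 : (1 + t ^ 2)⁻¹ - (1 + r ^ 2)⁻¹ = (r - t) * ((r + t) / ((1 + t ^ 2) * (1 + r ^ 2))) := by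
    field_simp; ring
  have h3 : (1 + r) ^ 2 ≤ 2 * (1 + r ^ 2) := by nlinarith [sq_nonneg (1 - r)]
  have h4 : (1 + t) ^ 2 ≤ 2 * (1 + t ^ 2) := by nlinarith [sq_nonneg (1 - t)]
  have h5 : (r + t) / ((1 + t ^ 2) * (1 + r ^ 2)) ≤ 8 * ((1 + r) ^ 3)⁻¹ * (1 + u) ^ 2 := by
    have a1 : (1 + t) ^ 2 * (1 + r) ^ 2 ≤ 4 * ((1 + t ^ 2) * (1 + r ^ 2)) := by
      calc (1 + t) ^ 2 * (1 + r) ^ 2 ≤ (2 * (1 + t ^ 2)) * (2 * (1 + r ^ 2)) :=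
            mul_le_mul h4 h3 (by positivity) (by positivity)
        _ = _ := by ring
    have a2 : (r + t) * (1 + r) ≤ 2 * (1 + t) ^ 2 * (1 + u) ^ 2 := by
      have b1 : r + t ≤ 2 * ((1 + t) * (1 + u)) := by nlinarith
      calc (r + t) * (1 + r) ≤ (2 * ((1 + t) * (1 + u))) * ((1 + t) * (1 + u)) :=
            mul_le_mul b1 h2 (by positivity) (by positivity)
        _ = _ := by ring
    rw [div_le_iff₀ (by positivity)]
    have a3 : (r + t) * (1 + r) ^ 3 ≤ 8 * (1 + u) ^ 2 * ((1 + t ^ 2) * (1 + r ^ 2)) := by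
      calc (r + t) * (1 + r) ^ 3 = ((r + t) * (1 + r)) * (1 + r) ^ 2 := by ring
        _ ≤ (2 * (1 + t) ^ 2 * (1 + u) ^ 2) * (1 + r) ^ 2 := by gcongr
        _ = 2 * (1 + u) ^ 2 * ((1 + t) ^ 2 * (1 + r) ^ 2) := by ring
        _ ≤ 2 * (1 + u) ^ 2 * (4 * ((1 + t ^ 2) * (1 + r ^ 2))) := by gcongr
        _ = _ := by ring
    have a4 : 8 * ((1 + r) ^ 3)⁻¹ * (1 + u) ^ 2 * ((1 + t ^ 2) * (1 + r ^ 2)) =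
        8 * (1 + u) ^ 2 * ((1 + t ^ 2) * (1 + r ^ 2)) / (1 + r) ^ 3 := by
      field_simp
    rw [a4, le_div_iff₀ (by positivity)]
    exact a3
  rw [e1, abs_mul, abs_of_nonneg (by positivity : 0 ≤ (r + t) / ((1 + t ^ 2) * (1 + r ^ 2)))]
  calc |r - t| * ((r + t) / ((1 + t ^ 2) * (1 + r ^ 2)))
      ≤ u * (8 * ((1 + r) ^ 3)⁻¹ * (1 + u) ^ 2) := mul_le_mul h1 h5 (by positivity) hu0
    _ ≤ (1 + u) * (8 * ((1 + r) ^ 3)⁻¹ * (1 + u) ^ 2) := by gcongr; linarith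
    _ = _ := by ring

lemma inv_sq_sub_inv_le (z : E) : |(‖z‖ ^ 2)⁻¹ - (1 + ‖z‖ ^ 2)⁻¹| ≤ 8 * majKer z := by
  have h0 := nearPow_nonneg 2 z
  rcases (norm_nonneg z).eq_or_lt with hz | hz
  · rw [← hz]
    have : ((1 + ‖z‖) ^ 3)⁻¹ = 1 := by rw [← hz]; norm_num
    rw [majKer, this]
    norm_num
    linarith
  have h1 : (1 + ‖z‖ ^ 2)⁻¹ ≤ (‖z‖ ^ 2)⁻¹ := by gcongr; linarith
  rw [abs_of_nonneg (by linarith)]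
  rcases lt_or_ge ‖z‖ 1 with h | h
  · have h2 : nearPow 2 z = (‖z‖ ^ 2)⁻¹ := by
      rw [nearPow, if_pos h, Real.rpow_neg hz.le]; norm_cast
    have h3 : 0 ≤ (1 + ‖z‖ ^ 2)⁻¹ := by positivity
    have h4 : 0 ≤ ((1 + ‖z‖) ^ 3)⁻¹ := by positivity
    rw [majKer, h2]
    have : 0 ≤ (‖z‖ ^ 2)⁻¹ := by positivity
    linarith
  · have h2 : (‖z‖ ^ 2)⁻¹ - (1 + ‖z‖ ^ 2)⁻¹ ≤ (‖z‖ ^ 3)⁻¹ := by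
      have : (‖z‖ ^ 2)⁻¹ - (1 + ‖z‖ ^ 2)⁻¹ = (‖z‖ ^ 2 * (1 + ‖z‖ ^ 2))⁻¹ := by field_simp; ring
      rw [this]
      gcongr
      rw [pow_succ ‖z‖ 2]
      gcongr
      nlinarith
    have h3 : (‖z‖ ^ 3)⁻¹ ≤ 8 * ((1 + ‖z‖) ^ 3)⁻¹ := by
      rw [← div_eq_mul_inv, inv_eq_one_div, div_le_div_iff₀ (by positivity) (by positivity)]
      have := pow_le_pow_left₀ (by positivity) (show 1 + ‖z‖ ≤ 2 * ‖z‖ by linarith) 3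
      rw [mul_pow] at this
      linarith
    rw [majKer]
    linarith

lemma measurable_gam : Measurable gam := by
  unfold gam
  exact Complex.measurable_ofReal.comp (by fun_prop)

namespace IsDensity

variable {f : E → ℂ}

lemma aesm_gam_mul (hf : IsDensity f) :
    AEStronglyMeasurable (fun p : E × E => gam (p.1 - p.2) * f p.2) (volume.prod volume) :=
  (measurable_gam.comp (measurable_fst.sub measurable_snd)).aestronglyMeasurable.mul
    hf.hasMoments.1.comp_snd

/-- The decay (1 + |x|²)⁻¹ alone is not square integrable on ℝ⁴. It is subtracted from the kernel at
no cost because f has mean zero, and passing through (1 + |x - y|²)⁻¹ separates the singularity from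
the gain at infinity. -/
lemma norm_lapPot_le (hf : IsDensity f) (h0 : ∫ y, f y = 0) : ∀ᵐ x, ‖lapPot f x‖ ≤
    1 / (4 * Real.pi ^ 2) * (8 * majPot f x +
      8 * ((1 + ‖x‖) ^ 3)⁻¹ * ∫ y, (1 + ‖y‖) ^ 3 * ‖f y‖) := by
  filter_upwards [hf.ae_integrable_majKer] with x hx
  set c : ℝ := 1 / (4 * Real.pi ^ 2) with hc
  have hc0 : 0 ≤ c := by positivity
  have k1 : Integrable fun y =>
      (((‖x - y‖ ^ 2)⁻¹ - (1 + ‖x - y‖ ^ 2)⁻¹ : ℝ) : ℂ) * f y := by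
    refine (hx.const_mul 8).mono' ((Complex.measurable_ofReal.comp
      (by fun_prop)).aestronglyMeasurable.mul hf.hasMoments.1) (.of_forall fun y => ?_)
    rw [norm_mul, Complex.norm_real, ← mul_assoc]
    exact mul_le_mul_of_nonneg_right (inv_sq_sub_inv_le _) (norm_nonneg _)
  have k2 : Integrable fun y => (((1 + ‖x - y‖ ^ 2)⁻¹ - (1 + ‖x‖ ^ 2)⁻¹ : ℝ) : ℂ) * f y := by
    refine (hf.hasMoments.2.const_mul (8 * ((1 + ‖x‖) ^ 3)⁻¹)).mono' ((Complex.measurable_ofReal.comp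
      (by fun_prop)).aestronglyMeasurable.mul hf.hasMoments.1) (.of_forall fun y => ?_)
    rw [norm_mul, Complex.norm_real, ← mul_assoc]
    exact mul_le_mul_of_nonneg_right (inv_sq_sub_le _ _) (norm_nonneg _)
  have k3 : Integrable fun y => (((1 + ‖x‖ ^ 2)⁻¹ : ℝ) : ℂ) * f y := hf.integrable.const_mul _
  have k12 : Integrable fun y => (((‖x - y‖ ^ 2)⁻¹ - (1 + ‖x - y‖ ^ 2)⁻¹ : ℝ) : ℂ) * f y +
    (((1 + ‖x - y‖ ^ 2)⁻¹ - (1 + ‖x‖ ^ 2)⁻¹ : ℝ) : ℂ) * f y := k1.add k2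
  have e1 : lapPot f x = -((c : ℂ) *
      ((∫ y, (((‖x - y‖ ^ 2)⁻¹ - (1 + ‖x - y‖ ^ 2)⁻¹ : ℝ) : ℂ) * f y) +
        ∫ y, (((1 + ‖x - y‖ ^ 2)⁻¹ - (1 + ‖x‖ ^ 2)⁻¹ : ℝ) : ℂ) * f y)) := by
    have h1 : ∫ y, (((1 + ‖x‖ ^ 2)⁻¹ : ℝ) : ℂ) * f y = 0 := by rw [integral_const_mul, h0, mul_zero]
    rw [lapPot, ← add_zero (_ + _), ← h1, ← integral_add k1 k2, ← integral_add k12 k3,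
      ← integral_const_mul]
    congr 1
    refine integral_congr_ae (.of_forall fun y => ?_)
    simp only [gam, hc]
    push_cast
    ring
  rw [e1, norm_neg, norm_mul, Complex.norm_real, Real.norm_of_nonneg hc0]
  refine mul_le_mul_of_nonneg_left ((norm_add_le _ _).trans (add_le_add ?_ ?_)) hc0
  · rw [majPot, ← integral_const_mul]
    refine norm_integral_le_of_norm_le (hx.const_mul 8) (.of_forall fun y => ?_)
    rw [norm_mul, Complex.norm_real, ← mul_assoc]
    exact mul_le_mul_of_nonneg_right (inv_sq_sub_inv_le _) (norm_nonneg _)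
  · rw [← integral_const_mul]
    refine norm_integral_le_of_norm_le (hf.hasMoments.2.const_mul _) (.of_forall fun y => ?_)
    rw [norm_mul, Complex.norm_real, ← mul_assoc]
    exact mul_le_mul_of_nonneg_right (inv_sq_sub_le _ _) (norm_nonneg _)

lemma memLp_lapPot (hf : IsDensity f) (h0 : ∫ y, f y = 0) : MemLp (lapPot f) 2 volume := by
  have h1 := ((hf.memLp_majPot.const_mul 8).add
    ((memLp_inv_cube.const_mul 8).mul_const (∫ y, (1 + ‖y‖) ^ 3 * ‖f y‖))).const_mul
    (1 / (4 * Real.pi ^ 2))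
  refine h1.mono hf.aesm_gam_mul.integral_prod_right'.neg ?_
  filter_upwards [hf.norm_lapPot_le h0] with x hx
  exact hx.trans (le_abs_self _)

lemma integrable_gam_mul_test (hf : IsDensity f) {ψ : E → ℂ} (hψ : IsTest ψ) :
    Integrable fun p : E × E => gam (p.1 - p.2) * f p.2 * ψ p.1 := by
  obtain ⟨B, hB⟩ := hψ.2.exists_bound_of_continuous hψ.continuous
  have i1 := hf.integrable_nearPow_two.const_mul B
  have i2 : Integrable fun p : E × E => ‖ψ p.1‖ * ‖f p.2‖ :=
    hψ.integrable.norm.mul_prod hf.integrable.norm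
  refine ((i1.add i2).const_mul (1 / (4 * Real.pi ^ 2))).mono' (hf.aesm_gam_mul.mul
    (hψ.continuous.comp continuous_fst).aestronglyMeasurable) (.of_forall fun p => ?_)
  set z := p.1 - p.2 with hz
  have h1 : (‖z‖ ^ 2)⁻¹ ≤ nearPow 2 z + 1 := by
    rcases lt_or_ge ‖z‖ 1 with h | h
    · rw [nearPow, if_pos h]
      have : ‖z‖ ^ (-2 : ℝ) = (‖z‖ ^ 2)⁻¹ := by
        rw [Real.rpow_neg (norm_nonneg z)]; norm_cast
      rw [this]; linarith
    · have := nearPow_nonneg 2 z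
      have h2 : (‖z‖ ^ 2)⁻¹ ≤ 1 := inv_le_one_of_one_le₀ (one_le_pow₀ h)
      linarith
  rw [norm_mul, norm_mul, gam, Complex.norm_real, Real.norm_of_nonneg (by positivity)]
  simp only [Pi.add_apply]
  rw [mul_assoc, mul_assoc]
  refine mul_le_mul_of_nonneg_left ?_ (by positivity)
  have h2 := hB p.1
  have h3 := nearPow_nonneg 2 z
  calc (‖z‖ ^ 2)⁻¹ * (‖f p.2‖ * ‖ψ p.1‖) ≤ (nearPow 2 z + 1) * (‖f p.2‖ * ‖ψ p.1‖) := by gcongr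
    _ = nearPow 2 z * ‖f p.2‖ * ‖ψ p.1‖ + ‖ψ p.1‖ * ‖f p.2‖ := by ring
    _ ≤ nearPow 2 z * ‖f p.2‖ * B + ‖ψ p.1‖ * ‖f p.2‖ := by gcongr
    _ = _ := by ring

lemma integral_lapPot_mul (hf : IsDensity f) {ψ : E → ℂ} (hψ : IsTest ψ) :
    ∫ x, lapPot f x * ψ x = ∫ y, f y * -∫ x, gam (x - y) * ψ x := by
  simp only [lapPot, neg_mul, mul_neg, integral_neg, ← integral_mul_const]
  rw [integral_integral_swap (hf.integrable_gam_mul_test hψ)]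
  congr 1
  refine integral_congr_ae (.of_forall fun y => ?_)
  dsimp only
  rw [← integral_const_mul]
  exact integral_congr_ae (.of_forall fun x => by dsimp only; ring)

lemma hasWeakLaplacian_lapPot (hf : IsDensity f) : HasWeakLaplacian (lapPot f) f := by
  intro ψ hψ
  rw [hf.integral_lapPot_mul hψ.lap]
  refine integral_congr_ae (.of_forall fun y => ?_)
  dsimp only
  have h1 := hψ.comp_affine (c := 1) one_ne_zero y
  have h2 := integral_gam_lap h1
  rw [lap_comp_affine hψ.1] at h2
  simp only [Complex.ofReal_one, one_pow, one_mul, one_smul, zero_add] at h2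
  rw [← integral_sub_right_eq_self (fun x => gam x * Δ ψ (x + y)) y] at h2
  simp only [sub_add_cancel] at h2
  rw [h2, neg_neg]

end IsDensity

/-! ### Green's formula for weak Laplacians -/

lemma HasWeakLaplacian.conj {u g : E → ℂ} (h : HasWeakLaplacian u g) :
    HasWeakLaplacian (fun x => conj (u x)) fun x => conj (g x) := by
  intro ψ hψ
  have h1 := congrArg conj (h _ hψ.conj)
  rw [lap_conj hψ.1, ← integral_conj, ← integral_conj] at h1
  simpa using h1

lemma cnv_reflect (a φ : E → ℂ) : cnv (fun z => a (-z)) φ =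
    fun x => cnv a (fun x => φ ((-1 : ℝ) • x + 0)) ((-1 : ℝ) • x + 0) := by
  ext x
  rw [cnv, cnv, ← integral_neg_eq_self]
  refine integral_congr_ae (.of_forall fun y => ?_)
  simp only [neg_neg, neg_smul, one_smul, add_zero, sub_neg_eq_add, neg_sub]
  congr 2
  abel

lemma contDiffOn_gam : ContDiffOn ℝ ∞ gam {0}ᶜ := by
  refine Complex.ofRealCLM.contDiff.comp_contDiffOn (contDiffOn_const.mul ?_)
  exact ContDiffOn.inv (contDiff_norm_sq ℝ).contDiffOn fun x hx => by simpa using hx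

/-- A parametrix of the Laplacian, with its reflection. -/
theorem exists_lap_parametrix : ∃ θ κ : E → ℂ, Integrable θ ∧ HasCompactSupport θ ∧
    (∃ C : ℝ, 0 ≤ C ∧ ∀ z, ‖θ z‖ ≤ C * majKer z) ∧ IsTest κ ∧
    (∀ φ, IsTest φ → Δ (cnv θ φ) = fun y => φ y + cnv κ φ y) ∧
    ∀ φ, IsTest φ → Δ (cnv (fun z => θ (-z)) φ) = fun y => φ y + cnv (fun z => κ (-z)) φ y := by
  obtain ⟨θ, κ, hθ, hc, hb, hκ, hid⟩ := exists_parametrix (N := fun x => -gam x)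
    locallyIntegrable_gam.neg contDiffOn_gam.neg 1 fun φ hφ => by
      have := integral_gam_lap hφ
      simp only [neg_mul, integral_neg]
      change -∫ x, gam x * Δ φ x = φ 0
      rw [this, neg_neg]
  have hid1 : ∀ φ, IsTest φ → Δ (cnv θ φ) = fun y => φ y + cnv κ φ y := hid
  refine ⟨θ, κ, hθ, hc, ?_, hκ, hid1, fun φ hφ => ?_⟩
  · obtain ⟨R, hR⟩ := hc.isCompact.isBounded.exists_norm_le
    set c : ℝ := 1 / (4 * Real.pi ^ 2) with hcdef
    have hc0 : 0 ≤ c := by positivity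
    -- Near the origin θ is dominated by the inverse square part of `majKer`; for 1 ≤ |z| ≤ |R| the
    -- inverse cube part is at least (1 + |R|)⁻³.
    refine ⟨c * (1 + (1 + |R|) ^ 3), by positivity, fun z => ?_⟩
    by_cases hz : z ∈ tsupport θ
    · have h1 : ‖θ z‖ ≤ c * (‖z‖ ^ 2)⁻¹ := by
        refine (hb z).trans ?_
        rw [norm_neg, gam, Complex.norm_real, Real.norm_of_nonneg (by positivity)]
      rw [mul_assoc]
      refine h1.trans (mul_le_mul_of_nonneg_left ?_ hc0)
      have hn := nearPow_nonneg 2 z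
      have hzR : ‖z‖ ≤ |R| := (hR z hz).trans (le_abs_self R)
      have h2 : 0 ≤ ((1 + ‖z‖) ^ 3)⁻¹ := by positivity
      have h3 : 0 ≤ (1 + |R|) ^ 3 := by positivity
      rw [majKer]
      rcases lt_or_ge ‖z‖ 1 with h | h
      · have h4 : nearPow 2 z = (‖z‖ ^ 2)⁻¹ := by
          rw [nearPow, if_pos h, Real.rpow_neg (norm_nonneg z)]; norm_cast
        rw [← h4]
        nlinarith [mul_nonneg h3 hn, mul_nonneg h3 h2]
      · have h4 : (‖z‖ ^ 2)⁻¹ ≤ 1 := inv_le_one_of_one_le₀ (one_le_pow₀ h)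
        have h5 : 1 ≤ (1 + |R|) ^ 3 * ((1 + ‖z‖) ^ 3)⁻¹ := by
          rw [← div_eq_mul_inv, one_le_div (by positivity)]
          gcongr
        nlinarith [mul_nonneg h3 hn]
    · rw [image_eq_zero_of_notMem_tsupport hz, norm_zero]
      exact mul_nonneg (by positivity) (majKer_nonneg z)
  · have h1 := hφ.comp_affine (c := -1) (by norm_num) 0
    have h2 := contDiff_cnv hθ.locallyIntegrable h1
    rw [cnv_reflect, lap_comp_affine h2, hid1 _ h1, cnv_reflect]
    ext x
    simp

/-- The definition of h = Δψ is tested against θ ∗ φ, whose Laplacian is φ + κ ∗ φ. -/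
lemma HasWeakLaplacian.ae_eq_corr {ψ h θ κ : E → ℂ} (hψ : LocallyIntegrable ψ)
    (hh : LocallyIntegrable h) (w : HasWeakLaplacian ψ h) (hθ : Integrable θ)
    (hc : HasCompactSupport θ) (hκ : IsTest κ)
    (hid : ∀ φ, IsTest φ → Δ (cnv θ φ) = fun y => φ y + cnv κ φ y) :
    ψ =ᵐ[volume] fun y => corr h θ y - corr ψ κ y := by
  have l1 := locallyIntegrable_corr hh hθ hc
  have l2 := locallyIntegrable_corr hψ hκ.integrable hκ.2
  refine ae_eq_of_test hψ (l1.sub l2) fun φ hφ => ?_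
  have i1 := integrable_mul_test l1 hφ
  have i2 := integrable_mul_test l2 hφ
  have i3 := integrable_mul_test hψ hφ
  have i4 := integrable_mul_test hψ (hφ.cnv hκ.integrable.locallyIntegrable hκ.2)
  have h1 := w _ (hφ.cnv hθ.locallyIntegrable hc)
  rw [hid φ hφ, integral_mul_cnv hh hθ hc hφ] at h1
  simp only [mul_add, sub_mul] at h1 ⊢
  rw [integral_add i3 i4, integral_mul_cnv hψ hκ.integrable hκ.2 hφ] at h1
  rw [integral_sub i1 i2, ← h1, add_sub_cancel_right]

lemma corr_swap {a b k : E → ℂ} (h : Integrable fun p : E × E => a p.1 * (k (p.1 - p.2) * b p.2)) :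
    Integrable (fun y => b y * corr a k y) ∧
    Integrable (fun x => a x * corr b (fun z => k (-z)) x) ∧
    ∫ y, b y * corr a k y = ∫ x, a x * corr b (fun z => k (-z)) x := by
  have e1 : ∀ y, ∫ x, a x * (k (x - y) * b y) = b y * corr a k y := by
    intro y
    rw [corr, ← integral_const_mul]
    exact integral_congr_ae (.of_forall fun x => by dsimp only; ring)
  have e2 : ∀ x, ∫ y, a x * (k (x - y) * b y) = a x * corr b (fun z => k (-z)) x := by
    intro x
    rw [corr, ← integral_const_mul]
    refine integral_congr_ae (.of_forall fun y => ?_)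
    dsimp only
    rw [neg_sub]; ring
  refine ⟨h.integral_prod_right.congr (.of_forall e1), h.integral_prod_left.congr (.of_forall e2), ?_⟩
  simp only [← e1, ← e2]
  exact (integral_integral_swap h).symm

lemma integrable_kernel_mul_fst {k F : E → ℝ} (hk : Integrable k) (hF : Integrable F) :
    Integrable fun p : E × E => k (p.1 - p.2) * F p.1 := by
  refine (integrable_kernel_mul hk.comp_neg hF).swap.congr (.of_forall fun p => ?_)
  simp

lemma aesm_kernel {a b k : E → ℂ} (ha : AEStronglyMeasurable a volume)
    (hb : AEStronglyMeasurable b volume) (hk : AEStronglyMeasurable k volume) :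
    AEStronglyMeasurable (fun p : E × E => a p.1 * (k (p.1 - p.2) * b p.2))
      (volume.prod volume) :=
  ha.comp_fst.mul ((hk.comp_quasiMeasurePreserving
    (quasiMeasurePreserving_sub_of_right_invariant volume volume)).mul hb.comp_snd)

/-- From |a||b| ≤ |a|² + |b|² and the integrability of k. -/
lemma integrable_kernel_L2 {a b k : E → ℂ} (ha : MemLp a 2 volume) (hb : MemLp b 2 volume)
    (hk : Integrable k) : Integrable fun p : E × E => a p.1 * (k (p.1 - p.2) * b p.2) := by
  have a2 := (memLp_two_iff_integrable_sq_norm ha.1).1 ha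
  have b2 := (memLp_two_iff_integrable_sq_norm hb.1).1 hb
  have i1 := integrable_kernel_mul_fst hk.norm a2
  have i2 := integrable_kernel_mul hk.norm b2
  refine (i1.add i2).mono' (aesm_kernel ha.1 hb.1 hk.1) (.of_forall fun p => ?_)
  rw [norm_mul, norm_mul]
  simp only [Pi.add_apply]
  have h1 : ‖a p.1‖ * ‖b p.2‖ ≤ ‖a p.1‖ ^ 2 + ‖b p.2‖ ^ 2 := by
    nlinarith [sq_nonneg (‖a p.1‖ - ‖b p.2‖), sq_nonneg ‖a p.1‖, sq_nonneg ‖b p.2‖]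
  have h2 := mul_le_mul_of_nonneg_left h1 (norm_nonneg (k (p.1 - p.2)))
  linarith

lemma integrable_kernel_test {a f κ : E → ℂ} (ha : MemLp a 2 volume) (hf : Integrable f)
    (hκ : IsTest κ) : Integrable fun p : E × E => a p.1 * (κ (p.1 - p.2) * f p.2) := by
  obtain ⟨B, hB⟩ := hκ.2.exists_bound_of_continuous hκ.continuous
  have a2 := (memLp_two_iff_integrable_sq_norm ha.1).1 ha
  have i1 : Integrable fun p : E × E => ‖a p.1‖ ^ 2 * ‖f p.2‖ := a2.mul_prod hf.norm
  have i2 := integrable_kernel_mul hκ.integrable.norm hf.norm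
  refine ((i1.const_mul B).add i2).mono' (aesm_kernel ha.1 hf.1 hκ.continuous.aestronglyMeasurable)
    (.of_forall fun p => ?_)
  rw [norm_mul, norm_mul]
  simp only [Pi.add_apply]
  have h1 : ‖a p.1‖ ≤ ‖a p.1‖ ^ 2 + 1 := by nlinarith [sq_nonneg (‖a p.1‖ - 1), sq_nonneg ‖a p.1‖]
  have h2 := hB (p.1 - p.2)
  have h3 := norm_nonneg (f p.2)
  have h4 := norm_nonneg (κ (p.1 - p.2))
  calc ‖a p.1‖ * (‖κ (p.1 - p.2)‖ * ‖f p.2‖)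
      ≤ (‖a p.1‖ ^ 2 + 1) * (‖κ (p.1 - p.2)‖ * ‖f p.2‖) := by gcongr
    _ = ‖κ (p.1 - p.2)‖ * (‖a p.1‖ ^ 2 * ‖f p.2‖) + ‖κ (p.1 - p.2)‖ * ‖f p.2‖ := by ring
    _ ≤ _ := by gcongr

lemma IsDensity.integrable_kernel {a f θ : E → ℂ} (hf : IsDensity f) (ha : MemLp a 2 volume)
    (hθ : AEStronglyMeasurable θ volume) {C : ℝ} (hb : ∀ z, ‖θ z‖ ≤ C * majKer z) :
    Integrable fun p : E × E => a p.1 * (θ (p.1 - p.2) * f p.2) := by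
  have hm := aesm_kernel ha.1 hf.hasMoments.1 hθ
  have hle : ∀ x y, ‖a x * (θ (x - y) * f y)‖ ≤ ‖a x‖ * (C * (majKer (x - y) * ‖f y‖)) := by
    intro x y
    rw [norm_mul, norm_mul, ← mul_assoc C]
    gcongr
    exact hb _
  have hsec : ∀ᵐ x, Integrable fun y => a x * (θ (x - y) * f y) := by
    filter_upwards [hf.ae_integrable_majKer, hm.prodMk_left] with x hx hmx
    exact ((hx.const_mul C).const_mul ‖a x‖).mono' hmx (.of_forall (hle x))
  refine (integrable_prod_iff hm).2 ⟨hsec, ?_⟩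
  have hi : Integrable fun x => ‖a x‖ * (C * majPot f x) :=
    ha.norm.integrable_mul (hf.memLp_majPot.const_mul C)
  refine hi.mono' hm.norm.integral_prod_right' ?_
  filter_upwards [hf.ae_integrable_majKer, hsec] with x hx hsx
  rw [Real.norm_of_nonneg (integral_nonneg fun y => norm_nonneg _), majPot, ← integral_const_mul,
    ← integral_const_mul]
  exact integral_mono hsx.norm ((hx.const_mul C).const_mul ‖a x‖) (hle x)

lemma HasWeakLaplacian.corr_right {ψ h κ : E → ℂ} (w : HasWeakLaplacian ψ h) (hκ : IsTest κ) (y : E) :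
    corr h κ y = corr ψ (Δ κ) y := by
  have h1 := w _ (hκ.comp_affine (c := 1) one_ne_zero (-y))
  rw [lap_comp_affine hκ.1] at h1
  simp only [Complex.ofReal_one, one_pow, one_mul, one_smul, ← sub_eq_add_neg] at h1
  exact h1.symm

lemma HasWeakLaplacian.corr_left {ψ h κ : E → ℂ} (w : HasWeakLaplacian ψ h) (hκ : IsTest κ) (x : E) :
    corr h (fun z => κ (-z)) x = corr ψ (fun z => Δ κ (-z)) x := by
  have h1 := w _ (hκ.comp_affine (c := -1) (by norm_num) x)
  rw [lap_comp_affine hκ.1] at h1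
  simp only [Complex.ofReal_neg, Complex.ofReal_one, even_two.neg_pow, one_pow, one_mul, neg_smul,
    one_smul, neg_add_eq_sub] at h1
  simpa only [corr, neg_sub] using h1.symm

/-- Substituting the parametrix representation of ψ into ∫ fψ and moving θ onto f by Fubini, the
representation of g produces ∫ gh plus two terms with the smooth kernel κ. Since h = Δψ and f = Δg,
both reduce to the pairing of ψ and g through Δκ, and they cancel. No approximation by test
functions is needed. -/
theorem IsDensity.green {f g ψ h : E → ℂ} (hf : IsDensity f) (hg : MemLp g 2 volume)
    (w₁ : HasWeakLaplacian g f) (hψ : MemLp ψ 2 volume) (hh : MemLp h 2 volume)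
    (w₂ : HasWeakLaplacian ψ h) :
    Integrable (fun x => f x * ψ x) ∧ ∫ x, f x * ψ x = ∫ x, g x * h x := by
  obtain ⟨θ, κ, hθ, hc, ⟨C, hC, hb⟩, hκ, hid, hid'⟩ := exists_lap_parametrix
  have lψ := hψ.locallyIntegrable one_le_two
  have lh := hh.locallyIntegrable one_le_two
  have lg := hg.locallyIntegrable one_le_two
  have hκ' : IsTest fun z => κ (-z) := by
    simpa using hκ.comp_affine (c := -1) (by norm_num) 0
  have R1 := w₂.ae_eq_corr lψ lh hθ hc hκ hid
  have R2 := w₁.ae_eq_corr lg hf.integrable.locallyIntegrable hθ.comp_neg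
    (hc.comp_homeomorph (Homeomorph.neg E)) hκ' hid'
  obtain ⟨s1, s1', e1⟩ := corr_swap (hf.integrable_kernel hh hθ.1 hb)
  obtain ⟨s2, -, e2⟩ := corr_swap (integrable_kernel_test hψ hf.integrable hκ)
  obtain ⟨-, s3, e3⟩ := corr_swap (integrable_kernel_L2 hh hg hκ.integrable)
  obtain ⟨-, -, e4⟩ := corr_swap (integrable_kernel_L2 hψ hg hκ.lap.integrable)
  have h1 : (fun x => f x * ψ x) =ᵐ[volume] fun y => f y * corr h θ y - f y * corr ψ κ y := by
    filter_upwards [R1] with x hx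
    rw [← mul_sub, ← hx]
  have i5 : Integrable fun x => g x * h x := hg.integrable_mul hh
  have h2 : (fun x => h x * corr f (fun z => θ (-z)) x) =ᵐ[volume]
      fun x => g x * h x + h x * corr g (fun z => κ (-z)) x := by
    filter_upwards [R2] with x hx
    have : g x + corr g (fun z => κ (-z)) x = corr f (fun z => θ (-z)) x := by
      nth_rewrite 1 [hx]; ring
    rw [← this]; ring
  refine ⟨(s1.sub s2).congr h1.symm, ?_⟩
  simp only [w₂.corr_right hκ] at e3
  simp only [w₁.corr_left hκ] at e2
  rw [integral_congr_ae h1, integral_sub s1 s2, e1, integral_congr_ae h2, integral_add i5 s3, ← e3,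
    e4, e2, add_sub_cancel_right]

/-! ### Zero energy eigenfunctions -/

section Potential

variable {V : E → ℝ}

lemma LogDecay.isDensity_den (hV : LogDecay 0 V) (hV3 : LogDecay 3 V) (hv : vVec V ≠ 0) {ζ : L2}
    (hζ : ζ ∈ S1 V) : IsDensity (den V ζ) := by
  obtain ⟨M, hM, hf⟩ := hV.norm_vFun_mul_le hv hζ
  obtain ⟨s, hs, hs1, C, hC, h⟩ := hV.exists_nearPow
  simp only [wt_zero, one_mul] at h
  refine ⟨hV.hasMoments_den hV3 hv hζ, s, hs, hs1, M * C, fun x => ?_⟩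
  have hle : ∀ᵐ y, nearPow s (x - y) * ‖den V ζ y‖ ≤ M * (nearPow s (x - y) * |V y|) := by
    filter_upwards [hf] with y hy
    have := mul_le_mul_of_nonneg_left hy (nearPow_nonneg s (x - y))
    rw [den]; linarith
  have hi := (h x).1.const_mul M
  have hi' : Integrable fun y => nearPow s (x - y) * ‖den V ζ y‖ := by
    refine hi.mono' (((measurable_nearPow s).comp
      (measurable_const.sub measurable_id)).aestronglyMeasurable.mul (hV.aesm_den ζ).norm) ?_
    filter_upwards [hle] with y hy
    rwa [Real.norm_of_nonneg (mul_nonneg (nearPow_nonneg _ _) (norm_nonneg _))]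
  refine ⟨hi', (integral_mono_ae hi' hi hle).trans ?_⟩
  rw [integral_const_mul]
  exact mul_le_mul_of_nonneg_left (h x).2 hM

lemma LogDecay.hasWeakLaplacian_N0v (hV : LogDecay 0 V) {ζ : L2} (hf : IsDensity (den V ζ)) :
    HasWeakLaplacian (N0v V ζ) (lapPot (den V ζ)) := by
  intro ψ hψ
  rw [hf.integral_lapPot_mul hψ]
  simp only [N0v, ← integral_mul_const]
  rw [integral_integral_swap (hV.integrable_N0v_mul ζ hψ.lap)]
  refine integral_congr_ae (.of_forall fun y => ?_)
  have h1 := hψ.comp_affine (c := 1) one_ne_zero y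
  have h2 := integral_N0_lap h1
  rw [lap_comp_affine hψ.1] at h2
  simp only [Complex.ofReal_one, one_pow, one_mul, one_smul] at h2
  rw [← integral_sub_right_eq_self (fun x => N0 x * Δ ψ (x + y)) y,
    ← integral_sub_right_eq_self (fun x => gam x * ψ (x + y)) y] at h2
  simp only [sub_add_cancel] at h2
  dsimp only
  rw [← h2, ← integral_const_mul]
  refine integral_congr_ae (.of_forall fun x => ?_)
  simp only [den]
  ring

/-- All three coefficients vanish, so Φ = O(|x|⁻³) lies in L². Its weak Laplacian is the square
integrable `lapPot` of vζ, and since vζ = -VΦ, Green's formula is the equation HΦ = 0 in form sense.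
-/
theorem LogDecay.eigenfunction_Phi (hV : LogDecay 0 V) (hV3 : LogDecay 3 V) (hv : vVec V ≠ 0)
    {ζ : L2} (hζ : ζ ∈ S4 V) (h0 : ζ ≠ 0) :
    HasExpansion (Phi V ζ) 0 0 0 ∧ InNInf V (Phi V ζ) ∧ IsZeroEigenfunction V (Phi V ζ) := by
  obtain ⟨h3, hq⟩ := (hV.mem_S4_iff hV3 hv).1 hζ
  obtain ⟨h2, hd⟩ := (hV.mem_S3_iff hV3 hv).1 h3
  obtain ⟨h1, hc⟩ := (hV.mem_S2_iff hv).1 h2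
  have hd' := dipole_eq_zero_iff.2 hd
  have hq' := quadrupole_eq_zero_iff.2 hq
  have hN := hV.inNInf_Phi hv h1 h0
  have hexp := hV.hasExpansion_Phi hV3 hv h1
  rw [hc, hd', hq'] at hexp
  have hden := hV.isDensity_den hV3 hv h1
  have hmean := integral_den_eq_zero hV h1
  have hPhi : Phi V ζ = N0v V ζ := by
    ext x; rw [Phi_eq, hc, sub_zero]
  have hw : HasWeakLaplacian (Phi V ζ) (lapPot (den V ζ)) := by
    rw [hPhi]; exact hV.hasWeakLaplacian_N0v hden
  have hg := hden.memLp_lapPot hmean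
  refine ⟨hexp, hN, ?_, ?_, lapPot (den V ζ), hg, hw, fun ψ h hψ hh hψh => ?_⟩
  · obtain ⟨φ, -, hφ0, hφ⟩ := hN
    intro hz
    exact hφ0 (Lp.ext ((hφ.symm.trans hz).trans (Lp.coeFn_zero ℂ ∞ (volume : Measure E)).symm))
  · obtain ⟨C, hC, hb⟩ := hV.exists_Phi_decay_three hV3 hv h1 hc hd' hq'
    refine (memLp_inv_cube.const_mul C).mono (hV.aesm_Phi ζ) (.of_forall fun x => ?_)
    refine le_trans ?_ (le_abs_self _)
    rw [← div_eq_mul_inv, le_div_iff₀ (by positivity), mul_comm]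
    exact hb x
  -- The form is sesquilinear while Green's formula is bilinear, hence the conjugate of the
  -- competitor.
  · obtain ⟨i1, e1⟩ := hden.green hg hden.hasWeakLaplacian_lapPot (memLp_conj hψ) (memLp_conj hh)
      hψh.conj
    have hae : (fun x => (V x : ℂ) * Phi V ζ x * conj (ψ x)) =ᵐ[volume]
        fun x => -(den V ζ x * conj (ψ x)) := by
      filter_upwards [hV.vFun_mul_ae hv h1] with x hx
      have : den V ζ x = -((V x : ℂ) * Phi V ζ x) := hx
      rw [this]; ring
    refine ⟨i1.neg.congr hae.symm, ?_⟩
    rw [integral_congr_ae hae, integral_neg, e1, add_neg_cancel]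

end Potential

end Bilaplace

end

/-! ### The main theorem -/

theorem mainTheorem5 (V : Bilaplace.E → ℝ) (hV : Bilaplace.LogDecay 0 V)
    (hV0 : ¬ V =ᵐ[volume] 0) :
    -- the operator `T₀` is well defined
    Bilaplace.IsT0 V (Bilaplace.T0 V) ∧
    -- (1)
    ((Bilaplace.IsSingularAtZero V ↔ Bilaplace.NInf V ≠ ⊥) ∧
      (Bilaplace.IsSingularAtZero V →
        ∃ e : Bilaplace.S1 V ≃L[ℂ] Bilaplace.NInf V,
          (∀ ζ : Bilaplace.S1 V,
            (e ζ : Bilaplace.LInf) =ᵐ[volume] Bilaplace.Phi V (ζ : Bilaplace.L2)) ∧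
          (∀ φ : Bilaplace.NInf V,
            (e.symm φ : Bilaplace.L2) =ᵐ[volume]
              fun x => -((Bilaplace.wFun V x : ℂ) * (φ : Bilaplace.LInf) x)))) ∧
    -- (2)
    (Bilaplace.IsFirstKind V →
      Module.finrank ℂ (Bilaplace.S1 V) = 1 ∧
      ∀ φ ∈ Bilaplace.NInf V, φ ≠ 0 → Bilaplace.IsSWave V φ) ∧
    -- (3)
    (Bilaplace.LogDecay 3 V →
      (∀ ζ ∈ Bilaplace.S1 V, ∃ c₀ a A, Bilaplace.HasExpansion (Bilaplace.Phi V ζ) c₀ a A) ∧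
      (∀ ζ ∈ Bilaplace.S1 V ⊓ (Bilaplace.S2 V)ᗮ, ζ ≠ 0 →
        Bilaplace.IsSWave V (Bilaplace.Phi V ζ)) ∧
      (∀ ζ ∈ Bilaplace.S2 V ⊓ (Bilaplace.S3 V)ᗮ, ζ ≠ 0 →
        Bilaplace.IsPWave V (Bilaplace.Phi V ζ)) ∧
      (∀ ζ ∈ Bilaplace.S3 V ⊓ (Bilaplace.S4 V)ᗮ, ζ ≠ 0 →
        Bilaplace.IsDWave V (Bilaplace.Phi V ζ)) ∧
      (∀ ζ ∈ Bilaplace.S4 V, ζ ≠ 0 →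
        Bilaplace.HasExpansion (Bilaplace.Phi V ζ) 0 0 0 ∧
        Bilaplace.InNInf V (Bilaplace.Phi V ζ) ∧
        Bilaplace.IsZeroEigenfunction V (Bilaplace.Phi V ζ))) := by
  have hv := hV.vVec_ne_zero hV0
  obtain ⟨e, he, he'⟩ := hV.exists_equiv hv
  have hperp : ∀ {K : Submodule ℂ Bilaplace.L2} {ζ : Bilaplace.L2}, ζ ∈ Kᗮ → ζ ≠ 0 → ζ ∉ K :=
    fun h h0 hK => h0 (inner_self_eq_zero.1 ((Submodule.mem_orthogonal _ _).1 h _ hK))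
  refine ⟨hV.isT0_T0, ⟨?_, fun _ => ⟨e, he, he'⟩⟩,
    fun h => ⟨hV.finrank_S1 hv h, fun φ hφ h0 => hV.isSWave_of_isFirstKind hv h hφ h0⟩,
    fun hV3 => ⟨fun ζ hζ => ⟨_, _, _, hV.hasExpansion_Phi hV3 hv hζ⟩,
      fun ζ hζ h0 => hV.isSWave_Phi hv hζ.1 fun hc =>
        hperp hζ.2 h0 ((hV.mem_S2_iff hv).2 ⟨hζ.1, hc⟩),
      fun ζ hζ h0 => hV.isPWave_Phi hV3 hv hζ.1 h0 (hperp hζ.2 h0),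
      fun ζ hζ h0 => hV.isDWave_Phi hV3 hv hζ.1 h0 (hperp hζ.2 h0),
      fun ζ hζ h0 => hV.eigenfunction_Phi hV3 hv hζ h0⟩⟩
  rw [hV.isSingularAtZero_iff, not_iff_not, Submodule.eq_bot_iff, Submodule.eq_bot_iff]
  constructor
  · intro h φ hφ
    have h1 : e.symm ⟨φ, hφ⟩ = 0 := Subtype.ext (h _ (e.symm ⟨φ, hφ⟩).2)
    exact congrArg Subtype.val ((map_eq_zero_iff _ e.symm.injective).1 h1)
  · intro h ζ hζ
    have h1 : e ⟨ζ, hζ⟩ = 0 := Subtype.ext (h _ (e ⟨ζ, hζ⟩).2)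
    exact congrArg Subtype.val ((map_eq_zero_iff _ e.injective).1 h1)
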